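/- Let $p$ be a prime and let $K$ be a complete discrete valuation field with ring of integers $\mathcal O_K$, maximal ideal $\mathfrak m_K$, uniformizer $\pi$ and residue field $F$ of characteristic $p$; assume that $F$ is a finitely generated field extension of a perfect field $F_0$. Let $L/K$ be a finite Galois extension of group $G$ and type (II): writing $\mathcal O_L,\mathfrak m_L,E$ for the ring of integers of $L$, its maximal ideal and its residue field, the ramification index of $L/K$ is $1$ and $E/F$ is non-trivial, purely inseparable and monogenic, say of degree $p^n$. Let $v$ be the normalized valuation (of $L$ and of $K$), choose $h\in\mathcal O_L$ whose residue class $\bar h$ generates $E/F$, let $f\in\mathcal O_K[T]$ be its minimal polynomial over $K$, and put $\bar a_0=\bar h^{p^n}\in F$. *Ramification.* Put $$c=\sup_{\sigma\in G-\{1\}}v(h-\sigma(h))+\sum_{\sigma\in G-\{1\}}v(h-\sigma(h)).$$ Let $\overline K$ be an algebraic closure of $K$. For $r>0$ the (non-logarithmic) Abbes–Saito upper ramification subgroup $G^r\subseteq G$ consists of the $\sigma\in G$ such that, for every $K$-embedding $\iota:L\to\overline K$, the points $\iota(h)$ and $\iota(\sigma(h))$ lie in the same geometric connected component of the affinoid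 $\{z:|z|\le 1,\ v(f(z))\ge r\}$. For $\sigma\in G-\{1\}$ let $u_\sigma\in E^\times$ be the residue class of $(h-\sigma(h))/\pi^{v(h-\sigma(h))}$, and put $u_1=0$. *The groups $S$.* For one-dimensional vector spaces $V_1,V_2$ over a field $k$ put $k\langle V_1,V_2\rangle=\bigoplus_{(i,j)\in\mathbb Z^2}V_1^{\otimes i}\otimes V_2^{\otimes j}$. Let $V=\ker(\Omega^1_F\to\Omega^1_E)$, which is the $F$-line spanned by $d\bar a_0$, and note that $\Omega^1_{E/F}$ is the $E$-line spanned by $d\bar h$. Put $$S_{K,L}=\big(F\langle\mathfrak m_K/\mathfrak m_K^2,\,V\rangle\big)^\times,\qquad S_{L/K}=\big(E\langle\mathfrak m_L/\mathfrak m_L^2,\,\Omega^1_{E/F}\rangle\big)^\times ,$$ both written additively, and write $[x]$ for the class of a non-zero element $x$ of the field, of one of the two lines, or of $K$ (resp. $L$), where $x\in K^\times$ (resp. $L^\times$) is sent to its class in $(\mathfrak m_K/\mathfrak m_K^2)^{\otimes v(x)}$ (resp. $(\mathfrak m_L/\mathfrak m_L^2)^{\otimes v(x)}$). The group $S_{K,L}$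 is regarded as a subgroup of $S_{L/K}$ through the inclusion $F\subseteq E$, the natural map $\mathfrak m_K/\mathfrak m_K^2\to\mathfrak m_L/\mathfrak m_L^2$, and the map $V\to(\Omega^1_{E/F})^{\otimes p^n}$, $y\,d\bar a_0\mapsto y\,(d\bar h)^{\otimes p^n}$. *The Swan conductor.* Let $C$ be an algebraically closed field of characteristic zero, $\widetilde{\mathbb Z}$ the integral closure of $\mathbb Z$ in $C$, and $\psi_0:\mathbb F_p\to C^\times$ a non-trivial character. Put $s_G(\sigma)=[d\bar h]-[h-\sigma(h)]\in S_{L/K}$ for $\sigma\in G-\{1\}$, and $s_G(1)=-\sum_{\sigma\in G-\{1\}}s_G(\sigma)$. For $\xi=\psi_0(1)$ and $\varepsilon(\xi)=\sum_{r\in\mathbb F_p^\times}[r]\otimes\xi^r$, Kato's Swan conductor with differential values of a character $\chi:G\to C^\times$ is $$\mathrm{sw}_{\xi}(\chi)=\sum_{\sigma\in G}s_G(\sigma)\otimes\chi(\sigma)+\Big(1-\frac{1}{\sharp G}\sum_{\sigma\in G}\chi(\sigma)\Big)\,\varepsilon(\xi)\ \in\ S_{L/K}\otimes_{\mathbb Z}\widetilde{\mathbb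 Z}.$$ **Proposition.** Let $\chi:G\to C^\times$ be a character whose restriction to $G^c$ is non-trivial. Then there is a unique homomorphism $\bar\chi:G^c\to\mathbb F_p$ with $\chi|_{G^c}=\psi_0\circ\bar\chi$. Put $\bar f_{c,\bar\chi}(T)=\prod_{\sigma\in\ker\bar\chi}(T+u_\sigma)\in E[T]$. For every $\tau\in G^c$ with $\bar\chi(\tau)=1$, the element $$[\pi^c]+[-\bar f_{c,\bar\chi}^{\,p}(u_\tau)]+\sum_{\sigma\in G-G^c}[u_\sigma]-[d\bar a_0]\ \in\ S_{L/K}$$ belongs to $S_{K,L}$, and $$\mathrm{sw}_{\psi_0(1)}(\chi)=\Big([\pi^c]+[-\bar f_{c,\bar\chi}^{\,p}(u_\tau)]+\sum_{\sigma\in G-G^c}[u_\sigma]-[d\bar a_0]\Big)\otimes 1 .$$ -/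

import Mathlib

open Polynomial IntermediateField IsLocalRing
open scoped KaehlerDifferential TensorProduct

namespace KatoSwan

/-! ## Differentials of purely inseparable extensions

Facts showing that, for `l = k(x)` purely inseparable of degree `q > 1` with `x ^ q = a`, the
kernel of `Ω_k → Ω_l` is the line spanned by `da`, and `dx` spans a non-zero `Ω_{l/k}`. -/

theorem kaehler_D_gen_ne_zero {k : Type*} {l : Type*} [Field k] [Field l] [Algebra k l] 
    [FiniteDimensional k l] [IsPurelyInseparable k l] (x : l) (hx : k⟮x⟯ = ⊤)
    (hne : ¬ Function.Surjective (algebraMap k l)) : KaehlerDifferential.D k l x ≠ 0 := by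
  intro h0
  have hD : KaehlerDifferential.D k l = 0 := by
    have hadj : Algebra.adjoin k {x} = ⊤ := by
      rw [← IntermediateField.adjoin_simple_toSubalgebra_of_isAlgebraic
        (IsIntegral.of_finite k x).isAlgebraic, hx, IntermediateField.top_toSubalgebra]
    apply Derivation.ext_of_adjoin_eq_top _ hadj
    intro y hy
    rw [Set.mem_singleton_iff] at hy
    simp [hy, h0]
  have hsub : Subsingleton (Ω[l⁄k]) := by
    rw [← Submodule.subsingleton_iff l, ← subsingleton_iff_bot_eq_top,
      ← KaehlerDifferential.span_range_derivation]
    symm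
    rw [Submodule.span_eq_bot]
    rintro _ ⟨y, rfl⟩
    simp [hD]
  have : Algebra.FormallyUnramified k l := ⟨hsub⟩
  have : Algebra.IsSeparable k l := Algebra.FormallyUnramified.isSeparable k l
  exact hne (IsPurelyInseparable.surjective_algebraMap_of_isSeparable k l)

theorem kaehler_D_ne_zero_of_not_pow {p : ℕ} [hp : Fact p.Prime] {k : Type*} [Field k] [CharP k p]
    (a : k) (ha : ∀ b : k, b ^ p ≠ a) : KaehlerDifferential.D ℤ k a ≠ 0 := by
  -- a subfield maximal among those containing all p-th powers but not a
  let S : Set (Subfield k) := {M | (frobenius k p).fieldRange ≤ M ∧ a ∉ M}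
  have h0 : (frobenius k p).fieldRange ∈ S := by
    refine ⟨le_rfl, ?_⟩
    rintro ⟨b, hb⟩
    exact ha b hb
  obtain ⟨M, -, hM⟩ := zorn_le_nonempty₀ S (by
    intro c hc hchain y hy
    refine ⟨sSup c, ⟨(hc hy).1.trans (le_sSup hy), ?_⟩, fun z hz => le_sSup hz⟩
    rw [Subfield.mem_sSup_of_directedOn ⟨y, hy⟩ hchain.directedOn]
    rintro ⟨z, hz, haz⟩
    exact (hc hz).2 haz) _ h0
  have hMS := hM.prop
  have hpow : ∀ y : k, ∃ m : M, algebraMap M k m = y ^ p := fun y =>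
    ⟨⟨y ^ p, hMS.1 ⟨y, rfl⟩⟩, rfl⟩
  have hCM : CharP M p := (algebraMap M k).charP (algebraMap M k).injective p
  have hdeg : ∀ y : k, y ∉ M → Module.finrank M M⟮y⟯ = p := by
    intro y hy
    obtain ⟨m, hm⟩ := hpow y
    have hirr : Irreducible (X ^ p - C m : M[X]) := by
      apply X_pow_sub_C_irreducible_of_prime hp.out
      rintro b rfl
      rw [map_pow] at hm
      have : algebraMap M k b = y := frobenius_inj k p hm
      exact hy (this ▸ b.2)
    have hmin : minpoly M y = X ^ p - C m := by
      symm
      apply minpoly.eq_of_irreducible_of_monic hirr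
      · simp [hm]
      · exact monic_X_pow_sub_C m hp.out.ne_zero
    have hint : IsIntegral M y := ⟨X ^ p - C m, monic_X_pow_sub_C m hp.out.ne_zero, by simp [hm]⟩
    rw [IntermediateField.adjoin.finrank hint, hmin, natDegree_X_pow_sub_C]
  have htop : M⟮a⟯ = ⊤ := by
    rw [eq_top_iff]
    intro y _
    by_cases hy : y ∈ M
    · exact IntermediateField.algebraMap_mem M⟮a⟯ ⟨y, hy⟩
    have hay : a ∈ M⟮y⟯ := by
      by_contra hay
      have h1 : (M⟮y⟯).toSubfield ∈ S := by
        refine ⟨fun z hz => ?_, hay⟩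
        exact IntermediateField.algebraMap_mem M⟮y⟯ ⟨z, hMS.1 hz⟩
      have h2 := hM.le_of_ge h1 (fun z hz => IntermediateField.algebraMap_mem M⟮y⟯ ⟨z, hz⟩)
      exact hy (h2 (IntermediateField.mem_adjoin_simple_self M y))
    have hle : M⟮a⟯ ≤ M⟮y⟯ := by
      rw [IntermediateField.adjoin_simple_le_iff]; exact hay
    have hfd : FiniteDimensional M M⟮y⟯ :=
      FiniteDimensional.of_finrank_pos (by rw [hdeg y hy]; exact hp.out.pos)
    rw [IntermediateField.eq_of_le_of_finrank_eq hle (by rw [hdeg y hy, hdeg a hMS.2])]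
    exact IntermediateField.mem_adjoin_simple_self M y
  have hfd : FiniteDimensional M k := by
    apply FiniteDimensional.of_finrank_pos
    rw [← IntermediateField.finrank_top' , ← htop, hdeg a hMS.2]
    exact hp.out.pos
  have hpi : IsPurelyInseparable M k := by
    rw [isPurelyInseparable_iff_pow_mem M p]
    exact fun y => ⟨1, by obtain ⟨m, hm⟩ := hpow y; exact ⟨m, by simpa using hm⟩⟩
  intro hzero
  apply kaehler_D_gen_ne_zero (k := M) a htop
  · intro hs
    obtain ⟨m, hm⟩ := hs a
    exact hMS.2 (hm ▸ m.2)
  · have hmap := KaehlerDifferential.map_D ℤ M k k a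
    rw [hzero, map_zero] at hmap
    exact hmap.symm

theorem ker_kaehlerMap_le_span {k l : Type*} [Field k] [Field l] [Algebra k l] (x : l) (a : k) (q : ℕ)
    (hint : IsIntegral k x)
    (hx : k⟮x⟯ = ⊤) (hmin : minpoly k x = X ^ q - C a) :
    LinearMap.ker (KaehlerDifferential.map ℤ ℤ k l) ≤
      Submodule.span k {KaehlerDifferential.D ℤ k a} := by
  intro w hw
  by_contra hnot
  obtain ⟨f, hf1, hf2⟩ := Submodule.exists_le_ker_of_notMem hnot
  have hfa : f (KaehlerDifferential.D ℤ k a) = 0 := hf2 (Submodule.mem_span_singleton_self _)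
  let δ : Derivation ℤ k k := f.compDer (KaehlerDifferential.D ℤ k)
  let d : Derivation ℤ k[X] k[X] := PolynomialModule.equivPolynomialSelf.compDer δ.mapCoeffs
  have hdC : ∀ y, d (C y) = C (δ y) := by
    intro y
    simp [d]
  have hdX : d X = 0 := by simp [d]
  have hsurj : Function.Surjective ((aeval (R := k) x).restrictScalars ℤ) := by
    rw [AlgHom.coe_restrictScalars', ← AlgHom.range_eq_top, ← Algebra.adjoin_singleton_eq_range_aeval,
      ← IntermediateField.adjoin_simple_toSubalgebra_of_isAlgebraic hint.isAlgebraic, hx,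
      IntermediateField.top_toSubalgebra]
  let e : Derivation ℤ l l := Derivation.liftOfSurjective (d := d) hsurj (by
    intro P hP
    simp only [AlgHom.coe_restrictScalars'] at hP ⊢
    obtain ⟨Q, rfl⟩ := minpoly.dvd k x hP
    have hm0 : aeval x (d (minpoly k x)) = 0 := by
      rw [hmin, map_sub, hdC, Derivation.leibniz_pow, hdX]
      simp [δ, hfa]
    rw [Derivation.leibniz]
    simp [hm0])
  have he : ∀ y : k, e (algebraMap k l y) = algebraMap k l (δ y) := by
    intro y
    have := Derivation.liftOfSurjective_apply hsurj (d := d) (by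
      intro P hP
      simp only [AlgHom.coe_restrictScalars'] at hP ⊢
      obtain ⟨Q, rfl⟩ := minpoly.dvd k x hP
      have hm0 : aeval x (d (minpoly k x)) = 0 := by
        rw [hmin, map_sub, hdC, Derivation.leibniz_pow, hdX]
        simp [δ, hfa]
      rw [Derivation.leibniz]
      simp [hm0]) (C y)
    simpa [hdC] using this
  have key : ∀ v : Ω[k⁄ℤ], e.liftKaehlerDifferential (KaehlerDifferential.map ℤ ℤ k l v) =
      algebraMap k l (f v) := by
    intro v
    have hv : v ∈ Submodule.span k (Set.range (KaehlerDifferential.D ℤ k)) := by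
      rw [KaehlerDifferential.span_range_derivation]; trivial
    induction hv using Submodule.span_induction with
    | mem v hv =>
      obtain ⟨y, rfl⟩ := hv
      rw [KaehlerDifferential.map_D, Derivation.liftKaehlerDifferential_comp_D, he]
      rfl
    | zero => simp
    | add u v _ _ hu hv => simp [hu, hv]
    | smul c v _ hv => 
      rw [LinearMap.map_smul, LinearMap.map_smul,
        ← algebraMap_smul l c (KaehlerDifferential.map ℤ ℤ k l v), LinearMap.map_smul, hv]
      simp
  have := key w
  rw [LinearMap.mem_ker.1 hw, map_zero] at this
  exact hf1 ((map_eq_zero _).1 this.symm)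

/-! ## Purely inseparable monogenic residue extensions -/

/-- `l / k` is a non-trivial, purely inseparable, monogenic field extension, `x` is a generator of
it and `a` is the element `x ^ [l : k]` of `k`. -/
structure IsInsepGenerator (k : Type*) {l : Type*} [Field k] [Field l] [Algebra k l]
    (x : l) (a : k) : Prop where
  isPurelyInseparable : IsPurelyInseparable k l
  not_surjective : ¬ Function.Surjective (algebraMap k l)
  adjoin_eq_top : k⟮x⟯ = ⊤
  pow_eq : x ^ Module.finrank k l = algebraMap k l a

namespace IsInsepGenerator

variable {k l : Type*} [Field k] [Field l] [Algebra k l] {x : l} {a : k}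

theorem finiteDimensional (H : IsInsepGenerator k x a) : FiniteDimensional k l := by
  have := H.isPurelyInseparable
  have hint : IsIntegral k x := this.isIntegral.isIntegral x
  have := IntermediateField.adjoin.finiteDimensional hint
  rw [H.adjoin_eq_top] at this
  exact Module.Finite.equiv (IntermediateField.topEquiv (F := k) (E := l)).toLinearEquiv

theorem exists_minpoly (H : IsInsepGenerator k x a) (p : ℕ) [hp : Fact p.Prime] [CharP k p] :
    ∃ n : ℕ, Module.finrank k l = p ^ (n + 1) ∧ minpoly k x = X ^ p ^ (n + 1) - C a := by
  have := H.isPurelyInseparable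
  have := H.finiteDimensional
  have : ExpChar k p := ExpChar.prime hp.out
  obtain ⟨n, y, hy⟩ := IsPurelyInseparable.minpoly_eq_X_pow_sub_C k p x
  have hfr : Module.finrank k l = p ^ n := by
    rw [← IntermediateField.finrank_top', ← H.adjoin_eq_top,
      IntermediateField.adjoin.finrank (IsIntegral.of_finite k x), hy, natDegree_X_pow_sub_C]
  have hya : y = a := by
    have h1 := minpoly.aeval k x
    rw [hy] at h1
    apply (algebraMap k l).injective
    rw [← H.pow_eq, hfr]
    simp only [map_sub, map_pow, aeval_X, aeval_C] at h1
    exact (sub_eq_zero.1 h1).symm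
  subst hya
  cases n with
  | zero =>
    exfalso
    rw [pow_zero] at hfr
    apply H.not_surjective
    have hbot := IntermediateField.finrank_eq_one_iff.1 (IntermediateField.finrank_top' (F := k) (E := l) |>.trans hfr)
    intro z
    have hz : z ∈ (⊥ : IntermediateField k l) := hbot ▸ IntermediateField.mem_top
    exact IntermediateField.mem_bot.1 hz
  | succ n => exact ⟨n, hfr, hy⟩

theorem D_ne_zero (H : IsInsepGenerator k x a) : KaehlerDifferential.D k l x ≠ 0 :=
  have := H.isPurelyInseparable
  have := H.finiteDimensional
  kaehler_D_gen_ne_zero x H.adjoin_eq_top H.not_surjective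

theorem D_base_ne_zero (H : IsInsepGenerator k x a) (p : ℕ) [hp : Fact p.Prime] [CharP k p] :
    KaehlerDifferential.D ℤ k a ≠ 0 := by
  obtain ⟨n, hfr, hmin⟩ := H.exists_minpoly p
  have := H.finiteDimensional
  apply kaehler_D_ne_zero_of_not_pow (p := p)
  rintro b rfl
  have hl : CharP l p := charP_of_injective_algebraMap (algebraMap k l).injective p
  have hx : x ^ p ^ n = algebraMap k l b := by
    apply frobenius_inj l p
    have := H.pow_eq
    rw [hfr, pow_succ, pow_mul] at this
    simpa [frobenius_def] using this
  have hdvd : minpoly k x ∣ X ^ p ^ n - C b := minpoly.dvd k x (by simp [hx])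
  have := natDegree_le_of_dvd hdvd (X_pow_sub_C_ne_zero (pow_pos hp.out.pos n) b)
  rw [hmin, natDegree_X_pow_sub_C, natDegree_X_pow_sub_C] at this
  exact absurd this (not_le.2 (Nat.pow_lt_pow_right hp.out.one_lt (Nat.lt_succ_self n)))

theorem D_mem_ker (H : IsInsepGenerator k x a) (p : ℕ) [hp : Fact p.Prime] [CharP k p] :
    KaehlerDifferential.D ℤ k a ∈ LinearMap.ker (KaehlerDifferential.map ℤ ℤ k l) := by
  obtain ⟨n, hfr, hmin⟩ := H.exists_minpoly p
  have hl : CharP l p := charP_of_injective_algebraMap (algebraMap k l).injective p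
  rw [LinearMap.mem_ker, KaehlerDifferential.map_D, ← H.pow_eq, hfr, Derivation.leibniz_pow]
  have : ((p ^ (n + 1) : ℕ) : l) = 0 := by simp
  rw [← Nat.cast_smul_eq_nsmul l, this, zero_smul]

theorem ker_eq_span (H : IsInsepGenerator k x a) (p : ℕ) [hp : Fact p.Prime] [CharP k p] :
    LinearMap.ker (KaehlerDifferential.map ℤ ℤ k l) =
      Submodule.span k {KaehlerDifferential.D ℤ k a} := by
  obtain ⟨n, hfr, hmin⟩ := H.exists_minpoly p
  have := H.finiteDimensional
  apply le_antisymm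
  · exact ker_kaehlerMap_le_span x a _ (IsIntegral.of_finite k x) H.adjoin_eq_top hmin
  · rw [Submodule.span_singleton_le_iff_mem]
    exact H.D_mem_ker p

end IsInsepGenerator

noncomputable section

/-! ## The algebras `k⟨V, W⟩` -/

/-- The multiplicative set generated by the non-zero elements of `V` and of `W` in the symmetric
algebra of `V ⊕ W`. -/
def laurentDenominators (k V W : Type*) [Field k] [AddCommGroup V] [Module k V]
    [AddCommGroup W] [Module k W] : Submonoid (SymmetricAlgebra k (V × W)) :=
  Submonoid.closure
    ({x | ∃ v : V, v ≠ 0 ∧ x = SymmetricAlgebra.ι k (V × W) (v, 0)} ∪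
      {x | ∃ w : W, w ≠ 0 ∧ x = SymmetricAlgebra.ι k (V × W) (0, w)})

/-- For one-dimensional `V` and `W`, the algebra `k⟨V, W⟩ = ⨁_{(i, j) ∈ ℤ²} V^{⊗ i} ⊗ W^{⊗ j}`.
As `V` and `W` are lines, `Sym (V ⊕ W)` is the part `i, j ≥ 0` of this sum, and inverting the
non-zero elements of `V` and of `W` gives all of it. -/
def LaurentAlgebra (k V W : Type*) [Field k] [AddCommGroup V] [Module k V]
    [AddCommGroup W] [Module k W] : Type _ :=
  Localization (laurentDenominators k V W)

namespace LaurentAlgebra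

variable (k V W : Type*) [Field k] [AddCommGroup V] [Module k V] [AddCommGroup W] [Module k W]

instance : CommRing (LaurentAlgebra k V W) :=
  inferInstanceAs (CommRing (Localization (laurentDenominators k V W)))

instance : Algebra (SymmetricAlgebra k (V × W)) (LaurentAlgebra k V W) :=
  inferInstanceAs (Algebra _ (Localization (laurentDenominators k V W)))

instance : IsLocalization (laurentDenominators k V W) (LaurentAlgebra k V W) :=
  inferInstanceAs (IsLocalization _ (Localization (laurentDenominators k V W)))

instance : Algebra k (LaurentAlgebra k V W) :=
  ((algebraMap (SymmetricAlgebra k (V × W)) (LaurentAlgebra k V W)).comp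
    (algebraMap k (SymmetricAlgebra k (V × W)))).toAlgebra

instance : IsScalarTower k (SymmetricAlgebra k (V × W)) (LaurentAlgebra k V W) :=
  IsScalarTower.of_algebraMap_eq fun _ => rfl

end LaurentAlgebra

open Classical in
/-- The additively written class `[x]` of a unit `x` of `R` in the group of units of `R`
(and `0` if `x` is not a unit). -/
def unitClass {R : Type*} [CommRing R] (x : R) : Additive Rˣ :=
  if hx : IsUnit x then Additive.ofMul hx.unit else 0

namespace LaurentAlgebra

variable (k V W : Type*) [Field k] [AddCommGroup V] [Module k V] [AddCommGroup W] [Module k W]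

/-- The inclusion of `V ⊕ W` (degrees `(1, 0)` and `(0, 1)`) into `k⟨V, W⟩`. -/
def incl : V × W →ₗ[k] LaurentAlgebra k V W :=
  (Algebra.linearMap (SymmetricAlgebra k (V × W)) (LaurentAlgebra k V W)).restrictScalars k ∘ₗ
    SymmetricAlgebra.ι k (V × W)

variable {k V W}

theorem isUnit_incl_left {v : V} (hv : v ≠ 0) : IsUnit (incl k V W (v, 0)) :=
  IsLocalization.map_units (LaurentAlgebra k V W)
    (⟨_, Submonoid.subset_closure (Or.inl ⟨v, hv, rfl⟩)⟩ : laurentDenominators k V W)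

theorem isUnit_incl_right {w : W} (hw : w ≠ 0) : IsUnit (incl k V W (0, w)) :=
  IsLocalization.map_units (LaurentAlgebra k V W)
    (⟨_, Submonoid.subset_closure (Or.inr ⟨w, hw, rfl⟩)⟩ : laurentDenominators k V W)

/-- The ring homomorphism `k⟨V, W⟩ → k'⟨V', W'⟩` extending `i : k → k'` and two `i`-semilinear maps
on `V` and `W` that send non-zero vectors to units. -/
def mapAlg {k' V' W' : Type*} [Field k'] [AddCommGroup V'] [Module k' V'] [AddCommGroup W']
    [Module k' W'] (i : k →+* k')
    (f : V →+ LaurentAlgebra k' V' W') (g : W →+ LaurentAlgebra k' V' W')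
    (hf : ∀ (c : k) (v : V), f (c • v) = algebraMap k' _ (i c) * f v)
    (hg : ∀ (c : k) (w : W), g (c • w) = algebraMap k' _ (i c) * g w)
    (hf' : ∀ v, v ≠ 0 → IsUnit (f v)) (hg' : ∀ w, w ≠ 0 → IsUnit (g w)) :
    LaurentAlgebra k V W →+* LaurentAlgebra k' V' W' :=
  letI : Algebra k (LaurentAlgebra k' V' W') := ((algebraMap k' _).comp i).toAlgebra
  let φ : V × W →ₗ[k] LaurentAlgebra k' V' W' :=
    { toFun := fun x => f x.1 + g x.2
      map_add' := fun x y => by simp only [Prod.fst_add, Prod.snd_add, map_add]; ring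
      map_smul' := fun c x => by
        simp only [Prod.smul_fst, Prod.smul_snd, hf, hg, RingHom.id_apply, ← mul_add]
        rw [Algebra.smul_def]; rfl }
  IsLocalization.lift (M := laurentDenominators k V W)
    (g := (SymmetricAlgebra.lift φ : SymmetricAlgebra k (V × W) →ₐ[k] _).toRingHom) (by
      rintro ⟨y, hy⟩
      change IsUnit ((SymmetricAlgebra.lift φ) y)
      induction hy using Submonoid.closure_induction with
      | mem y hy =>
        rcases hy with ⟨v, hv, rfl⟩ | ⟨w, hw, rfl⟩
        · simpa [φ] using hf' v hv
        · simpa [φ] using hg' w hw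
      | one => simp
      | mul y z _ _ hy hz => rw [map_mul]; exact hy.mul hz)

end LaurentAlgebra

/-! ## The groups `S_{K,L}` and `S_{L/K}`

`A` and `B` are the rings of integers of `K` and `L`, and `F` and `E` their residue fields. -/

section

variable (A B : Type*) [CommRing A] [IsDomain A] [IsDiscreteValuationRing A]
  [CommRing B] [IsDomain B] [IsDiscreteValuationRing B] [Algebra A B]
  [IsLocalHom (algebraMap A B)]

/-- `V = ker (Ω_F → Ω_E)`, for absolute differentials. -/
abbrev omegaKer : Submodule (ResidueField A) (Ω[ResidueField A⁄ℤ]) :=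
  LinearMap.ker (KaehlerDifferential.map ℤ ℤ (ResidueField A) (ResidueField B))

/-- `F⟨𝔪_K / 𝔪_K², V⟩`. -/
abbrev LowerAlgebra : Type _ :=
  LaurentAlgebra (ResidueField A) (CotangentSpace A) (omegaKer A B)

/-- `E⟨𝔪_L / 𝔪_L², Ω_{E/F}⟩`. -/
abbrev UpperAlgebra : Type _ :=
  LaurentAlgebra (ResidueField B) (CotangentSpace B) (Ω[ResidueField B⁄ResidueField A])

/-- The natural map `𝔪_K / 𝔪_K² → 𝔪_L / 𝔪_L²`. -/
def cotangentMap : CotangentSpace A →ₗ[A] CotangentSpace B :=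
  Ideal.mapCotangent (maximalIdeal A) (maximalIdeal B) (Algebra.ofId A B)
    (fun x hx => by
      rw [mem_maximalIdeal, mem_nonunits_iff] at hx
      rw [Ideal.mem_comap, mem_maximalIdeal, mem_nonunits_iff]
      exact fun hu => hx (isUnit_of_map_unit (algebraMap A B) x hu))

variable {A B}

theorem cotangentMap_residue_smul (a : ResidueField A) (x : CotangentSpace A) :
    cotangentMap A B (a • x) =
      algebraMap (ResidueField A) (ResidueField B) a • cotangentMap A B x := by
  obtain ⟨a, rfl⟩ := residue_surjective a
  have h1 : residue A a • x = a • x := algebraMap_smul (ResidueField A) a x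
  rw [h1, map_smul, ResidueField.algebraMap_residue]
  have h2 : residue B (algebraMap A B a) • cotangentMap A B x =
    algebraMap A B a • cotangentMap A B x := algebraMap_smul (ResidueField B) _ _
  rw [h2, algebraMap_smul]

theorem cotangentMap_ne_zero
    (he : (maximalIdeal A).map (algebraMap A B) = maximalIdeal B) {x : CotangentSpace A}
    (hx : x ≠ 0) : cotangentMap A B x ≠ 0 := by
  obtain ⟨⟨y, hy⟩, rfl⟩ := Ideal.toCotangent_surjective _ x
  rw [Ne, Ideal.toCotangent_eq_zero] at hx
  rw [cotangentMap, Ideal.mapCotangent_toCotangent, Ne, Ideal.toCotangent_eq_zero]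
  intro hmem
  apply hx
  obtain ⟨ϖ, hϖ⟩ := IsDiscreteValuationRing.exists_irreducible A
  have hA := hϖ.maximalIdeal_eq
  have hB : maximalIdeal B = Ideal.span {algebraMap A B ϖ} := by
    rw [← he, hA, Ideal.map_span, Set.image_singleton]
  have hne : algebraMap A B ϖ ≠ 0 := by
    intro h0
    rw [h0, Ideal.span_singleton_eq_bot.2 rfl] at hB
    exact IsDiscreteValuationRing.not_a_field B hB
  change y ∈ maximalIdeal A ^ 2
  change algebraMap A B y ∈ maximalIdeal B ^ 2 at hmem
  rw [hA, Ideal.mem_span_singleton] at hy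
  obtain ⟨z, rfl⟩ := hy
  rw [hB, Ideal.span_singleton_pow, Ideal.mem_span_singleton, map_mul, pow_two] at hmem
  have hdvd := (mul_dvd_mul_iff_left hne).1 hmem
  have hz : z ∈ maximalIdeal A := by
    by_contra hz
    rw [mem_maximalIdeal, mem_nonunits_iff, not_not] at hz
    have hu : IsUnit (algebraMap A B ϖ) := isUnit_of_dvd_unit hdvd (hz.map _)
    have : algebraMap A B ϖ ∈ maximalIdeal B := by rw [hB]; exact Ideal.mem_span_singleton_self _
    exact this hu
  rw [pow_two]
  exact Ideal.mul_mem_mul (by rw [hA]; exact Ideal.mem_span_singleton_self _) hz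

/-- The coordinate of an element of the line `V` in the basis `dā`. -/
def omegaKerCoord (p : ℕ) [Fact p.Prime] [CharP (ResidueField A) p]
    {hb : ResidueField B} {ab : ResidueField A} (H : IsInsepGenerator (ResidueField A) hb ab) :
    omegaKer A B ≃ₗ[ResidueField A] ResidueField A :=
  (LinearEquiv.ofEq _ _ (H.ker_eq_span p)).trans
    (LinearEquiv.toSpanNonzeroSingleton (ResidueField A) _ _ (H.D_base_ne_zero p)).symm

/-- For an extension of ramification index one, the homomorphism of `F`-algebras
`F⟨𝔪_K / 𝔪_K², V⟩ → E⟨𝔪_L / 𝔪_L², Ω_{E/F}⟩` given by the natural map on `𝔪_K / 𝔪_K²` and by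
`y dā ↦ y (dh̄)^{⊗ [E : F]}` on `V`. -/
def lowerToUpper (p : ℕ) [Fact p.Prime] [CharP (ResidueField A) p]
    (he : (maximalIdeal A).map (algebraMap A B) = maximalIdeal B)
    {hb : ResidueField B} {ab : ResidueField A}
    (H : IsInsepGenerator (ResidueField A) hb ab) :
    LowerAlgebra A B →+* UpperAlgebra A B :=
  LaurentAlgebra.mapAlg (algebraMap (ResidueField A) (ResidueField B))
    (AddMonoidHom.mk'
      (fun x => LaurentAlgebra.incl (ResidueField B) (CotangentSpace B)
        (Ω[ResidueField B⁄ResidueField A]) (cotangentMap A B x, 0))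
      (fun x y => by
        rw [map_add (cotangentMap A B), ← LinearMap.map_add (LaurentAlgebra.incl _ _ _),
          Prod.mk_add_mk, add_zero]))
    (AddMonoidHom.mk'
      (fun w => algebraMap (ResidueField B) (UpperAlgebra A B)
          (algebraMap (ResidueField A) (ResidueField B) (omegaKerCoord p H w)) *
        LaurentAlgebra.incl (ResidueField B) (CotangentSpace B)
          (Ω[ResidueField B⁄ResidueField A])
          (0, KaehlerDifferential.D (ResidueField A) (ResidueField B) hb) ^
            Module.finrank (ResidueField A) (ResidueField B))
      (fun x y => by rw [map_add, map_add, map_add, add_mul]))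
    (fun c v => by
      simp only [AddMonoidHom.mk'_apply, cotangentMap_residue_smul]
      rw [← Algebra.smul_def, ← LinearMap.map_smul, Prod.smul_mk, smul_zero])
    (fun c w => by
      simp only [AddMonoidHom.mk'_apply]
      rw [LinearEquiv.map_smul, smul_eq_mul, map_mul, map_mul, mul_assoc])
    (fun v hv => LaurentAlgebra.isUnit_incl_left (cotangentMap_ne_zero he hv))
    (fun w hw => by
      have h1 : omegaKerCoord p H w ≠ 0 := (LinearEquiv.map_ne_zero_iff _).2 hw
      have h2 := (LaurentAlgebra.isUnit_incl_right (k := ResidueField B) (V := CotangentSpace B)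
        H.D_ne_zero).pow (Module.finrank (ResidueField A) (ResidueField B))
      exact IsUnit.mul ((IsUnit.mk0 _ h1).map ((algebraMap (ResidueField B) (UpperAlgebra A B)).comp
        (algebraMap (ResidueField A) (ResidueField B)))) h2)

end

/-! ## Valuations, the conductor and the ramification filtration -/

section Valuation

/-- The normalized valuation of a non-zero element of a discrete valuation ring. -/
def ord {B : Type*} [CommRing B] [IsDomain B] [IsDiscreteValuationRing B] (x : B) : ℕ :=
  (IsDiscreteValuationRing.addVal B x).toNat

open Classical in
/-- The residue class of `x / ϖ ^ v(x)`, for a uniformizer `ϖ` (and `0` for `x = 0`). -/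
def leadCoeff {B : Type*} [CommRing B] [IsDomain B] [IsDiscreteValuationRing B] (ϖ x : B) :
    ResidueField B :=
  if hx : ∃ y : B, x = ϖ ^ ord x * y then residue B hx.choose else 0

variable (A K L : Type*) {B : Type*} [CommRing A] [CommRing B] [IsDomain B]
  [IsDiscreteValuationRing B] [Algebra A B] [Field K] [Algebra A K] [IsFractionRing A K]
  [Field L] [Algebra K L] [FiniteDimensional K L] [Algebra A L] [IsScalarTower A K L]
  [Algebra B L] [IsScalarTower A B L] [IsIntegralClosure B A L]

/-- `h - σ(h)`. -/
def displacement (h : B) (σ : Gal(L/K)) : B := h - galRestrict A K L B σ h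

open Classical in
/-- `c = sup_{σ ≠ 1} v(h - σ(h)) + ∑_{σ ≠ 1} v(h - σ(h))`. The ramification index being one, the
normalized valuation of `L` extends that of `K`. -/
def conductor (h : B) : ℕ :=
  (Finset.univ.erase (1 : Gal(L/K))).sup (fun σ => ord (displacement A K L h σ)) +
    ∑ σ ∈ Finset.univ.erase (1 : Gal(L/K)), ord (displacement A K L h σ)

end Valuation

section Ramification

variable (A K L : Type*) {B : Type*} [CommRing A] [IsDomain A] [IsDiscreteValuationRing A]
  [CommRing B] [IsDomain B] [IsDiscreteValuationRing B] [Algebra A B]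
  [IsLocalHom (algebraMap A B)]
  [NontriviallyNormedField K] [Algebra A K] [IsFractionRing A K]
  [Field L] [Algebra K L] [FiniteDimensional K L] [Algebra A L] [IsScalarTower A K L]
  [Algebra B L] [IsScalarTower A B L] [IsIntegralClosure B A L]

/-- `S` is an open and closed subset of the affinoid subset `X` of the line over an algebraic
closure of `K` in the sense of rigid geometry: its indicator function is an analytic function on
`X`, that is, a uniform limit of rational functions without poles in `X`. -/
def IsAnalyticClopen (X S : Set (AlgebraicClosure K)) : Prop :=
  S ⊆ X ∧ ∀ ε > (0 : ℝ), ∃ P Q : (AlgebraicClosure K)[X], ∀ z ∈ X, Q.eval z ≠ 0 ∧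
    spectralNorm K (AlgebraicClosure K) (P.eval z / Q.eval z - S.indicator 1 z) < ε

/-- `x` and `y` lie in the same geometric connected component of `X`: no idempotent analytic
function on `X` separates them. -/
def SameComponent (X : Set (AlgebraicClosure K)) (x y : AlgebraicClosure K) : Prop :=
  ∀ S, IsAnalyticClopen K X S → (x ∈ S ↔ y ∈ S)

/-- The affinoid `{z : |z| ≤ 1, v(f(z)) ≥ r}` attached to the monogenic presentation
`O_L = O_K[T] / (f)`, where `f` is the minimal polynomial of `h`. -/
def tube (π : A) (h : B) (r : ℚ) : Set (AlgebraicClosure K) :=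
  {z | spectralNorm K (AlgebraicClosure K) z ≤ 1 ∧
    spectralNorm K (AlgebraicClosure K) (aeval z (minpoly K (algebraMap B L h))) ≤
      ‖algebraMap A K π‖ ^ (r : ℝ)}

/-- The (non-logarithmic) upper ramification subgroup `G^r` of Abbes and Saito, for `r > 0`,
computed with the presentation `O_L = O_K[T] / (f)`: the elements of `G` that act trivially on the
quotient of `Hom_K(L, K̄)`, the set of zeros of `f`, by the relation of lying in the same geometric
connected component of the affinoid `{z : |z| ≤ 1, v(f(z)) ≥ r}`. -/
def ramificationGroup (π : A) (h : B) (r : ℚ) : Subgroup Gal(L/K) where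
  carrier := {σ | ∀ ι : L →ₐ[K] AlgebraicClosure K,
    SameComponent K (tube A K L π h r) (ι (algebraMap B L h)) (ι (σ (algebraMap B L h)))}
  one_mem' := fun _ _ _ => Iff.rfl
  mul_mem' := fun {σ τ} hσ hτ ι S hS =>
    (hσ ι S hS).trans (hτ (ι.comp (σ : L →ₐ[K] L)) S hS)
  inv_mem' := fun {σ} hσ ι S hS => by
    have := hσ (ι.comp ((σ⁻¹ : Gal(L/K)) : L →ₐ[K] L)) S hS
    simpa using this.symm


end Ramification

/-! ## Kato's Swan conductor with differential values -/

section Swan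

/-- The integral closure of `ℤ` in `C`. -/
abbrev ZTilde (C : Type*) [Field C] : Subalgebra ℤ C := integralClosure ℤ C

theorem isIntegral_character {H C : Type*} [Group H] [Finite H] [Field C] (χ : H →* Cˣ) (σ : H) :
    IsIntegral ℤ (χ σ : C) := by
  have h1 : ((χ σ : Cˣ) : C) ^ Nat.card H = 1 := by
    rw [← Units.val_pow_eq_pow_val, ← map_pow, pow_card_eq_one', map_one, Units.val_one]
  exact IsIntegral.of_pow Nat.card_pos (h1 ▸ isIntegral_one)

/-- The value at `σ` of a one-dimensional character of a finite group, an algebraic integer. -/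
def charValue {H C : Type*} [Group H] [Finite H] [Field C] (χ : H →* Cˣ) (σ : H) : ZTilde C :=
  ⟨(χ σ : C), isIntegral_character χ σ⟩

theorem isIntegral_innerOne {H C : Type*} [Group H] [Fintype H] [Field C] (χ : H →* Cˣ) :
    IsIntegral ℤ ((Fintype.card H : C)⁻¹ * ∑ σ : H, (χ σ : C)) := by
  classical
  have h1 := sum_hom_units ((Units.coeHom C).comp χ)
  simp only [MonoidHom.comp_apply, Units.coeHom_apply] at h1
  rw [h1]
  split_ifs
  · by_cases h0 : (Fintype.card H : C) = 0
    · simp [h0, isIntegral_zero]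
    · rw [inv_mul_cancel₀ h0]; exact isIntegral_one
  · rw [Nat.cast_zero, mul_zero]; exact isIntegral_zero

/-- `⟨χ, 1⟩ = (1 / |H|) ∑_σ χ(σ)`, which is `0` or `1`. -/
def innerOne {H C : Type*} [Group H] [Fintype H] [Field C] (χ : H →* Cˣ) : ZTilde C :=
  ⟨(Fintype.card H : C)⁻¹ * ∑ σ : H, (χ σ : C), isIntegral_innerOne χ⟩

variable {A B : Type*} [CommRing A] [IsDomain A] [IsDiscreteValuationRing A]
  [CommRing B] [IsDomain B] [IsDiscreteValuationRing B] [Algebra A B]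
  [IsLocalHom (algebraMap A B)]

variable (A B) in
/-- `S_{K,L}`, written additively. -/
abbrev SLower : Type _ := Additive (LowerAlgebra A B)ˣ
variable (A B) in
/-- `S_{L/K}`, written additively. -/
abbrev SUpper : Type _ := Additive (UpperAlgebra A B)ˣ

/-- The homomorphism `S_{K,L} → S_{L/K}`. -/
def lowerToUpperHom (p : ℕ) [Fact p.Prime] [CharP (ResidueField A) p]
    (he : (maximalIdeal A).map (algebraMap A B) = maximalIdeal B)
    {hb : ResidueField B} {ab : ResidueField A}
    (H : IsInsepGenerator (ResidueField A) hb ab) : SLower A B →+ SUpper A B :=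
  MonoidHom.toAdditive (Units.map (lowerToUpper p he H).toMonoidHom)

variable (A)

/-- `[b]` in `S_{L/K}`, for `b ∈ E`. -/
def upperScalar (b : ResidueField B) : SUpper A B :=
  unitClass (algebraMap (ResidueField B) (UpperAlgebra A B) b)

/-- `[x]` in `S_{L/K}`, for `x ∈ 𝔪_L / 𝔪_L²`. -/
def upperCotangent (x : CotangentSpace B) : SUpper A B :=
  unitClass (LaurentAlgebra.incl _ _ _ (x, 0))

/-- `[ω]` in `S_{L/K}`, for `ω ∈ Ω_{E/F}`. -/
def upperDifferential (ω : Ω[ResidueField B⁄ResidueField A]) : SUpper A B :=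
  unitClass (LaurentAlgebra.incl _ _ _ (0, ω))

variable {A} (B)

/-- `[x]` in `S_{K,L}`, for `x ∈ 𝔪_K / 𝔪_K²`. -/
def lowerCotangent (x : CotangentSpace A) : SLower A B :=
  unitClass (LaurentAlgebra.incl _ _ _ (x, 0))

/-- `[ω]` in `S_{K,L}`, for `ω ∈ V`. -/
def lowerDifferential (ω : omegaKer A B) : SLower A B :=
  unitClass (LaurentAlgebra.incl _ _ _ (0, ω))

variable (A) {B}

/-- `[x]` in `S_{L/K}` for a non-zero `x ∈ O_L`: the class of `x` in `(𝔪_L / 𝔪_L²)^{⊗ v(x)}`, written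
as `x = ϖ^{v(x)} · (x / ϖ^{v(x)})` with a uniformizer `ϖ` of `L`, on which it does not depend. -/
def leadClass (ϖ : maximalIdeal B) (x : B) : SUpper A B :=
  ord x • upperCotangent A ((maximalIdeal B).toCotangent ϖ) + upperScalar A (leadCoeff (ϖ : B) x)

variable (K L : Type*) [Field K] [Algebra A K] [IsFractionRing A K]
  [Field L] [Algebra K L] [FiniteDimensional K L] [Algebra A L] [IsScalarTower A K L]
  [Algebra B L] [IsScalarTower A B L] [IsIntegralClosure B A L]

/-- `s_G(σ) = [dh̄] - [h - σ(h)]`, for `σ ≠ 1`. -/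
def sGne (ϖ : maximalIdeal B) (h : B) (σ : Gal(L/K)) : SUpper A B :=
  upperDifferential A (KaehlerDifferential.D (ResidueField A) (ResidueField B) (residue B h)) -
    leadClass A ϖ (displacement A K L h σ)

open Classical in
/-- `s_G(σ)` for all `σ`, with `s_G(1) = -∑_{σ ≠ 1} s_G(σ)`. -/
def sG (ϖ : maximalIdeal B) (h : B) (σ : Gal(L/K)) : SUpper A B :=
  if σ = 1 then -∑ τ ∈ Finset.univ.erase (1 : Gal(L/K)), sGne A K L ϖ h τ
  else sGne A K L ϖ h σ

/-- `m · ε(ξ)`, where `ε(ξ) = ∑_{r ∈ 𝔽_p^×} [r] ⊗ ξ^r`. -/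
def epsilon {C : Type*} [Field C] (p : ℕ) (ξ m : ZTilde C) : SUpper A B ⊗[ℤ] ZTilde C :=
  ∑ r ∈ Finset.Ico 1 p, upperScalar A (r : ResidueField B) ⊗ₜ[ℤ] (m * ξ ^ r)

/-- Kato's Swan conductor with differential values of a one-dimensional character,
`sw_ξ(χ) = ∑_σ s_G(σ) ⊗ χ(σ) + (1 - ⟨χ, 1⟩) ε(ξ)`. -/
def swan {C : Type*} [Field C] (p : ℕ) (ϖ : maximalIdeal B) (h : B) (ξ : ZTilde C)
    (χ : Gal(L/K) →* Cˣ) : SUpper A B ⊗[ℤ] ZTilde C :=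
  ∑ σ : Gal(L/K), sG A K L ϖ h σ ⊗ₜ[ℤ] charValue χ σ + epsilon A p ξ (1 - innerOne χ)

end Swan

section Formula

variable (A K L : Type*) {B : Type*} [CommRing A] [IsDomain A] [IsDiscreteValuationRing A]
  [CommRing B] [IsDomain B] [IsDiscreteValuationRing B] [Algebra A B]
  [IsLocalHom (algebraMap A B)]

variable {A} in
/-- A uniformizer of `K` as an element of `𝔪_K`. -/
def unifLower {π : A} (hπ : Irreducible π) : maximalIdeal A :=
  ⟨π, (mem_maximalIdeal π).2 hπ.not_isUnit⟩

variable {A} in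
/-- A uniformizer of `K` as an element of `𝔪_L`. -/
def unifUpper (B : Type*) [CommRing B] [IsDomain B] [IsDiscreteValuationRing B] [Algebra A B]
    [IsLocalHom (algebraMap A B)] {π : A} (hπ : Irreducible π) : maximalIdeal B :=
  ⟨algebraMap A B π, (mem_maximalIdeal _).2 fun hu =>
    hπ.not_isUnit (isUnit_of_map_unit (algebraMap A B) π hu)⟩

/-- `u_σ`, the residue class of `(h - σ(h)) / π^{v(h - σ(h))}` for `σ ≠ 1`, and `u_1 = 0`. -/
def uMap [Field K] [Algebra A K] [IsFractionRing A K]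
    [Field L] [Algebra K L] [FiniteDimensional K L] [Algebra A L] [IsScalarTower A K L]
    [Algebra B L] [IsScalarTower A B L] [IsIntegralClosure B A L]
    (π : A) (h : B) (σ : Gal(L/K)) : ResidueField B :=
  leadCoeff (algebraMap A B π) (displacement A K L h σ)

/-- The subgroup `G^c`, for `c` the conductor of `L / K`. -/
abbrev topGroup [NontriviallyNormedField K] [Algebra A K] [IsFractionRing A K]
    [Field L] [Algebra K L] [FiniteDimensional K L] [Algebra A L] [IsScalarTower A K L]
    [Algebra B L] [IsScalarTower A B L] [IsIntegralClosure B A L]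
    (π : A) (h : B) : Subgroup Gal(L/K) :=
  ramificationGroup A K L π h (conductor A K L h)

open Classical in
/-- The polynomial `∏_{σ ∈ ker χ̄} (T + u_σ)`, for a homomorphism `χ̄ : H → 𝔽_p` on a subgroup `H`
of a finite group `G` and a map `u : G → k`. -/
def kerPoly {G k : Type*} [Group G] [Fintype G] [Field k] {p : ℕ} {H : Subgroup G}
    (χbar : H →* Multiplicative (ZMod p)) (u : G → k) : k[X] :=
  ∏ σ : H with χbar σ = 1, (X + C (u σ))

open Classical in
/-- `∑_{σ ∈ G - H} f(σ)`. -/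
def sumOutside {G M : Type*} [Group G] [Fintype G] [AddCommMonoid M] (H : Subgroup G)
    (f : G → M) : M :=
  ∑ σ : G with σ ∉ H, f σ

end Formula

end

end KatoSwan

open KatoSwan

namespace KatoSwan

/-! ## Classes of units and the map `S_{K,L} → S_{L/K}` -/

/-! Let s be the largest v(h - σ(h)) with σ ≠ 1, and let T be the group of the σ with v(h - σ(h)) ≥
s. Since f(z) = ∏ (z - σ(h)) over the conjugates of h, the condition v(f(z)) ≥ c cuts out the union
of the closed discs of radius |π|^s around these conjugates. Each disc is connected, and distinct
discs are separated by a rational function, so G^c = T (`topGroup_eq_lastGroup`).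

The map σ ↦ h - σ(h) is a cocycle and G acts trivially on E. Hence u is an injective homomorphism
from T to the additive group of E (`uMap_mul`). So T is killed by p, which gives the factorization
of χ through ψ₀ (`existsUnique_factorization`). Outside T, both v(h - σ(h)) and u_σ depend only on
the coset σT.

For χ ≠ 1 the Swan conductor is ∑_{σ ≠ 1} ([dh̄] - [h - σ(h)]) ⊗ (χ(σ) - 1) + ε(ξ). The total
multiple of [dh̄] is -#G = -[E : F], and [E : F][dh̄] is the image of [dā₀]. For σ outside T the
part with χ(σ) cancels along cosets of T, leaving [h - σ(h)] ⊗ 1. On T, the product of u over the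
fibre of χ̄ above r is r·φ, where φ is the product over the fibre above 1 and equals the value of
the kernel polynomial at u_τ. As the ξ^r sum to -1, the terms in χ yield ε(ξ) - [φ], and this ε(ξ)
cancels the one in the definition. By Wilson's theorem the remaining product over T is -φ^(p-1), so
that -φ^p appears (`sum_lastGroup_tmul`, `swan_eq`).

It remains to see that -φ^p ∏_{σ ∉ T} u_σ lies in F. With N = ker χ and τ in T such that χ̄(τ) = 1,
this product is ∏_{σ ∉ N} u_σ · ∏_{s ∈ N} u_{τs}. It is the residue of the leading part of δ·(α -
τ(α)), where α is the norm of h to the fixed field M of N and δ is the product of the differences of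
α and its other conjugates. A class outside F would be a polynomial of positive degree in ᾱ.
Multiplying by a suitable y - γ(y), whose trace is zero, would then contradict Euler's formula: the
trace of P(α)/δ is the top coefficient of P (`prod_uMap_mem_range`, `coeff_eq_zero_of_sum_eq_zero`).
-/

theorem unitClass_of_isUnit {R : Type*} [CommRing R] {x : R} (hx : IsUnit x) :
    unitClass x = Additive.ofMul hx.unit := by
  rw [unitClass, dif_pos hx]

/-- Both factors must be units: the class of a non-unit is the default value 0, so additivity fails
without this. -/
theorem unitClass_mul {R : Type*} [CommRing R] {x y : R} (hx : IsUnit x) (hy : IsUnit y) :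
    unitClass (x * y) = unitClass x + unitClass y := by
  rw [unitClass_of_isUnit hx, unitClass_of_isUnit hy, unitClass_of_isUnit (hx.mul hy), ← ofMul_mul]
  congr 1
  ext
  rfl

theorem unitClass_one {R : Type*} [CommRing R] : unitClass (1 : R) = 0 := by
  rw [unitClass_of_isUnit isUnit_one, IsUnit.unit_one, ofMul_one]

theorem unitClass_pow {R : Type*} [CommRing R] {x : R} (hx : IsUnit x) (n : ℕ) :
    unitClass (x ^ n) = n • unitClass x := by
  induction n with
  | zero => simp [unitClass_one]
  | succ n ih => rw [pow_succ, unitClass_mul (hx.pow n) hx, ih, succ_nsmul]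

theorem toAdditive_map_unitClass {R S : Type*} [CommRing R] [CommRing S] (f : R →+* S) {x : R}
    (hx : IsUnit x) :
    MonoidHom.toAdditive (Units.map f.toMonoidHom) (unitClass x) = unitClass (f x) := by
  rw [unitClass_of_isUnit hx, unitClass_of_isUnit (hx.map f), MonoidHom.toAdditive_apply_apply,
    toMul_ofMul]
  congr 1
  ext
  rfl

namespace LaurentAlgebra

variable {k V W k' V' W' : Type*} [Field k] [AddCommGroup V] [Module k V] [AddCommGroup W]
  [Module k W] [Field k'] [AddCommGroup V'] [Module k' V'] [AddCommGroup W'] [Module k' W']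
  (i : k →+* k') (f : V →+ LaurentAlgebra k' V' W') (g : W →+ LaurentAlgebra k' V' W')
  (hf : ∀ (c : k) (v : V), f (c • v) = algebraMap k' _ (i c) * f v)
  (hg : ∀ (c : k) (w : W), g (c • w) = algebraMap k' _ (i c) * g w)
  (hf' : ∀ v, v ≠ 0 → IsUnit (f v)) (hg' : ∀ w, w ≠ 0 → IsUnit (g w))

theorem mapAlg_algebraMap (c : k) :
    mapAlg i f g hf hg hf' hg' (algebraMap k _ c) = algebraMap k' _ (i c) := by
  -- `mapAlg` lifts a map that is linear for the `k`-algebra structure through `i`; the same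
  -- structure has to be in force here.
  let : Algebra k (LaurentAlgebra k' V' W') := ((algebraMap k' _).comp i).toAlgebra
  rw [IsScalarTower.algebraMap_apply k (SymmetricAlgebra k (V × W)) (LaurentAlgebra k V W), mapAlg,
    IsLocalization.lift_eq]
  exact AlgHom.commutes _ c

theorem mapAlg_incl (x : V × W) :
    mapAlg i f g hf hg hf' hg' (incl k V W x) = f x.1 + g x.2 := by
  let : Algebra k (LaurentAlgebra k' V' W') := ((algebraMap k' _).comp i).toAlgebra
  have : incl k V W x = algebraMap (SymmetricAlgebra k (V × W)) (LaurentAlgebra k V W)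
    (SymmetricAlgebra.ι k (V × W) x) := rfl
  rw [this, mapAlg, IsLocalization.lift_eq]
  exact SymmetricAlgebra.lift_ι_apply ..

end LaurentAlgebra

section Classes

variable {A B : Type*} [CommRing A] [IsDomain A] [IsDiscreteValuationRing A]
  [CommRing B] [IsDomain B] [IsDiscreteValuationRing B] [Algebra A B]
  [IsLocalHom (algebraMap A B)]

variable (A) in
theorem isUnit_algebraMap_upper {b : ResidueField B} (hb : b ≠ 0) :
    IsUnit (algebraMap (ResidueField B) (UpperAlgebra A B) b) :=
  (IsUnit.mk0 b hb).map _

variable (A) in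
theorem upperScalar_mul {b c : ResidueField B} (hb : b ≠ 0) (hc : c ≠ 0) :
    upperScalar A (b * c) = upperScalar A b + upperScalar A c := by
  rw [upperScalar, map_mul,
    unitClass_mul (isUnit_algebraMap_upper A hb) (isUnit_algebraMap_upper A hc)]
  rfl

variable (A) in
theorem upperScalar_one : upperScalar A (1 : ResidueField B) = 0 := by
  rw [upperScalar, map_one, unitClass_one]

variable (A) in
theorem upperScalar_prod {ι : Type*} (s : Finset ι) (f : ι → ResidueField B)
    (hf : ∀ i ∈ s, f i ≠ 0) :
    upperScalar A (∏ i ∈ s, f i) = ∑ i ∈ s, upperScalar A (f i) := by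
  classical
  induction s using Finset.induction_on with
  | empty => simp [upperScalar_one]
  | insert a s ha ih =>
    rw [Finset.prod_insert ha, Finset.sum_insert ha, upperScalar_mul A (hf a (by simp)), ih]
    · exact fun i hi => hf i (by simp [hi])
    · exact Finset.prod_ne_zero_iff.2 fun i hi => hf i (by simp [hi])

variable (p : ℕ) [Fact p.Prime] [CharP (ResidueField A) p]
  (he : (maximalIdeal A).map (algebraMap A B) = maximalIdeal B)
  {hb : ResidueField B} {ab : ResidueField A} (H : IsInsepGenerator (ResidueField A) hb ab)

include he in
theorem toCotangent_unifUpper_ne_zero {π : A} (hπ : Irreducible π) :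
    (maximalIdeal B).toCotangent (unifUpper B hπ) ≠ 0 := by
  have h1 : (maximalIdeal A).toCotangent (unifLower hπ) ≠ 0 := by
    rw [Ne, Ideal.toCotangent_eq_zero]
    change π ∉ maximalIdeal A ^ 2
    rw [hπ.maximalIdeal_eq, Ideal.span_singleton_pow, Ideal.mem_span_singleton, pow_two]
    intro h
    have := (mul_dvd_mul_iff_left hπ.ne_zero).1 (h.trans (mul_one π).symm.dvd)
    exact hπ.not_isUnit (isUnit_of_dvd_one this)
  exact cotangentMap_ne_zero he h1

theorem lowerToUpper_algebraMap (c : ResidueField A) :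
    lowerToUpper p he H (algebraMap (ResidueField A) (LowerAlgebra A B) c) =
      algebraMap (ResidueField B) (UpperAlgebra A B)
        (algebraMap (ResidueField A) (ResidueField B) c) :=
  LaurentAlgebra.mapAlg_algebraMap ..

theorem lowerToUpper_incl (x : CotangentSpace A × omegaKer A B) :
    lowerToUpper p he H (LaurentAlgebra.incl _ _ _ x) =
      LaurentAlgebra.incl (ResidueField B) (CotangentSpace B)
        (Ω[ResidueField B⁄ResidueField A]) (cotangentMap A B x.1, 0) +
      algebraMap (ResidueField B) (UpperAlgebra A B)
          (algebraMap (ResidueField A) (ResidueField B) (omegaKerCoord p H x.2)) *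
        LaurentAlgebra.incl (ResidueField B) (CotangentSpace B)
          (Ω[ResidueField B⁄ResidueField A])
          (0, KaehlerDifferential.D (ResidueField A) (ResidueField B) hb) ^
            Module.finrank (ResidueField A) (ResidueField B) :=
  LaurentAlgebra.mapAlg_incl ..

theorem omegaKerCoord_D :
    omegaKerCoord p H ⟨KaehlerDifferential.D ℤ (ResidueField A) ab, H.D_mem_ker p⟩ = 1 :=
  (LinearEquiv.symm_apply_eq _).2 (Subtype.ext
    (one_smul (ResidueField A) (KaehlerDifferential.D ℤ (ResidueField A) ab)).symm)

theorem lowerToUpperHom_lowerCotangent {π : A} (hπ : Irreducible π) :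
    lowerToUpperHom p he H (lowerCotangent B ((maximalIdeal A).toCotangent (unifLower hπ))) =
      upperCotangent A ((maximalIdeal B).toCotangent (unifUpper B hπ)) := by
  have h1 : (maximalIdeal A).toCotangent (unifLower hπ) ≠ 0 := fun h0 =>
    toCotangent_unifUpper_ne_zero he hπ
      ((congrArg (cotangentMap A B) h0).trans (map_zero _))
  rw [lowerToUpperHom, lowerCotangent, toAdditive_map_unitClass]
  · rw [lowerToUpper_incl, map_zero, map_zero, map_zero, zero_mul, add_zero]
    rfl
  · exact LaurentAlgebra.isUnit_incl_left h1

/-- The coordinate of dā₀ in the basis dā₀ is 1, so only the power of dh̄ is left. This turns the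
multiple [E : F] of [dh̄] in the Swan conductor into the class [dā₀]. -/
theorem lowerToUpperHom_lowerDifferential :
    lowerToUpperHom p he H (lowerDifferential B
        ⟨KaehlerDifferential.D ℤ (ResidueField A) ab, H.D_mem_ker p⟩) =
      Module.finrank (ResidueField A) (ResidueField B) •
        upperDifferential A (KaehlerDifferential.D (ResidueField A) (ResidueField B) hb) := by
  set ω : omegaKer A B := ⟨KaehlerDifferential.D ℤ (ResidueField A) ab, H.D_mem_ker p⟩
  have hω : ω ≠ 0 := fun h0 => H.D_base_ne_zero p (congrArg Subtype.val h0)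
  have hcoord : omegaKerCoord p H ω = 1 := omegaKerCoord_D p H
  rw [lowerToUpperHom, lowerDifferential, toAdditive_map_unitClass]
  · rw [lowerToUpper_incl, map_zero, ← Prod.zero_eq_mk, map_zero, zero_add, hcoord,
      map_one, map_one, one_mul, unitClass_pow (LaurentAlgebra.isUnit_incl_right H.D_ne_zero)]
    rfl
  · exact LaurentAlgebra.isUnit_incl_right hω

theorem lowerToUpperHom_scalar {c : ResidueField A} (hc : c ≠ 0) :
    lowerToUpperHom p he H (unitClass (algebraMap (ResidueField A) (LowerAlgebra A B) c)) =
      upperScalar A (algebraMap (ResidueField A) (ResidueField B) c) := by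
  rw [lowerToUpperHom, toAdditive_map_unitClass]
  · rw [lowerToUpper_algebraMap]
    rfl
  · exact (IsUnit.mk0 c hc).map _

end Classes

/-! ## Orders and leading coefficients in a discrete valuation ring -/

section Leading

variable {B : Type*} [CommRing B] [IsDomain B] [IsDiscreteValuationRing B] {ϖ : B}

theorem ord_pow_mul (hϖ : Irreducible ϖ) (n : ℕ) {y : B} (hy : IsUnit y) : ord (ϖ ^ n * y) = n := by
  rw [ord, IsDiscreteValuationRing.addVal_def _ hy.unit hϖ n (by rw [IsUnit.unit_spec, mul_comm])]
  rfl

theorem leadCoeff_pow_mul (hϖ : Irreducible ϖ) (n : ℕ) {y : B} (hy : IsUnit y) :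
    leadCoeff ϖ (ϖ ^ n * y) = residue B y := by
  have hex : ∃ z : B, ϖ ^ n * y = ϖ ^ ord (ϖ ^ n * y) * z := ⟨y, by rw [ord_pow_mul hϖ n hy]⟩
  rw [leadCoeff, dif_pos hex]
  have hspec := hex.choose_spec
  generalize hex.choose = z at hspec
  nth_rewrite 1 [ord_pow_mul hϖ n hy] at hspec
  rw [← mul_left_cancel₀ (pow_ne_zero n hϖ.ne_zero) hspec]

theorem leadCoeff_zero (ϖ : B) : leadCoeff ϖ 0 = 0 := by
  -- The valuation of 0 is `⊤`, and `toNat` sends it to 0; the defining condition therefore holds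
  -- and forces the quotient to be 0.
  have h0 : ord (0 : B) = 0 := by simp [ord]
  have hex : ∃ z : B, (0 : B) = ϖ ^ ord (0 : B) * z := ⟨0, by simp⟩
  rw [leadCoeff, dif_pos hex]
  have hspec := hex.choose_spec
  generalize hex.choose = z at hspec
  rw [h0, pow_zero, one_mul] at hspec
  rw [← hspec, map_zero]

theorem exists_eq_pow_mul (hϖ : Irreducible ϖ) {x : B} (hx : x ≠ 0) :
    ∃ y : B, IsUnit y ∧ x = ϖ ^ ord x * y ∧ residue B y = leadCoeff ϖ x := by
  obtain ⟨n, u, rfl⟩ := IsDiscreteValuationRing.eq_unit_mul_pow_irreducible hx hϖ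
  rw [mul_comm]
  exact ⟨u, u.isUnit, by rw [ord_pow_mul hϖ n u.isUnit], (leadCoeff_pow_mul hϖ n u.isUnit).symm⟩

theorem leadCoeff_ne_zero (hϖ : Irreducible ϖ) {x : B} (hx : x ≠ 0) : leadCoeff ϖ x ≠ 0 := by
  obtain ⟨y, hy, -, h⟩ := exists_eq_pow_mul hϖ hx
  rw [← h]
  exact (residue_ne_zero_iff_isUnit y).2 hy

theorem eq_pow_mul_of_residue_ne_zero (hϖ : Irreducible ϖ) {x y : B} {n : ℕ} (hx : x = ϖ ^ n * y)
    (hy : residue B y ≠ 0) : ord x = n ∧ leadCoeff ϖ x = residue B y := by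
  have hy' := (residue_ne_zero_iff_isUnit y).1 hy
  subst hx
  exact ⟨ord_pow_mul hϖ n hy', leadCoeff_pow_mul hϖ n hy'⟩

theorem residue_eq_zero_iff_dvd (hϖ : Irreducible ϖ) (x : B) : residue B x = 0 ↔ ϖ ∣ x := by
  rw [residue_eq_zero_iff, hϖ.maximalIdeal_eq, Ideal.mem_span_singleton]

end Leading

/-! ## Polynomials in a lift of a generator of a residue extension -/

section Lift

variable {A B : Type*} [CommRing A] [IsDomain A] [IsDiscreteValuationRing A]
  [CommRing B] [IsDomain B] [IsDiscreteValuationRing B] [Algebra A B]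
  [IsLocalHom (algebraMap A B)] {π : A}

omit [IsLocalHom (algebraMap A B)] in
theorem irreducible_algebraMap (he : (maximalIdeal A).map (algebraMap A B) = maximalIdeal B)
    (hπ : Irreducible π) : Irreducible (algebraMap A B π) := by
  rw [IsDiscreteValuationRing.irreducible_iff_uniformizer, ← he, hπ.maximalIdeal_eq, Ideal.map_span,
    Set.image_singleton]

theorem residue_aeval (P : A[X]) (α : B) :
    residue B (aeval α P) = aeval (residue B α) (P.map (residue A)) := by
  rw [aeval_def, aeval_def, hom_eval₂, eval₂_map]
  congr 1

theorem exists_eq_C_mul_of_map_residue_eq_zero (hπ : Irreducible π) {P : A[X]}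
    (hP : P.map (residue A) = 0) : ∃ Q : A[X], P = C π * Q := by
  rw [← dvd_def, C_dvd_iff_dvd_coeff]
  intro i
  rw [← residue_eq_zero_iff_dvd hπ, ← coeff_map, hP, coeff_zero]

/-- The powers of the residue of α below the degree of its minimal polynomial are independent over
F, so divisibility of P(α) by π already forces divisibility of P; iterate n times. -/
theorem exists_eq_C_pow_mul_of_aeval (he : (maximalIdeal A).map (algebraMap A B) = maximalIdeal B)
    (hπ : Irreducible π) {α : B} (n : ℕ) {P : A[X]}
    (hP : P.degree < (minpoly (ResidueField A) (residue B α)).degree) {b : B}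
    (hb : aeval α P = algebraMap A B π ^ n * b) : ∃ Q : A[X], P = C (π ^ n) * Q := by
  induction n generalizing b with
  | zero => exact ⟨P, by simp⟩
  | succ n ih =>
    have hϖ := irreducible_algebraMap he hπ
    obtain ⟨Q, rfl⟩ := ih (b := algebraMap A B π * b) (by rw [hb]; ring)
    have hQ : aeval α Q = algebraMap A B π * b := by
      rw [map_mul, aeval_C, map_pow, pow_succ, mul_assoc] at hb
      exact mul_left_cancel₀ (pow_ne_zero n hϖ.ne_zero) hb
    have hQ0 : Q.map (residue A) = 0 := by
      by_contra hne
      have h1 : aeval (residue B α) (Q.map (residue A)) = 0 := by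
        rw [← residue_aeval, residue_eq_zero_iff_dvd hϖ]
        exact ⟨b, hQ⟩
      have h2 := minpoly.degree_le_of_ne_zero (ResidueField A) _ hne h1
      have h3 : (C (π ^ n) * Q).degree = Q.degree := by
        rw [degree_mul, degree_C (pow_ne_zero n hπ.ne_zero), zero_add]
      exact absurd hP (not_lt.2 (h2.trans (degree_map_le.trans h3.ge)))
    obtain ⟨R, rfl⟩ := exists_eq_C_mul_of_map_residue_eq_zero hπ hQ0
    exact ⟨R, by rw [pow_succ, C_mul, mul_assoc]⟩

variable (K : Type*) {L : Type*} [Field K] [Algebra A K] [IsFractionRing A K]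
  [Field L] [Algebra K L] [Algebra A L] [IsScalarTower A K L]
  [Algebra B L] [IsScalarTower A B L]

include K in
-- Clear the denominator of P by u·π^n with u a unit. The value at α of the resulting polynomial is
-- divisible by π^n, hence so is the polynomial itself, and P was integral.
theorem exists_map_eq_of_aeval_eq_algebraMap [FaithfulSMul B L]
    (he : (maximalIdeal A).map (algebraMap A B) = maximalIdeal B)
    (hπ : Irreducible π) {α : B} {P : K[X]}
    (hP : P.degree < (minpoly (ResidueField A) (residue B α)).degree) {b : B}
    (hb : aeval (algebraMap B L α) P = algebraMap B L b) :
    ∃ Q : A[X], Q.map (algebraMap A K) = P ∧ aeval α Q = b := by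
  obtain ⟨a, ha, ha'⟩ := IsLocalization.integerNormalization_spec (nonZeroDivisors A) P
  set R := IsLocalization.integerNormalization (nonZeroDivisors A) P
  have hRP : R.map (algebraMap A K) = C (algebraMap A K a) * P := by
    rw [ha', ← smul_eq_C_mul, algebraMap_smul]
  have ha0 : a ≠ 0 := nonZeroDivisors.ne_zero ha
  have haK : algebraMap A K a ≠ 0 := by simpa using ha0
  obtain ⟨n, u, rfl⟩ := IsDiscreteValuationRing.eq_unit_mul_pow_irreducible ha0 hπ
  have hinj : Function.Injective (algebraMap B L) := FaithfulSMul.algebraMap_injective B L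
  have hdeg : R.degree = P.degree := by
    rw [← degree_map_eq_of_injective (IsFractionRing.injective A K), hRP, degree_mul,
      degree_C haK, zero_add]
  have hR : aeval α R = algebraMap A B π ^ n * (algebraMap A B u * b) := by
    apply hinj
    rw [← aeval_algebraMap_apply, ← aeval_map_algebraMap K, hRP, map_mul, hb, aeval_C,
      ← IsScalarTower.algebraMap_apply, IsScalarTower.algebraMap_apply A B L]
    simp only [map_mul, map_pow]
    ring
  obtain ⟨Q, hQ⟩ := exists_eq_C_pow_mul_of_aeval he hπ n (hdeg ▸ hP) hR
  have hQP : (C (↑u⁻¹ : A) * Q).map (algebraMap A K) = P := by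
    have h1 : C (↑u * π ^ n) * (C (↑u⁻¹ : A) * Q) = R := by
      rw [hQ, ← mul_assoc, ← C_mul]
      congr 2
      rw [mul_assoc, mul_comm, mul_assoc, Units.inv_mul, mul_one]
    have h2 := congrArg (map (algebraMap A K)) h1
    rw [Polynomial.map_mul, hRP, map_C] at h2
    exact mul_left_cancel₀ (C_ne_zero.2 haK) h2
  refine ⟨_, hQP, hinj ?_⟩
  rw [← hb, ← hQP, aeval_map_algebraMap, aeval_algebraMap_apply]

/-- Otherwise the minimal polynomial over K would have small enough degree to be integral and,
vanishing at α, divisible by π, although it is monic. -/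
theorem degree_minpoly_residue_le [FaithfulSMul B L]
    (he : (maximalIdeal A).map (algebraMap A B) = maximalIdeal B)
    (hπ : Irreducible π) {α : B}
    (hαK : IsIntegral K (algebraMap B L α)) :
    (minpoly (ResidueField A) (residue B α)).degree ≤
      (minpoly K (algebraMap B L α)).degree := by
  by_contra! hlt
  obtain ⟨Q, hQ, hQ0⟩ := exists_map_eq_of_aeval_eq_algebraMap K (L := L) (b := 0) he hπ hlt
    (by rw [minpoly.aeval, map_zero])
  have hQm : Q.Monic := by
    rw [Function.Injective.monic_map_iff (IsFractionRing.injective A K), hQ]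
    exact minpoly.monic hαK
  have hdeg : Q.degree < (minpoly (ResidueField A) (residue B α)).degree := by
    rwa [← hQ, degree_map_eq_of_injective (IsFractionRing.injective A K)] at hlt
  obtain ⟨R, hR⟩ := exists_eq_C_pow_mul_of_aeval (b := 0) he hπ 1 hdeg (by rw [hQ0, mul_zero])
  have h1 := hQm.coeff_natDegree
  rw [hR, coeff_C_mul, pow_one] at h1
  exact hπ.not_isUnit (IsUnit.of_mul_eq_one _ h1)

end Lift

/-! ## The Galois action for a residue extension generated by one element -/

theorem faithfulSMul_of_isIntegralClosure (A B L : Type*) [CommRing A] [CommRing B] [CommRing L]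
    [Algebra A L] [Algebra B L] [IsIntegralClosure B A L] : FaithfulSMul B L :=
  (faithfulSMul_iff_algebraMap_injective B L).2 (IsIntegralClosure.algebraMap_injective B A L)

section Galois

set_option linter.unusedSectionVars false

variable {A B : Type*} (K L : Type*) [CommRing A] [IsDomain A] [IsDiscreteValuationRing A]
  [CommRing B] [IsDomain B] [IsDiscreteValuationRing B] [Algebra A B]
  [IsLocalHom (algebraMap A B)] [Field K] [Algebra A K] [IsFractionRing A K]
  [Field L] [Algebra K L] [FiniteDimensional K L] [Algebra A L] [IsScalarTower A K L]
  [Algebra B L] [IsScalarTower A B L] [IsIntegralClosure B A L]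
  {p : ℕ} [Fact p.Prime] [CharP (ResidueField A) p] {π : A} {h : B} {a₀ : ResidueField A}

/-- Some p^n-th power of the class of b comes from A, which σ fixes, and the Frobenius of E is
injective. -/
theorem residue_galRestrict (p : ℕ) [Fact p.Prime] [CharP (ResidueField A) p]
    (H : IsInsepGenerator (ResidueField A) (residue B h) a₀) (σ : Gal(L/K)) (b : B) :
    residue B (galRestrict A K L B σ b) = residue B b := by
  have := H.isPurelyInseparable
  have : ExpChar (ResidueField A) p := ExpChar.prime Fact.out
  have : CharP (ResidueField B) p :=
    charP_of_injective_algebraMap (algebraMap (ResidueField A) (ResidueField B)).injective p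
  have : ExpChar (ResidueField B) p := ExpChar.prime Fact.out
  obtain ⟨n, a, ha⟩ := IsPurelyInseparable.pow_mem (ResidueField A) p (residue B b)
  obtain ⟨a, rfl⟩ := residue_surjective a
  rw [ResidueField.algebraMap_residue, ← map_pow, ← sub_eq_zero, ← map_sub, residue_eq_zero_iff] at ha
  have h1 : galRestrict A K L B σ (algebraMap A B a - b ^ p ^ n) ∈ maximalIdeal B := by
    rw [mem_maximalIdeal, mem_nonunits_iff] at ha ⊢
    rwa [isUnit_map_iff]
  rw [← residue_eq_zero_iff] at h1 ha
  rw [map_sub, AlgEquiv.commutes, map_pow, map_sub, map_pow] at h1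
  rw [map_sub, map_pow] at ha
  apply iterateFrobenius_inj (ResidueField B) p n
  rw [iterateFrobenius_def, iterateFrobenius_def, ← sub_eq_zero.1 h1, ← sub_eq_zero.1 ha]

/-- A cocycle relation: it is the source of the additivity of u on the last ramification group and
of its invariance under translation outside it. -/
theorem displacement_mul (σ τ : Gal(L/K)) :
    displacement A K L h (σ * τ) =
      displacement A K L h σ + galRestrict A K L B σ (displacement A K L h τ) := by
  simp only [displacement, map_mul, map_sub, AlgEquiv.mul_apply]
  ring

@[simp]
theorem displacement_one : displacement A K L h (1 : Gal(L/K)) = 0 := by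
  simp [displacement]

variable [IsGalois K L]

/-- An element of `B` fixed by a subgroup `N` is a polynomial in `α`, if `α` is fixed by `N` and its
residue class has degree `[G : N]`. -/
theorem exists_aeval_eq_of_fixed (he : (maximalIdeal A).map (algebraMap A B) = maximalIdeal B)
    (hπ : Irreducible π) (N : Subgroup Gal(L/K)) {α : B}
    (hα : ∀ s ∈ N, galRestrict A K L B s α = α)
    (hdeg : (minpoly (ResidueField A) (residue B α)).natDegree * Nat.card N = Nat.card Gal(L/K))
    {b : B} (hb : ∀ s ∈ N, galRestrict A K L B s b = b) :
    ∃ P : A[X], P.degree < (minpoly (ResidueField A) (residue B α)).degree ∧ aeval α P = b := by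
  have := faithfulSMul_of_isIntegralClosure A B L
  have hmem : ∀ c : B, (∀ s ∈ N, galRestrict A K L B s c = c) → algebraMap B L c ∈ fixedField N := by
    rintro c hc ⟨s, hs⟩
    change s (algebraMap B L c) = algebraMap B L c
    rw [← algebraMap_galRestrict_apply A, hc s hs]
  have hint : IsIntegral K (algebraMap B L α) := IsIntegral.of_finite K _
  have hle : K⟮algebraMap B L α⟯ ≤ fixedField N := adjoin_simple_le_iff.2 (hmem α hα)
  have hd0 : 0 < (minpoly (ResidueField A) (residue B α)).natDegree := by
    by_contra! h0
    rw [Nat.le_zero.1 h0, zero_mul] at hdeg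
    exact Nat.card_pos.ne hdeg
  have hne : minpoly (ResidueField A) (residue B α) ≠ 0 := by
    rintro h0
    simp [h0] at hd0
  have hnat := natDegree_le_natDegree (degree_minpoly_residue_le K (L := L) he hπ hint)
  have hfr : Module.finrank K (fixedField N) =
      (minpoly (ResidueField A) (residue B α)).natDegree := by
    have h1 := Module.finrank_mul_finrank K (fixedField N) L
    rw [finrank_fixedField_eq_card, ← IsGalois.card_aut_eq_finrank K L, ← hdeg] at h1
    exact Nat.eq_of_mul_eq_mul_right Nat.card_pos h1
  -- The residue degree bounds [K(α) : K] from below by [G : N], which is the degree of the fixed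
  -- field containing K(α).
  have heq : K⟮algebraMap B L α⟯ = fixedField N := by
    apply eq_of_le_of_finrank_le hle
    rw [hfr, adjoin.finrank hint]
    exact hnat
  have hnat' : (minpoly K (algebraMap B L α)).natDegree =
      (minpoly (ResidueField A) (residue B α)).natDegree := by
    rw [← adjoin.finrank hint, heq, hfr]
  have hbK : algebraMap B L b ∈ Algebra.adjoin K {algebraMap B L α} := by
    rw [← adjoin_simple_toSubalgebra_of_isAlgebraic hint.isAlgebraic, heq]
    exact hmem b hb
  rw [Algebra.adjoin_singleton_eq_range_aeval] at hbK
  obtain ⟨P, hP⟩ := hbK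
  have hPdeg := degree_modByMonic_lt P (minpoly.monic hint)
  rw [degree_eq_natDegree (minpoly.ne_zero hint), hnat', ← degree_eq_natDegree hne] at hPdeg
  obtain ⟨Q, hQ, hQb⟩ := exists_map_eq_of_aeval_eq_algebraMap K (L := L) (b := b) he hπ hPdeg
    (by rw [aeval_modByMonic_eq_self_of_root (minpoly.aeval K _)]; exact hP)
  refine ⟨Q, ?_, hQb⟩
  rwa [← hQ, degree_map_eq_of_injective (IsFractionRing.injective A K)] at hPdeg

theorem natDegree_minpoly_eq_finrank (H : IsInsepGenerator (ResidueField A) (residue B h) a₀) :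
    (minpoly (ResidueField A) (residue B h)).natDegree =
      Module.finrank (ResidueField A) (ResidueField B) := by
  have := H.finiteDimensional
  rw [← adjoin.finrank (IsIntegral.of_finite _ _), H.adjoin_eq_top, finrank_top']

/-- The fundamental identity with e = 1. By Nakayama the first [E : F] powers of h span B over A,
which bounds [L : K] above; the degree of the minimal polynomial of h bounds it below. -/
theorem card_gal_eq_finrank_residueField
    (he : (maximalIdeal A).map (algebraMap A B) = maximalIdeal B)
    (hπ : Irreducible π) (H : IsInsepGenerator (ResidueField A) (residue B h) a₀) :
    Nat.card Gal(L/K) = Module.finrank (ResidueField A) (ResidueField B) := by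
  have := H.finiteDimensional
  have := faithfulSMul_of_isIntegralClosure A B L
  have hfin : Module.Finite A B := IsIntegralClosure.finite A K L B
  set q := Module.finrank (ResidueField A) (ResidueField B) 
  rw [IsGalois.card_aut_eq_finrank]
  have hdeg : _ = q := natDegree_minpoly_eq_finrank H
  apply le_antisymm
  · let S : Submodule A B := Submodule.span A (Set.range fun i : Fin q => h ^ (i : ℕ))
    have hS : S = ⊤ := by
      rw [eq_top_iff]
      -- Nakayama: every b is a polynomial in h of degree less than [E : F] up to a multiple of π,
      -- since 𝔪_L is generated by π.
      apply Submodule.le_of_le_smul_of_le_jacobson_bot (I := maximalIdeal A) hfin.fg_top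
        (maximalIdeal_le_jacobson _)
      intro b _
      have hb : residue B b ∈ Algebra.adjoin (ResidueField A) {residue B h} := by
        rw [← adjoin_simple_toSubalgebra_of_isAlgebraic (IsIntegral.of_finite _ _).isAlgebraic,
          H.adjoin_eq_top]
        trivial
      rw [Algebra.adjoin_singleton_eq_range_aeval] at hb
      obtain ⟨P, hP⟩ := hb
      have hint := IsIntegral.of_finite (ResidueField A) (residue B h)
      have hPdeg := natDegree_modByMonic_lt P (minpoly.monic hint) (minpoly.ne_one _ _)
      obtain ⟨Q, hQ, hQdeg⟩ := (exists_degree_eq_of_mem_lifts (f := residue A)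
        ((mem_lifts _).2 (map_surjective _ residue_surjective (P %ₘ minpoly _ (residue B h)))))
      have hQb : residue B (b - aeval h Q) = 0 := by
        rw [map_sub, residue_aeval, hQ, aeval_modByMonic_eq_self_of_root (minpoly.aeval _ _),
          sub_eq_zero]
        exact hP.symm
      obtain ⟨c, hc⟩ := (residue_eq_zero_iff_dvd (irreducible_algebraMap he hπ) _).1 hQb
      rw [← sub_add_cancel b (aeval h Q), add_comm, hc]
      apply Submodule.add_mem_sup
      · rw [aeval_eq_sum_range' (n := q)]
        · refine Submodule.sum_mem _ fun i hi => Submodule.smul_mem _ _ (Submodule.subset_span ?_)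
          exact ⟨⟨i, Finset.mem_range.1 hi⟩, rfl⟩
        · rw [natDegree_eq_of_degree_eq hQdeg, ← hdeg]
          exact hPdeg
      · rw [← Algebra.smul_def]
        exact Submodule.smul_mem_smul ((mem_maximalIdeal π).2 hπ.not_isUnit) trivial
    have hT : Submodule.span K (Set.range fun i : Fin q => algebraMap B L h ^ (i : ℕ)) = ⊤ := by
      rw [eq_top_iff]
      intro x _
      have hloc := IsIntegralClosure.isLocalization A K L B
      obtain ⟨⟨b, ⟨_, a, ha, rfl⟩⟩, hx⟩ :=
        IsLocalization.surj (Algebra.algebraMapSubmonoid B (nonZeroDivisors A)) x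
      have ha0 : algebraMap A K a ≠ 0 := by
        simpa using nonZeroDivisors.ne_zero ha
      have hb : ∀ b : B, algebraMap B L b ∈
          Submodule.span K (Set.range fun i : Fin q => algebraMap B L h ^ (i : ℕ)) := by
        intro b
        have hbS : b ∈ S := hS ▸ Submodule.mem_top
        induction hbS using Submodule.span_induction with
        | mem b hb =>
          obtain ⟨i, rfl⟩ := hb
          exact Submodule.subset_span ⟨i, (map_pow _ _ _).symm⟩
        | zero => simp
        | add b c _ _ hb hc => rw [map_add]; exact add_mem hb hc
        | smul a b _ hb =>
          rw [Algebra.smul_def, map_mul, ← IsScalarTower.algebraMap_apply,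
            IsScalarTower.algebraMap_apply A K L, ← Algebra.smul_def]
          exact Submodule.smul_mem _ _ hb
      have hx' : x = (algebraMap A K a)⁻¹ • algebraMap B L b := by
        rw [← hx, ← IsScalarTower.algebraMap_apply, IsScalarTower.algebraMap_apply A K L, mul_comm,
          ← Algebra.smul_def, smul_smul, inv_mul_cancel₀ ha0, one_smul]
      rw [hx']
      exact Submodule.smul_mem _ _ (hb b)
    rw [← finrank_top, ← hT]
    exact (finrank_range_le_card _).trans (by simp)
  · rw [← hdeg]
    have hint := IsIntegral.of_finite K (algebraMap B L h)
    exact (natDegree_le_natDegree (degree_minpoly_residue_le K (L := L) he hπ hint)).trans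
      (minpoly.natDegree_le _)

/-- Taking N trivial in `exists_aeval_eq_of_fixed` gives B = A[h], so an automorphism fixing h is
trivial. -/
theorem eq_one_of_displacement_eq_zero
    (he : (maximalIdeal A).map (algebraMap A B) = maximalIdeal B)
    (hπ : Irreducible π) (H : IsInsepGenerator (ResidueField A) (residue B h) a₀) {σ : Gal(L/K)}
    (hσ : displacement A K L h σ = 0) : σ = 1 := by
  apply (galRestrict A K L B).injective
  ext b
  obtain ⟨P, -, rfl⟩ := exists_aeval_eq_of_fixed K L he hπ ⊥ (α := h) (b := b)
    (by simp) (by rw [natDegree_minpoly_eq_finrank H, card_gal_eq_finrank_residueField K L he hπ H,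
      Subgroup.card_bot, mul_one]) (by simp)
  rw [← aeval_algHom_apply, ← (sub_eq_zero.1 hσ), map_one]
  rfl

theorem displacement_ne_zero (he : (maximalIdeal A).map (algebraMap A B) = maximalIdeal B)
    (hπ : Irreducible π) (H : IsInsepGenerator (ResidueField A) (residue B h) a₀) {σ : Gal(L/K)}
    (hσ : σ ≠ 1) : displacement A K L h σ ≠ 0 :=
  fun h0 => hσ (eq_one_of_displacement_eq_zero K L he hπ H h0)

end Galois

/-! ## The last lower ramification group -/

section LastGroup

set_option linter.unusedSectionVars false

variable {A B : Type*} (K L : Type*) [CommRing A] [IsDomain A] [IsDiscreteValuationRing A]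
  [CommRing B] [IsDomain B] [IsDiscreteValuationRing B] [Algebra A B]
  [IsLocalHom (algebraMap A B)] [Field K] [Algebra A K] [IsFractionRing A K]
  [Field L] [Algebra K L] [FiniteDimensional K L] [Algebra A L] [IsScalarTower A K L]
  [Algebra B L] [IsScalarTower A B L] [IsIntegralClosure B A L]
  {π : A} {h : B} {a₀ : ResidueField A}

/-- The largest valuation of `h - σ(h)`, for `σ ≠ 1`. -/
noncomputable def lastBreak (A : Type*) {B : Type*} (K L : Type*) [CommRing A] [CommRing B]
    [IsDomain B] [IsDiscreteValuationRing B] [Algebra A B] [Field K] [Algebra A K]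
    [IsFractionRing A K] [Field L] [Algebra K L] [FiniteDimensional K L] [Algebra A L]
    [IsScalarTower A K L] [Algebra B L] [IsScalarTower A B L] [IsIntegralClosure B A L]
    (h : B) : ℕ :=
  open Classical in
  (Finset.univ.erase (1 : Gal(L/K))).sup (fun σ => ord (displacement A K L h σ))

/-- The last non-trivial lower ramification group. -/
def lastGroup (π : A) (h : B) : Subgroup Gal(L/K) where
  carrier := {σ | algebraMap A B π ^ lastBreak A K L h ∣ displacement A K L h σ}
  one_mem' := by simp
  mul_mem' := fun {σ τ} hσ hτ => by
    rw [Set.mem_ofPred_eq] at *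
    rw [displacement_mul]
    refine dvd_add hσ ?_
    have := map_dvd (galRestrict A K L B σ) hτ
    rwa [map_pow, AlgEquiv.commutes] at this
  inv_mem' := fun {σ} hσ => by
    rw [Set.mem_ofPred_eq] at *
    have h1 := displacement_mul (A := A) (h := h) K L σ⁻¹ σ
    rw [inv_mul_cancel, displacement_one] at h1
    rw [eq_neg_of_add_eq_zero_left h1.symm, dvd_neg]
    have := map_dvd (galRestrict A K L B σ⁻¹) hσ
    rwa [map_pow, AlgEquiv.commutes] at this

theorem mem_lastGroup {σ : Gal(L/K)} : σ ∈ lastGroup K L π h ↔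
    algebraMap A B π ^ lastBreak A K L h ∣ displacement A K L h σ := Iff.rfl

@[simp]
theorem uMap_one : uMap A K L π h (1 : Gal(L/K)) = 0 := by
  rw [uMap, displacement_one, leadCoeff_zero]

variable {K L} in
theorem ord_displacement_le_lastBreak {σ : Gal(L/K)} (hσ : σ ≠ 1) :
    ord (displacement A K L h σ) ≤ lastBreak A K L h := by
  classical
  rw [lastBreak]
  convert Finset.le_sup (f := fun σ => ord (displacement A K L h σ))
    (Finset.mem_erase.2 ⟨hσ, Finset.mem_univ σ⟩)

variable {K L} in
open Classical in
theorem conductor_eq : conductor A K L h = lastBreak A K L h +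
    ∑ σ ∈ Finset.univ.erase (1 : Gal(L/K)), ord (displacement A K L h σ) := by
  rw [conductor, lastBreak]

variable [IsGalois K L] (he : (maximalIdeal A).map (algebraMap A B) = maximalIdeal B)
    (hπ : Irreducible π) (H : IsInsepGenerator (ResidueField A) (residue B h) a₀)

include he hπ H

theorem uMap_ne_zero {σ : Gal(L/K)} (hσ : σ ≠ 1) : uMap A K L π h σ ≠ 0 :=
  leadCoeff_ne_zero (irreducible_algebraMap he hπ) (displacement_ne_zero K L he hπ H hσ)

theorem exists_displacement_eq {σ : Gal(L/K)} (hσ : σ ≠ 1) :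
    ∃ w : B, displacement A K L h σ = algebraMap A B π ^ ord (displacement A K L h σ) * w ∧
      residue B w = uMap A K L π h σ := by
  obtain ⟨w, -, h1, h2⟩ := exists_eq_pow_mul (irreducible_algebraMap he hπ)
    (displacement_ne_zero K L he hπ H hσ)
  exact ⟨w, h1, h2⟩

theorem mem_lastGroup_iff {σ : Gal(L/K)} (hσ : σ ≠ 1) :
    σ ∈ lastGroup K L π h ↔ ord (displacement A K L h σ) = lastBreak A K L h := by
  have hϖ := irreducible_algebraMap (B := B) he hπ
  obtain ⟨w, hw, hwu⟩ := exists_displacement_eq K L he hπ H hσ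
  rw [mem_lastGroup]
  constructor
  · intro hdvd
    refine le_antisymm (ord_displacement_le_lastBreak hσ) ?_
    by_contra! hlt
    obtain ⟨m, hm⟩ := Nat.exists_eq_add_of_lt hlt
    rw [hw, hm, add_assoc, pow_add, mul_dvd_mul_iff_left (pow_ne_zero _ hϖ.ne_zero)] at hdvd
    apply uMap_ne_zero K L he hπ H hσ
    rw [← hwu, residue_eq_zero_iff_dvd hϖ]
    exact (dvd_pow_self _ (Nat.succ_ne_zero m)).trans hdvd
  · intro h1
    rw [← h1]
    exact ⟨w, hw⟩

/-- The identity is included, with quotient 0; this is where the convention u_1 = 0 makes u additive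
on the whole group. -/
theorem exists_displacement_eq_lastBreak {σ : Gal(L/K)} (hσ : σ ∈ lastGroup K L π h) :
    ∃ w : B, displacement A K L h σ = algebraMap A B π ^ lastBreak A K L h * w ∧
      residue B w = uMap A K L π h σ := by
  by_cases h1 : σ = 1
  · subst h1
    exact ⟨0, by simp, by simp⟩
  · rw [← (mem_lastGroup_iff K L he hπ H h1).1 hσ]
    exact exists_displacement_eq K L he hπ H h1

theorem uMap_eq_of_displacement_eq {σ : Gal(L/K)} {w : B}
    (h1 : displacement A K L h σ = algebraMap A B π ^ lastBreak A K L h * w) :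
    residue B w = uMap A K L π h σ := by
  obtain ⟨w', h2, h3⟩ := exists_displacement_eq_lastBreak K L he hπ H ⟨w, h1⟩
  rw [h1] at h2
  rw [mul_left_cancel₀ (pow_ne_zero _ (irreducible_algebraMap he hπ).ne_zero) h2, h3]

variable (p : ℕ) [Fact p.Prime] [CharP (ResidueField A) p]

include p

/-- Divide the cocycle relation by the common power of π and reduce; σ disappears from the second
term because it acts trivially on E. -/
theorem uMap_mul {σ τ : Gal(L/K)} (hσ : σ ∈ lastGroup K L π h) (hτ : τ ∈ lastGroup K L π h) :
    uMap A K L π h (σ * τ) = uMap A K L π h σ + uMap A K L π h τ := by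
  obtain ⟨w, hw, hwu⟩ := exists_displacement_eq_lastBreak K L he hπ H hσ
  obtain ⟨v, hv, hvu⟩ := exists_displacement_eq_lastBreak K L he hπ H hτ
  rw [← uMap_eq_of_displacement_eq K L he hπ H (w := w + galRestrict A K L B σ v), map_add,
    residue_galRestrict K L p H, hwu, hvu]
  rw [displacement_mul, hw, hv, map_mul, map_pow, AlgEquiv.commutes]
  ring

theorem uMap_pow {σ : Gal(L/K)} (hσ : σ ∈ lastGroup K L π h) (n : ℕ) :
    uMap A K L π h (σ ^ n) = n * uMap A K L π h σ := by
  induction n with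
  | zero => simp
  | succ n ih =>
    rw [pow_succ, uMap_mul K L he hπ H p (pow_mem hσ n) hσ, ih]
    push_cast
    ring

/-- By additivity u takes the value p·u_σ = 0 at σ^p, and u vanishes only at 1. -/
theorem pow_eq_one_of_mem_lastGroup {σ : Gal(L/K)} (hσ : σ ∈ lastGroup K L π h) : σ ^ p = 1 := by
  have : CharP (ResidueField B) p :=
    charP_of_injective_algebraMap (algebraMap (ResidueField A) (ResidueField B)).injective p
  by_contra h1
  apply uMap_ne_zero K L he hπ H h1
  rw [uMap_pow K L he hπ H p hσ, CharP.cast_eq_zero, zero_mul]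

/-- In the cocycle relation the term coming from τ has strictly larger valuation than h - σ(h), so
the leading part does not change. -/
theorem displacement_mul_of_notMem {σ τ : Gal(L/K)} (hσ : σ ∉ lastGroup K L π h)
    (hτ : τ ∈ lastGroup K L π h) :
    ord (displacement A K L h (σ * τ)) = ord (displacement A K L h σ) ∧
      uMap A K L π h (σ * τ) = uMap A K L π h σ := by
  have hϖ := irreducible_algebraMap (B := B) he hπ
  have hσ1 : σ ≠ 1 := fun h1 => hσ (h1 ▸ one_mem _)
  obtain ⟨w, hw, hwu⟩ := exists_displacement_eq K L he hπ H hσ1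
  obtain ⟨v, hv, hvu⟩ := exists_displacement_eq_lastBreak K L he hπ H hτ
  obtain ⟨m, hm⟩ := Nat.exists_eq_add_of_lt (lt_of_le_of_ne (ord_displacement_le_lastBreak hσ1)
    (mt (mem_lastGroup_iff K L he hπ H hσ1).2 hσ))
  have hx : displacement A K L h (σ * τ) = algebraMap A B π ^ ord (displacement A K L h σ) *
      (w + algebraMap A B π * (algebraMap A B π ^ m * galRestrict A K L B σ v)) := by
    rw [displacement_mul, hv, map_mul, map_pow, AlgEquiv.commutes, hm, mul_add, ← hw]
    ring
  have hres : residue B (w + algebraMap A B π * (algebraMap A B π ^ m * galRestrict A K L B σ v)) =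
      uMap A K L π h σ := by
    rw [map_add, hwu, (residue_eq_zero_iff_dvd hϖ _).2 (dvd_mul_right _ _), add_zero]
  have h2 := eq_pow_mul_of_residue_ne_zero hϖ hx (hres ▸ uMap_ne_zero K L he hπ H hσ1)
  exact ⟨h2.1, h2.2.trans hres⟩

end LastGroup

/-! ## Connectedness of closed discs -/

section Disc

variable {M : Type*} [Field M] {v : AbsoluteValue M ℝ}

theorem abv_sub_le_max (hv : IsNonarchimedean v) (x y z : M) :
    v (x - z) ≤ max (v (x - y)) (v (y - z)) := by
  rw [← sub_add_sub_cancel x y z]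
  exact hv _ _

theorem abv_sub_eq_of_lt (hv : IsNonarchimedean v) {x y z : M} (h : v (x - y) < v (y - z)) :
    v (x - z) = v (y - z) := by
  rw [← sub_add_sub_cancel x y z]
  exact IsNonarchimedean.add_eq_right_of_lt hv h

variable [IsAlgClosed M]

/-- Take a root t of ∏ (X - x) + 1. The numbers v(t - x) multiply to 1; if v(t) > 1 they would all
exceed 1, so they are all at most 1 and hence all equal to 1. In effect, t avoids finitely many
residue classes. -/
theorem exists_forall_one_le_abv_sub (hv : IsNonarchimedean v) (s : Finset M)
    (hs : ∀ x ∈ s, v x ≤ 1) : ∃ t, v t ≤ 1 ∧ ∀ x ∈ s, 1 ≤ v (t - x) := by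
  rcases s.eq_empty_or_nonempty with rfl | hne
  · exact ⟨0, by simp, by simp⟩
  have hcard : 0 < s.card := hne.card_pos
  have hdeg : (∏ x ∈ s, (X - C x) : M[X]).degree = s.card := by
    rw [degree_prod]; simp
  have hdeg' : (∏ x ∈ s, (X - C x) + C 1 : M[X]).degree = s.card := by
    rw [degree_add_eq_left_of_degree_lt, hdeg]
    rw [hdeg]
    exact lt_of_le_of_lt degree_C_le (by exact_mod_cast hcard)
  obtain ⟨t, ht⟩ := IsAlgClosed.exists_root (∏ x ∈ s, (X - C x) + C 1 : M[X]) (by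
    rw [hdeg']; exact_mod_cast hcard.ne')
  have hprod : ∏ x ∈ s, v (t - x) = 1 := by
    have h1 : ∏ x ∈ s, (t - x) = -1 := by
      simpa [IsRoot, eval_prod, add_eq_zero_iff_eq_neg] using ht
    rw [← map_prod, h1, AbsoluteValue.map_neg, map_one]
  have ht1 : v t ≤ 1 := by
    by_contra! hlt
    have h2 : ∀ x ∈ s, v (t - x) = v t := fun x hx => by
      have := abv_sub_eq_of_lt (x := x) (y := 0) (z := t) hv
        (by rw [sub_zero, zero_sub, AbsoluteValue.map_neg]; exact (hs x hx).trans_lt hlt)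
      rwa [zero_sub, AbsoluteValue.map_neg, v.map_sub] at this
    rw [Finset.prod_congr rfl h2, Finset.prod_const] at hprod
    exact (one_lt_pow₀ hlt hcard.ne').ne' hprod
  classical
  refine ⟨t, ht1, fun x hx => ?_⟩
  have hle : ∀ y ∈ s, v (t - y) ≤ 1 := fun y hy => by
    have := abv_sub_le_max hv t 0 y
    rw [sub_zero, zero_sub, AbsoluteValue.map_neg] at this
    exact this.trans (max_le ht1 (hs y hy))
  by_contra! hlt
  rw [← Finset.mul_prod_erase s _ hx] at hprod
  have h2 : ∏ y ∈ s.erase x, v (t - y) ≤ 1 :=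
    Finset.prod_le_one (fun _ _ => v.nonneg _) fun y hy => hle y (Finset.mem_of_mem_erase hy)
  exact ((mul_le_of_le_one_right (v.nonneg _) h2).trans_lt hlt).ne hprod

theorem abv_eval_le_of_forall_roots (P : M[X]) {w z : M}
    (h : ∀ x ∈ P.roots, v (w - x) ≤ v (z - x)) : v (P.eval w) ≤ v (P.eval z) := by
  rw [(IsAlgClosed.splits P).eval_eq_prod_roots, (IsAlgClosed.splits P).eval_eq_prod_roots, map_mul,
    map_mul]
  refine mul_le_mul_of_nonneg_left ?_ (v.nonneg _)
  have hprod : ∀ y : M, v (P.roots.map fun x => y - x).prod =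
      (P.roots.map fun x => v (y - x)).prod := by
    intro y
    rw [map_multiset_prod, Multiset.map_map]
    rfl
  rw [hprod, hprod]
  exact Multiset.prod_map_le_prod_map₀ _ _ (fun _ _ => v.nonneg _) h

/-- A closed disc of radius `v b` contains a point at which any polynomial with roots among a given
finite set assumes its maximal absolute value on the disc. -/
theorem exists_generic_point (hv : IsNonarchimedean v) (a : M) {b : M} (hb : b ≠ 0)
    (s : Finset M) : ∃ z, v (z - a) ≤ v b ∧
      ∀ x ∈ s, ∀ w, v (w - a) ≤ v b → v (w - x) ≤ v (z - x) := by
  classical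
  have hb' : 0 < v b := v.pos hb
  obtain ⟨t, ht, hts⟩ := exists_forall_one_le_abv_sub hv
    ((s.filter fun x => v (x - a) ≤ v b).image fun x => (x - a) / b) (by
      intro y hy
      simp only [Finset.mem_image, Finset.mem_filter] at hy
      obtain ⟨x, ⟨-, hx⟩, rfl⟩ := hy
      rw [map_div₀]
      exact div_le_one_of_le₀ hx hb'.le)
  refine ⟨a + b * t, ?_, fun x hx w hw => ?_⟩
  · rw [add_sub_cancel_left, map_mul]
    exact mul_le_of_le_one_right hb'.le ht
  have hz : v (a + b * t - a) ≤ v b := by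
    rw [add_sub_cancel_left, map_mul]
    exact mul_le_of_le_one_right hb'.le ht
  -- A point x of the disc is at distance at least v(b) from the chosen point, the largest distance
  -- possible within the disc. A point x outside is equidistant from all points of the disc.
  by_cases hxa : v (x - a) ≤ v b
  · have h1 := hts ((x - a) / b)
      (Finset.mem_image.2 ⟨x, Finset.mem_filter.2 ⟨hx, hxa⟩, rfl⟩)
    have h2 : a + b * t - x = b * (t - (x - a) / b) := by field_simp; ring
    have h3 : v b ≤ v (a + b * t - x) := by
      rw [h2, map_mul]
      exact le_mul_of_one_le_right hb'.le h1
    rw [v.map_sub] at hxa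
    exact ((abv_sub_le_max hv w a x).trans (max_le hw hxa)).trans h3
  · rw [not_le, v.map_sub] at hxa
    rw [abv_sub_eq_of_lt hv (hw.trans_lt hxa), abv_sub_eq_of_lt hv (hz.trans_lt hxa)]

/-- A rational function without poles on a closed disc cannot be close to `1` at one point of the
disc and close to `0` at another one, if it is close to `0` or `1` everywhere on the disc. -/
theorem abv_div_sub_dichotomy_const (hv : IsNonarchimedean v) {a b : M} (hb : b ≠ 0) {P Q : M[X]}
    (hQ : ∀ z, v (z - a) ≤ v b → Q.eval z ≠ 0)
    (hPQ : ∀ z, v (z - a) ≤ v b → v (P.eval z / Q.eval z) < 1 ∨ v (P.eval z / Q.eval z - 1) < 1)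
    {z₁ z₂ : M} (h₁ : v (z₁ - a) ≤ v b) (h₂ : v (z₂ - a) ≤ v b)
    (hz₁ : v (P.eval z₁ / Q.eval z₁ - 1) < 1) (hz₂ : v (P.eval z₂ / Q.eval z₂) < 1) : False := by
  classical
  have hone : ∀ x y : M, v x < 1 → v (y - x) = 1 → v y = 1 := by
    intro x y hx hy
    have := IsNonarchimedean.add_eq_right_of_lt hv (x := x) (y := y - x) (by rwa [hy])
    rw [← hy, ← this]
    congr 1
    ring
  -- All roots of Q lie outside the disc, and each is equidistant from all its points, so |Q| is
  -- constant on the disc.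
  have hQconst : ∀ z w, v (z - a) ≤ v b → v (w - a) ≤ v b → v (Q.eval z) ≤ v (Q.eval w) := by
    intro z w hz hw
    apply abv_eval_le_of_forall_roots
    intro x hx
    have hxa : v b < v (a - x) := by
      by_contra! hle
      rw [v.map_sub] at hle
      exact hQ x hle (isRoot_of_mem_roots hx)
    rw [abv_sub_eq_of_lt hv (hw.trans_lt hxa), abv_sub_eq_of_lt hv (hz.trans_lt hxa)]
  -- At this point both |P| and |P - Q| are maximal. Comparison with z₁ and z₂ shows that both are
  -- at least the constant |Q|, so P/Q is close neither to 0 nor to 1 there.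
  obtain ⟨z, hz, hzs⟩ := exists_generic_point hv a hb (P.roots.toFinset ∪ (P - Q).roots.toFinset)
  have hQz := v.pos (hQ z hz)
  have e1 : v (P.eval z₁) ≤ v (P.eval z) := abv_eval_le_of_forall_roots P fun x hx =>
    hzs x (by simp only [Finset.mem_union, Multiset.mem_toFinset]; exact Or.inl hx) _ h₁
  have e2 : v ((P - Q).eval z₂) ≤ v ((P - Q).eval z) :=
    abv_eval_le_of_forall_roots (P - Q) fun x hx =>
      hzs x (by simp only [Finset.mem_union, Multiset.mem_toFinset]; exact Or.inr hx) _ h₂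
  have f1 : v (P.eval z₁) = v (Q.eval z₁) := by
    have h3 : v (P.eval z₁ / Q.eval z₁) = 1 := by
      apply hone (P.eval z₁ / Q.eval z₁ - 1) _ hz₁
      rw [sub_sub_cancel, map_one]
    rwa [map_div₀, div_eq_one_iff_eq (v.pos (hQ z₁ h₁)).ne'] at h3
  have f2 : v ((P - Q).eval z₂) = v (Q.eval z₂) := by
    have h3 : v (P.eval z₂ / Q.eval z₂ - 1) = 1 := by
      apply hone (P.eval z₂ / Q.eval z₂) _ hz₂
      rw [sub_sub_cancel_left, AbsoluteValue.map_neg, map_one]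
    rw [div_sub_one (hQ z₂ h₂), map_div₀, div_eq_one_iff_eq (v.pos (hQ z₂ h₂)).ne'] at h3
    rwa [eval_sub]
  rcases hPQ z hz with h | h
  · rw [map_div₀, div_lt_one hQz] at h
    exact absurd h (not_lt.2 ((hQconst z z₁ hz h₁).trans (f1.ge.trans e1)))
  · rw [div_sub_one (hQ z hz), map_div₀, div_lt_one hQz, ← eval_sub] at h
    exact absurd h (not_lt.2 ((hQconst z z₂ hz h₂).trans (f2.ge.trans e2)))

end Disc

/-! ## The spectral norm -/

section SpectralNorm

variable (K : Type*) [NontriviallyNormedField K] [IsUltrametricDist K] [CompleteSpace K]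

/-- The absolute value on an algebraic closure of a complete ultrametric field. -/
noncomputable def spectralAbv : AbsoluteValue (AlgebraicClosure K) ℝ where
  toFun := spectralNorm K (AlgebraicClosure K)
  map_mul' := spectralAlgNorm_mul
  nonneg' := spectralNorm_nonneg
  eq_zero' _ := ⟨fun h => eq_zero_of_map_spectralNorm_eq_zero h (Algebra.IsAlgebraic.isAlgebraic _), fun h => by rw [h]; exact spectralNorm_zero⟩
  add_le' := map_add_le_add (spectralAlgNorm K (AlgebraicClosure K))

theorem isNonarchimedean_spectralAbv : IsNonarchimedean (spectralAbv K) :=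
  isNonarchimedean_spectralNorm

theorem spectralAbv_apply (x : AlgebraicClosure K) :
    spectralAbv K x = spectralNorm K (AlgebraicClosure K) x := rfl

variable {K}

theorem spectralAbv_algebraMap (x : K) :
    spectralAbv K (algebraMap K (AlgebraicClosure K) x) = ‖x‖ :=
  spectralNorm_extends x

theorem spectralAbv_le_one {A : Type*} [CommRing A] [Algebra A K] (hA : ∀ a : A, ‖algebraMap A K a‖ ≤ 1)
    {P : A[X]} (hP : P.Monic) {x : AlgebraicClosure K}
    (hx : aeval x (P.map (algebraMap A K)) = 0) : spectralAbv K x ≤ 1 := by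
  have h1 := norm_root_le_spectralValue (f := spectralAlgNorm K (AlgebraicClosure K))
    isPowMul_spectralNorm isNonarchimedean_spectralNorm (hP.map (algebraMap A K)) hx
  refine h1.trans ((spectralValue_le_one_iff (hP.map _)).2 fun n => ?_)
  rw [coeff_map]
  exact hA _

/-- Two points of a closed disc contained in `X` lie in the same component of `X`. -/
theorem sameComponent_of_disc_subset {X : Set (AlgebraicClosure K)} {a b : AlgebraicClosure K}
    (hb : b ≠ 0) (hX : ∀ z, spectralAbv K (z - a) ≤ spectralAbv K b → z ∈ X)
    {x y : AlgebraicClosure K} (hx : spectralAbv K (x - a) ≤ spectralAbv K b)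
    (hy : spectralAbv K (y - a) ≤ spectralAbv K b) : SameComponent K X x y := by
  have key : ∀ x y : AlgebraicClosure K, spectralAbv K (x - a) ≤ spectralAbv K b →
      spectralAbv K (y - a) ≤ spectralAbv K b → ∀ S, IsAnalyticClopen K X S → x ∈ S → y ∈ S := by
    rintro x y hx hy S ⟨-, hS⟩ hxS
    by_contra hyS
    -- Precision 1 suffices, as the values 0 and 1 of the indicator are at distance 1.
    obtain ⟨P, Q, hPQ⟩ := hS 1 one_pos
    apply abv_div_sub_dichotomy_const (isNonarchimedean_spectralAbv K) hb (P := P) (Q := Q)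
      (fun z hz => (hPQ z (hX z hz)).1) _ hx hy
    · simpa [hxS, spectralAbv_apply] using (hPQ x (hX x hx)).2
    · simpa [-map_div₀, hyS, spectralAbv_apply] using (hPQ y (hX y hy)).2
    · intro z hz
      have := (hPQ z (hX z hz)).2
      by_cases hzS : z ∈ S
      · exact Or.inr (by simpa [hzS, spectralAbv_apply] using this)
      · exact Or.inl (by simpa [-map_div₀, hzS, spectralAbv_apply] using this)
  exact fun S hS => ⟨key x y hx hy S hS, key y x hy hx S hS⟩

/-- A closed disc is open and closed in `X` if `X` has no points in a closed annulus around it. -/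
theorem isAnalyticClopen_disc {Y : Set (AlgebraicClosure K)} {a b : AlgebraicClosure K}
    (hb : b ≠ 0) {θ : ℝ} (hθ : 0 < θ) (hθ1 : θ < 1) 
    (hY : ∀ z ∈ Y, spectralAbv K (z - a) ≤ spectralAbv K b * θ ∨
      spectralAbv K b ≤ spectralAbv K (z - a) * θ) :
    IsAnalyticClopen K Y {z | z ∈ Y ∧ spectralAbv K (z - a) ≤ spectralAbv K b * θ} := by
  refine ⟨fun z hz => hz.1, fun ε hε => ?_⟩
  obtain ⟨m, hm⟩ := exists_pow_lt_of_lt_one hε hθ1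
  have hb' : 0 < spectralAbv K b := (spectralAbv K).pos hb
  -- With w = (z - a)/b, the function 1/(1 + w^(m+1)) is near 1 for |w| ≤ θ and near 0 for |w| ≥
  -- 1/θ, with error at most θ^(m+1). The exponent m + 1 rather than m ensures θ^(m+1) < 1, so that
  -- there is no pole.
  refine ⟨1, 1 + (C b⁻¹ * (X - C a)) ^ (m + 1), fun z hz => ?_⟩
  have hθm : θ ^ (m + 1) ≤ θ ^ m := pow_le_pow_of_le_one hθ.le hθ1.le (Nat.le_succ m)
  have hθm1 : θ ^ (m + 1) < 1 := pow_lt_one₀ hθ.le hθ1 (Nat.succ_ne_zero m)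
  have hv := isNonarchimedean_spectralAbv K
  simp only [eval_one, eval_add, eval_pow, eval_mul, eval_C, eval_sub, eval_X]
  rw [← spectralAbv_apply]
  set w := b⁻¹ * (z - a) with hw
  have hvw : spectralAbv K w = spectralAbv K (z - a) / spectralAbv K b := by
    rw [hw, map_mul, map_inv₀, inv_mul_eq_div]
  rcases hY z hz with h | h
  · have hw1 : spectralAbv K w ≤ θ := by
      rw [hvw, div_le_iff₀ hb', mul_comm]
      exact h
    have hwm : spectralAbv K (w ^ (m + 1)) ≤ θ ^ (m + 1) := by
      rw [map_pow]
      exact pow_le_pow_left₀ ((spectralAbv K).nonneg _) hw1 _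
    have h1 : spectralAbv K (1 + w ^ (m + 1)) = 1 := by
      rw [IsNonarchimedean.add_eq_left_of_lt hv, map_one]
      rw [map_one]
      exact hwm.trans_lt hθm1
    have hne : 1 + w ^ (m + 1) ≠ 0 := fun h0 => by simp [h0] at h1
    refine ⟨hne, ?_⟩
    have hmem : z ∈ {z | z ∈ Y ∧ spectralAbv K (z - a) ≤ spectralAbv K b * θ} := ⟨hz, h⟩
    rw [Set.indicator_of_mem hmem, Pi.one_apply,
      div_sub_one hne, map_div₀, h1, div_one, sub_add_cancel_left, AbsoluteValue.map_neg]
    exact (hwm.trans hθm).trans_lt hm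
  · have hza : 0 < spectralAbv K (z - a) := by
      by_contra! h0
      have := mul_nonpos_of_nonpos_of_nonneg h0 hθ.le
      linarith
    have hw1 : θ⁻¹ ≤ spectralAbv K w := by
      rw [hvw, inv_le_iff_one_le_mul₀ hθ, mul_comm, mul_div_assoc', mul_comm θ,
        one_le_div hb']
      exact h
    have hwm : (θ ^ (m + 1))⁻¹ ≤ spectralAbv K (w ^ (m + 1)) := by
      rw [map_pow, ← inv_pow]
      exact pow_le_pow_left₀ (inv_nonneg.2 hθ.le) hw1 _
    have hgt : 1 < spectralAbv K (w ^ (m + 1)) :=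
      ((one_lt_inv₀ (pow_pos hθ _)).2 hθm1).trans_le hwm
    have h1 : spectralAbv K (1 + w ^ (m + 1)) = spectralAbv K (w ^ (m + 1)) := by
      rw [IsNonarchimedean.add_eq_right_of_lt hv]
      rwa [map_one]
    have hne : 1 + w ^ (m + 1) ≠ 0 := fun h0 => by
      rw [h0, map_zero] at h1
      linarith
    refine ⟨hne, ?_⟩
    have hnot : z ∉ {z | z ∈ Y ∧ spectralAbv K (z - a) ≤ spectralAbv K b * θ} := by
      rintro ⟨-, h2⟩
      have h3 := h.trans (mul_le_mul_of_nonneg_right h2 hθ.le)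
      rw [mul_assoc] at h3
      nlinarith
    rw [Set.indicator_of_notMem hnot, sub_zero, map_div₀, map_one, h1, one_div]
    exact ((inv_le_of_inv_le₀ (pow_pos hθ _) hwm).trans hθm).trans_lt hm

end SpectralNorm

/-! ## The upper ramification group at the conductor -/

theorem map_minpoly_eq_prod {K L : Type*} [Field K] [Field L] [Algebra K L] [FiniteDimensional K L]
    [IsGalois K L] {x : L} (hx : Function.Injective fun σ : Gal(L/K) => σ x) :
    (minpoly K x).map (algebraMap K L) = ∏ σ : Gal(L/K), (X - C (σ x)) := by
  have hint := IsIntegral.of_finite K x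
  apply eq_of_monic_of_dvd_of_natDegree_le (monic_prod_of_monic _ _ fun σ _ => monic_X_sub_C _)
    ((minpoly.monic hint).map _)
  · apply Finset.prod_dvd_of_coprime
    · exact (pairwise_coprime_X_sub_C hx).set_pairwise _
    · intro σ _
      rw [dvd_iff_isRoot, IsRoot.def, eval_map_algebraMap, aeval_algHom_apply σ x, minpoly.aeval,
        map_zero]
  · rw [natDegree_prod_of_monic _ _ fun σ _ => monic_X_sub_C _, natDegree_map]
    simp only [natDegree_X_sub_C, Finset.sum_const, Finset.card_univ, smul_eq_mul, mul_one]
    rw [← Nat.card_eq_fintype_card, IsGalois.card_aut_eq_finrank]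
    exact minpoly.natDegree_le x

section TopGroup

set_option linter.unusedSectionVars false

variable {A B : Type*} {K L : Type*} [CommRing A] [IsDomain A] [IsDiscreteValuationRing A]
  [CommRing B] [IsDomain B] [IsDiscreteValuationRing B] [Algebra A B]
  [IsLocalHom (algebraMap A B)] [NontriviallyNormedField K] [IsUltrametricDist K]
  [CompleteSpace K] [Algebra A K] [IsFractionRing A K]
  [Field L] [Algebra K L] [FiniteDimensional K L] [Algebra A L] [IsScalarTower A K L]
  [Algebra B L] [IsScalarTower A B L] [IsIntegralClosure B A L]
  {π : A} {h : B} {a₀ : ResidueField A}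
  (hA : ∀ x : K, ‖x‖ ≤ 1 ↔ ∃ a : A, algebraMap A K a = x)

include hA

theorem norm_uniformizer_pos_lt_one (hπ : Irreducible π) :
    0 < ‖algebraMap A K π‖ ∧ ‖algebraMap A K π‖ < 1 := by
  have h0 : algebraMap A K π ≠ 0 := by simpa using hπ.ne_zero
  refine ⟨norm_pos_iff.2 h0, lt_of_le_of_ne ((hA _).2 ⟨π, rfl⟩) fun h1 => ?_⟩
  obtain ⟨a, ha⟩ := (hA (algebraMap A K π)⁻¹).1 (by rw [norm_inv, h1, inv_one])
  apply hπ.not_isUnit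
  apply IsUnit.of_mul_eq_one a
  apply IsFractionRing.injective A K
  rw [map_mul, ha, map_one, mul_inv_cancel₀ h0]

theorem spectralAbv_le_one_of_integer (ι : L →ₐ[K] AlgebraicClosure K) (b : B) :
    spectralAbv K (ι (algebraMap B L b)) ≤ 1 := by
  obtain ⟨P, hP, hPb⟩ : IsIntegral A (algebraMap B L b) :=
    (IsIntegralClosure.isIntegral_iff (A := B)).2 ⟨b, rfl⟩
  apply spectralAbv_le_one (fun a => (hA _).2 ⟨a, rfl⟩) hP
  rw [aeval_algHom_apply, aeval_map_algebraMap, aeval_def, hPb, map_zero]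

/-- As e = 1, π is a uniformizer of L; a unit and its inverse are both integral, so the unit has
absolute value 1. -/
theorem spectralAbv_eq_pow_ord (he : (maximalIdeal A).map (algebraMap A B) = maximalIdeal B)
    (hπ : Irreducible π) (ι : L →ₐ[K] AlgebraicClosure K) {b : B} (hb : b ≠ 0) :
    spectralAbv K (ι (algebraMap B L b)) = ‖algebraMap A K π‖ ^ ord b := by
  obtain ⟨y, hy, h1, -⟩ := exists_eq_pow_mul (irreducible_algebraMap (B := B) he hπ) hb
  have hy1 : spectralAbv K (ι (algebraMap B L y)) = 1 := by
    obtain ⟨z, hz⟩ := hy.exists_right_inv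
    have h2 : spectralAbv K (ι (algebraMap B L y)) * spectralAbv K (ι (algebraMap B L z)) = 1 := by
      rw [← map_mul, ← map_mul, ← map_mul, hz, map_one, map_one, map_one]
    have h3 := spectralAbv_le_one_of_integer hA ι y
    have h4 := spectralAbv_le_one_of_integer hA ι z
    refine le_antisymm h3 ?_
    rw [← h2]
    exact mul_le_of_le_one_right ((spectralAbv K).nonneg _) h4
  conv_lhs => rw [h1]
  rw [map_mul, map_mul, map_mul, hy1, mul_one, map_pow, map_pow, map_pow,
    ← IsScalarTower.algebraMap_apply, IsScalarTower.algebraMap_apply A K L, AlgHom.commutes,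
    spectralAbv_algebraMap]

omit hA in
theorem algebraMap_displacement (σ : Gal(L/K)) :
    algebraMap B L (displacement A K L h σ) = algebraMap B L h - σ (algebraMap B L h) := by
  rw [displacement, map_sub, algebraMap_galRestrict_apply]

variable [IsGalois K L]
  (he : (maximalIdeal A).map (algebraMap A B) = maximalIdeal B)
  (hπ : Irreducible π) (H : IsInsepGenerator (ResidueField A) (residue B h) a₀)

include he hπ H

omit hA in
theorem injective_conjugates : Function.Injective fun σ : Gal(L/K) => σ (algebraMap B L h) := by
  have := faithfulSMul_of_isIntegralClosure A B L
  intro σ τ hστ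
  have h1 : displacement A K L h (σ⁻¹ * τ) = 0 := by
    apply FaithfulSMul.algebraMap_injective B L
    rw [algebraMap_displacement, map_zero, AlgEquiv.mul_apply, sub_eq_zero]
    have h2 : σ (algebraMap B L h) = τ (algebraMap B L h) := hστ
    rw [← h2]
    simp
  exact (inv_mul_eq_one.1 (eq_one_of_displacement_eq_zero K L he hπ H h1))

omit hA in
theorem spectralAbv_aeval_minpoly (ι : L →ₐ[K] AlgebraicClosure K) (z : AlgebraicClosure K) :
    spectralAbv K (aeval z (minpoly K (algebraMap B L h))) =
      ∏ σ : Gal(L/K), spectralAbv K (z - ι (σ (algebraMap B L h))) := by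
  have h1 : aeval z (minpoly K (algebraMap B L h)) =
      ((minpoly K (algebraMap B L h)).map (algebraMap K L)).eval₂ (ι : L →+* AlgebraicClosure K) z := by
    rw [eval₂_map, aeval_def]
    congr 1
    exact ι.comp_algebraMap.symm
  rw [h1, map_minpoly_eq_prod (injective_conjugates he hπ H), eval₂_finsetProd, map_prod]
  simp

theorem spectralAbv_conjugate_sub (ι : L →ₐ[K] AlgebraicClosure K) {σ τ : Gal(L/K)} (hστ : σ ≠ τ) :
    spectralAbv K (ι (σ (algebraMap B L h)) - ι (τ (algebraMap B L h))) =
      ‖algebraMap A K π‖ ^ ord (displacement A K L h (σ⁻¹ * τ)) := by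
  rw [← spectralAbv_eq_pow_ord hA he hπ (ι.comp (σ : L →ₐ[K] L)) (displacement_ne_zero K L he hπ H
    (fun h1 => hστ (inv_mul_eq_one.1 h1))), algebraMap_displacement]
  have h1 : σ (algebraMap B L h - (σ⁻¹ * τ) (algebraMap B L h)) =
      σ (algebraMap B L h) - τ (algebraMap B L h) := by
    rw [map_sub, ← AlgEquiv.mul_apply, mul_inv_cancel_left]
  change _ = spectralAbv K (ι (σ (algebraMap B L h - (σ⁻¹ * τ) (algebraMap B L h))))
  rw [h1, map_sub ι]

omit he hπ H in
theorem mem_tube_iff {r : ℕ} {z : AlgebraicClosure K} : z ∈ tube A K L π h r ↔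
    spectralAbv K z ≤ 1 ∧ spectralAbv K (aeval z (minpoly K (algebraMap B L h))) ≤
      ‖algebraMap A K π‖ ^ r := by
  rw [tube, Set.mem_ofPred_eq, Rat.cast_natCast, Real.rpow_natCast]
  rfl

/-- In f(z) = ∏ (z - σ(h)) the factor of σ = 1 is at most |π| to the power `lastBreak`, and any
other factor is at most |h - σ(h)|, which is no smaller than that radius. The exponents add up to c.
-/
theorem mem_tube_of_close (ι : L →ₐ[K] AlgebraicClosure K) {z : AlgebraicClosure K}
    (hz : spectralAbv K (z - ι (algebraMap B L h)) ≤ ‖algebraMap A K π‖ ^ lastBreak A K L h) :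
    z ∈ tube A K L π h (conductor A K L h) := by
  classical
  have hv := isNonarchimedean_spectralAbv K
  obtain ⟨h0, h1⟩ := norm_uniformizer_pos_lt_one hA hπ
  rw [mem_tube_iff hA]
  constructor
  · have := abv_sub_le_max hv z (ι (algebraMap B L h)) 0
    rw [sub_zero, sub_zero] at this
    exact this.trans (max_le (hz.trans (pow_le_one₀ h0.le h1.le))
      (spectralAbv_le_one_of_integer hA ι h))
  · rw [spectralAbv_aeval_minpoly he hπ H ι, ← Finset.mul_prod_erase _ _ (Finset.mem_univ 1),
      conductor_eq, pow_add, ← Finset.prod_pow_eq_pow_sum]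
    refine mul_le_mul (by simpa using hz) (Finset.prod_le_prod (fun _ _ => (spectralAbv K).nonneg _)
      fun σ hσ => ?_) (Finset.prod_nonneg fun _ _ => (spectralAbv K).nonneg _)
      (pow_nonneg h0.le _)
    have hσ1 : σ ≠ 1 := (Finset.mem_erase.1 hσ).1
    have h2 := spectralAbv_conjugate_sub hA he hπ H ι hσ1.symm
    rw [inv_one, one_mul, AlgEquiv.one_apply] at h2
    refine (abv_sub_le_max hv z (ι (algebraMap B L h)) _).trans (max_le (hz.trans ?_) h2.le)
    exact pow_le_pow_of_le_one h0.le h1.le (ord_displacement_le_lastBreak hσ1)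

/-- Take the conjugate σ(h) nearest to z. Every other factor satisfies |z - τ(h)| ≥ |σ(h) - τ(h)|,
so if the nearest distance exceeded the radius, |f(z)| would exceed |π|^c. -/
theorem exists_close_of_mem_tube (ι : L →ₐ[K] AlgebraicClosure K) {z : AlgebraicClosure K}
    (hz : z ∈ tube A K L π h (conductor A K L h)) : ∃ σ : Gal(L/K),
    spectralAbv K (z - ι (σ (algebraMap B L h))) ≤ ‖algebraMap A K π‖ ^ lastBreak A K L h := by
  classical
  have hv := isNonarchimedean_spectralAbv K
  obtain ⟨h0, h1⟩ := norm_uniformizer_pos_lt_one hA hπ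
  obtain ⟨σ, -, hσ⟩ := Finset.exists_min_image Finset.univ
    (fun σ : Gal(L/K) => spectralAbv K (z - ι (σ (algebraMap B L h)))) ⟨1, Finset.mem_univ 1⟩
  refine ⟨σ, ?_⟩
  by_contra! hlt
  have hle := ((mem_tube_iff hA).1 hz).2
  rw [spectralAbv_aeval_minpoly he hπ H ι, ← Finset.mul_prod_erase _ _ (Finset.mem_univ σ)] at hle
  have hprod : ∏ τ ∈ Finset.univ.erase σ, spectralAbv K (z - ι (τ (algebraMap B L h))) ≥
      ∏ τ ∈ Finset.univ.erase (1 : Gal(L/K)),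
        ‖algebraMap A K π‖ ^ ord (displacement A K L h τ) := by
    rw [ge_iff_le, Finset.prod_bij (i := fun τ _ => σ * τ) (t := Finset.univ.erase σ)
      (g := fun τ => ‖algebraMap A K π‖ ^ ord (displacement A K L h (σ⁻¹ * τ)))]
    · refine Finset.prod_le_prod (fun _ _ => pow_nonneg h0.le _) fun τ hτ => ?_
      rw [← spectralAbv_conjugate_sub hA he hπ H ι (Finset.mem_erase.1 hτ).1.symm]
      refine (abv_sub_le_max hv _ z _).trans (max_le ?_ le_rfl)
      rw [(spectralAbv K).map_sub]
      exact hσ τ (Finset.mem_univ τ)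
    · intro τ hτ
      simpa using hτ
    · intro τ _ τ' _ h
      exact mul_left_cancel h
    · intro τ hτ
      exact ⟨σ⁻¹ * τ, by simpa [inv_mul_eq_one, eq_comm] using hτ, by simp⟩
    · intro τ _
      simp
  rw [conductor_eq, pow_add, ← Finset.prod_pow_eq_pow_sum] at hle
  have hpos : 0 < ∏ τ ∈ Finset.univ.erase (1 : Gal(L/K)),
        ‖algebraMap A K π‖ ^ ord (displacement A K L h τ) :=
    Finset.prod_pos fun _ _ => pow_pos h0 _
  exact absurd hle (not_le.2 ((mul_lt_mul_of_pos_right hlt hpos).trans_le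
    (mul_le_mul_of_nonneg_left hprod ((spectralAbv K).nonneg _))))

theorem sameComponent_of_mem_lastGroup {σ : Gal(L/K)} (hσ : σ ∈ lastGroup K L π h)
    (ι : L →ₐ[K] AlgebraicClosure K) :
    SameComponent K (tube A K L π h (conductor A K L h)) (ι (algebraMap B L h))
      (ι (σ (algebraMap B L h))) := by
  by_cases h1 : σ = 1
  · subst h1
    exact fun S _ => Iff.rfl
  have hb0 : algebraMap A K π ^ lastBreak A K L h ≠ 0 :=
    pow_ne_zero _ (norm_pos_iff.1 (norm_uniformizer_pos_lt_one hA hπ).1)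
  have hb : spectralAbv K (algebraMap K _ (algebraMap A K π ^ lastBreak A K L h)) =
      ‖algebraMap A K π‖ ^ lastBreak A K L h := by
    rw [spectralAbv_algebraMap, norm_pow]
  apply sameComponent_of_disc_subset (a := ι (algebraMap B L h))
    (b := algebraMap K _ (algebraMap A K π ^ lastBreak A K L h))
  · rwa [Ne, map_eq_zero]
  · intro z hz
    exact mem_tube_of_close hA he hπ H ι (hb ▸ hz)
  · rw [sub_self, map_zero]
    exact (spectralAbv K).nonneg _
  · rw [hb, (spectralAbv K).map_sub]
    have h2 := spectralAbv_conjugate_sub hA he hπ H ι (Ne.symm h1)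
    rw [inv_one, one_mul, AlgEquiv.one_apply, (mem_lastGroup_iff K L he hπ H h1).1 hσ] at h2
    exact h2.le

theorem mem_lastGroup_of_sameComponent {σ : Gal(L/K)} (ι : L →ₐ[K] AlgebraicClosure K)
    (hσ : SameComponent K (tube A K L π h (conductor A K L h)) (ι (algebraMap B L h))
      (ι (σ (algebraMap B L h)))) : σ ∈ lastGroup K L π h := by
  by_cases hσ1 : σ = 1
  · exact hσ1 ▸ one_mem _
  have hv := isNonarchimedean_spectralAbv K
  obtain ⟨h0, h1⟩ := norm_uniformizer_pos_lt_one hA hπ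
  rw [mem_lastGroup_iff K L he hπ H hσ1]
  refine le_antisymm (ord_displacement_le_lastBreak hσ1) ?_
  by_contra! hlt
  obtain ⟨m, hm⟩ := Nat.exists_eq_add_of_lt hlt
  set q := ‖algebraMap A K π‖
  -- a radius strictly between the ones of the discs and their distances
  obtain ⟨b, hb⟩ := IsAlgClosed.exists_pow_nat_eq (k := AlgebraicClosure K)
    (algebraMap K _ (algebraMap A K π ^ (2 * (lastBreak A K L h - 1) + 1))) two_pos
  obtain ⟨S, hS⟩ : ∃ S, lastBreak A K L h = S + 1 := ⟨_, hm⟩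
  rw [hS] at hb
  have hvb : spectralAbv K b ^ 2 = q ^ (2 * S + 1) := by
    rw [← map_pow, hb, spectralAbv_algebraMap, norm_pow]
    rfl
  have hvb' : spectralAbv K b = q ^ S * √q := by
    rw [← Real.sqrt_sq ((spectralAbv K).nonneg b), hvb, pow_succ, Real.sqrt_mul (by positivity),
      mul_comm 2 S, pow_mul, Real.sqrt_sq (by positivity)]
  have hq : 0 < √q := Real.sqrt_pos.2 h0
  have hq1 : √q < 1 := by rw [Real.sqrt_lt' one_pos]; simpa using h1
  have hqq : √q * √q = q := Real.mul_self_sqrt h0.le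
  have hb1 : spectralAbv K b * √q = q ^ lastBreak A K L h := by
    rw [hvb', mul_assoc, hqq, hS, pow_succ]
  have hb2 : spectralAbv K b = q ^ S * √q := hvb'
  have hb0 : b ≠ 0 := by
    intro h2
    rw [h2, map_zero] at hvb'
    exact (mul_pos (pow_pos h0 S) hq).ne hvb'
  -- Valuations are integers: a conjugate outside the closed disc of radius q^(S+1) around h is at
  -- distance at least q^S. The annulus between |b|·√q = q^(S+1) and |b|/√q = q^S is therefore
  -- empty.
  have hfar : ∀ τ : Gal(L/K), q ^ lastBreak A K L h <
      spectralAbv K (ι (τ (algebraMap B L h)) - ι (algebraMap B L h)) →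
      q ^ S ≤ spectralAbv K (ι (τ (algebraMap B L h)) - ι (algebraMap B L h)) := by
    intro τ hτ
    have hτ1 : τ ≠ 1 := by
      rintro rfl
      rw [AlgEquiv.one_apply, sub_self, map_zero] at hτ
      exact absurd hτ (not_lt.2 (by positivity))
    have h2 := spectralAbv_conjugate_sub hA he hπ H ι (Ne.symm hτ1)
    rw [inv_one, one_mul, AlgEquiv.one_apply, (spectralAbv K).map_sub] at h2
    rw [h2] at hτ ⊢
    have h3 := (pow_lt_pow_iff_right_of_lt_one₀ h0 h1).1 hτ
    exact pow_le_pow_of_le_one h0.le h1.le (by omega)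
  have hclopen := isAnalyticClopen_disc (a := ι (algebraMap B L h)) (b := b) hb0 hq hq1
    (Y := tube A K L π h (conductor A K L h)) (by
      intro z hz
      rw [hb1, hb2]
      obtain ⟨τ, hτ⟩ := exists_close_of_mem_tube hA he hπ H ι hz
      by_cases hle : spectralAbv K (ι (τ (algebraMap B L h)) - ι (algebraMap B L h)) ≤
          q ^ lastBreak A K L h
      · exact Or.inl ((abv_sub_le_max hv _ _ _).trans (max_le hτ hle))
      · rw [not_le] at hle
        right
        rw [abv_sub_eq_of_lt hv (hτ.trans_lt hle)]
        exact mul_le_mul_of_nonneg_right (hfar τ hle) hq.le)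
  have hmem := (hσ _ hclopen).1 ⟨mem_tube_of_close hA he hπ H ι (by
      rw [sub_self, map_zero]; positivity), by
      rw [sub_self, map_zero, hb1]; positivity⟩
  have h2 := hmem.2
  have h3 := spectralAbv_conjugate_sub hA he hπ H ι (Ne.symm hσ1)
  rw [inv_one, one_mul, AlgEquiv.one_apply, (spectralAbv K).map_sub] at h3
  rw [hb1, h3] at h2
  have h4 := (pow_le_pow_iff_right_of_lt_one₀ h0 h1).1 h2
  omega

theorem topGroup_eq_lastGroup : topGroup A K L π h = lastGroup K L π h := by
  ext σ
  constructor
  · intro hσ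
    -- A single embedding of L is enough for this inclusion, and one exists.
    exact mem_lastGroup_of_sameComponent hA he hπ H (IsAlgClosed.lift : L →ₐ[K] AlgebraicClosure K)
      (hσ _)
  · intro hσ ι
    exact sameComponent_of_mem_lastGroup hA he hπ H hσ ι

end TopGroup

/-! ## Descent of a product of leading coefficients to the residue field of `K` -/

theorem prod_coset_eq {G M : Type*} [Group G] [Fintype G] [CommMonoid M] (N : Subgroup G)
    [Fintype N] [DecidableEq (G ⧸ N)] (σ : G) (f : G → M) :
    ∏ ρ ∈ Finset.univ.filter (fun ρ : G => (ρ : G ⧸ N) = (σ : G ⧸ N)), f ρ =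
      ∏ s : N, f (σ * s) := by
  symm
  refine Finset.prod_bij (fun s _ => σ * s) (fun s _ => by simp) (fun s _ t _ h => ?_)
    (fun ρ hρ => ?_) (fun _ _ => rfl)
  · exact Subtype.ext (mul_left_cancel h)
  · rw [Finset.mem_filter, eq_comm, QuotientGroup.eq] at hρ
    exact ⟨⟨_, hρ.2⟩, Finset.mem_univ _, by simp⟩

theorem sum_coset_eq {G M : Type*} [Group G] [Fintype G] [AddCommMonoid M] (N : Subgroup G)
    [Fintype N] [DecidableEq (G ⧸ N)] (σ : G) (f : G → M) :
    ∑ ρ ∈ Finset.univ.filter (fun ρ : G => (ρ : G ⧸ N) = (σ : G ⧸ N)), f ρ =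
      ∑ s : N, f (σ * s) :=
  prod_coset_eq (M := Multiplicative M) N σ f

theorem neg_one_pow_eq_neg_one_of_charP (R : Type*) [CommRing R] (p : ℕ) [Fact p.Prime] [CharP R p]
    (n : ℕ) : (-1 : R) ^ p ^ n = -1 := by
  have := sub_pow_char_pow (p := p) (n := n) (0 : R) 1
  rwa [zero_sub, one_pow, zero_pow (pow_pos (Fact.out : p.Prime).pos n).ne', zero_sub] at this

/-- The power x^n is a root of X^d - a. Conversely, substituting X^n in its minimal polynomial gives
a polynomial that kills x, so its degree times n is at least q = dn. -/
theorem natDegree_minpoly_pow_mul {F E : Type*} [Field F] [Field E] [Algebra F E]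
    [FiniteDimensional F E] {x : E} {a : F} {q n d : ℕ} (hmin : minpoly F x = X ^ q - C a)
    (hq : 0 < q) (hd : d * n = q) : (minpoly F (x ^ n)).natDegree = d := by
  have hd0 : 0 < d := Nat.pos_of_ne_zero (by rintro rfl; omega)
  have hn0 : 0 < n := Nat.pos_of_ne_zero (by rintro rfl; omega)
  have hxq : x ^ q = algebraMap F E a := by
    have := minpoly.aeval F x
    rwa [hmin, map_sub, map_pow, aeval_X, aeval_C, sub_eq_zero] at this
  apply le_antisymm
  · have h1 : aeval (x ^ n) (X ^ d - C a : F[X]) = 0 := by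
      rw [map_sub, map_pow, aeval_X, aeval_C, ← pow_mul, mul_comm n d, hd, hxq, sub_self]
    have h2 := natDegree_le_of_dvd (minpoly.dvd F (x ^ n) h1) (X_pow_sub_C_ne_zero hd0 a)
    rwa [natDegree_X_pow_sub_C] at h2
  · have h1 : aeval x (expand F n (minpoly F (x ^ n))) = 0 := by
      rw [expand_aeval, minpoly.aeval]
    have hne : expand F n (minpoly F (x ^ n)) ≠ 0 :=
      (expand_ne_zero hn0).2 (minpoly.ne_zero (IsIntegral.of_finite F _))
    have h2 := natDegree_le_of_dvd (minpoly.dvd F x h1) hne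
    rw [hmin, natDegree_X_pow_sub_C, natDegree_expand, ← hd] at h2
    exact Nat.le_of_mul_le_mul_right h2 hn0

section Descent

set_option linter.unusedSectionVars false

variable {A B : Type*} {K L : Type*} [CommRing A] [IsDomain A] [IsDiscreteValuationRing A]
  [CommRing B] [IsDomain B] [IsDiscreteValuationRing B] [Algebra A B]
  [IsLocalHom (algebraMap A B)] [Field K] [Algebra A K] [IsFractionRing A K]
  [Field L] [Algebra K L] [FiniteDimensional K L] [Algebra A L] [IsScalarTower A K L]
  [Algebra B L] [IsScalarTower A B L] [IsIntegralClosure B A L]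
  {π : A} {h : B} {a₀ : ResidueField A} (N : Subgroup Gal(L/K))

variable (A) in
/-- `b` is fixed by `N`. -/
def IsFixed (b : B) : Prop := ∀ s ∈ N, galRestrict A K L B s b = b

variable {N}

theorem IsFixed.sub {b c : B} (hb : IsFixed A N b) (hc : IsFixed A N c) : IsFixed A N (b - c) :=
  fun s hs => by rw [map_sub, hb s hs, hc s hs]

theorem IsFixed.mul {b c : B} (hb : IsFixed A N b) (hc : IsFixed A N c) : IsFixed A N (b * c) :=
  fun s hs => by rw [map_mul, hb s hs, hc s hs]

theorem IsFixed.pow {b : B} (hb : IsFixed A N b) (n : ℕ) : IsFixed A N (b ^ n) :=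
  fun s hs => by rw [map_pow, hb s hs]

theorem IsFixed.prod {ι : Type*} {t : Finset ι} {f : ι → B} (hf : ∀ i ∈ t, IsFixed A N (f i)) :
    IsFixed A N (∏ i ∈ t, f i) :=
  fun s hs => by rw [map_prod]; exact Finset.prod_congr rfl fun i hi => hf i hi s hs

theorem isFixed_algebraMap (a : A) : IsFixed A N (algebraMap A B a) :=
  fun _ _ => AlgEquiv.commutes _ a

theorem IsFixed.of_mul {b c : B} (hb0 : b ≠ 0) (hb : IsFixed A N b) (hbc : IsFixed A N (b * c)) :
    IsFixed A N c := fun s hs => by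
  have := hbc s hs
  rw [map_mul, hb s hs] at this
  exact mul_left_cancel₀ hb0 this

theorem galRestrict_mul_apply (σ τ : Gal(L/K)) (b : B) :
    galRestrict A K L B (σ * τ) b = galRestrict A K L B σ (galRestrict A K L B τ b) := by
  rw [map_mul, AlgEquiv.mul_apply]

theorem IsFixed.galRestrict [N.Normal] {b : B} (hb : IsFixed A N b) (σ : Gal(L/K)) :
    IsFixed A N (galRestrict A K L B σ b) := fun s hs => by
  rw [← galRestrict_mul_apply, show s * σ = σ * (σ⁻¹ * s * σ) by group, galRestrict_mul_apply,
    hb _ (by simpa using Subgroup.Normal.conj_mem ‹_› s hs σ⁻¹)]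


theorem galRestrict_out_apply {b : B} (hb : IsFixed A N b) (σ : Gal(L/K)) :
    galRestrict A K L B (σ : Gal(L/K) ⧸ N).out b = galRestrict A K L B σ b := by
  obtain ⟨s, hs⟩ := QuotientGroup.mk_out_eq_mul N σ
  rw [hs, galRestrict_mul_apply, hb s s.2]

variable [Fintype N]

variable (A h N) in
/-- The product of the conjugates of `h` under `N`. -/
noncomputable def normElement : B :=
  ∏ s : N, galRestrict A K L B s h

theorem isFixed_normElement : IsFixed A N (normElement A h N) := by
  intro s hs
  rw [normElement, map_prod]
  refine Fintype.prod_equiv (Equiv.mulLeft (⟨s, hs⟩ : N)) _ _ fun t => ?_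
  rw [Equiv.coe_mulLeft, Subgroup.coe_mul, galRestrict_mul_apply]

theorem isFixed_coeff_prod (l : ℕ) :
    IsFixed A N ((∏ s : N, (X - C (galRestrict A K L B s h))).coeff l) := by
  intro s hs
  have h1 : (∏ t : N, (X - C (galRestrict A K L B t h))).map
      (galRestrict A K L B s : B →+* B) = ∏ t : N, (X - C (galRestrict A K L B t h)) := by
    rw [Polynomial.map_prod]
    refine Fintype.prod_equiv (Equiv.mulLeft ⟨s, hs⟩) _ _ fun t => ?_
    rw [Polynomial.map_sub, map_X, map_C, Equiv.coe_mulLeft, Subgroup.coe_mul,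
      galRestrict_mul_apply]
    rfl
  conv_rhs => rw [← h1, coeff_map]
  rfl

variable [IsGalois K L] (he : (maximalIdeal A).map (algebraMap A B) = maximalIdeal B)
    (hπ : Irreducible π) (H : IsInsepGenerator (ResidueField A) (residue B h) a₀)
    (p : ℕ) [Fact p.Prime] [CharP (ResidueField A) p]

include he hπ H p

omit he hπ [IsGalois K L] in
theorem residue_normElement :
    residue B (normElement A h N) = residue B h ^ Nat.card N := by
  rw [normElement, map_prod, Finset.prod_congr rfl fun s _ => residue_galRestrict K L p H _ h,
    Finset.prod_const, Finset.card_univ, Nat.card_eq_fintype_card]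

theorem natDegree_minpoly_residue_normElement {d : ℕ} (hd : d * Nat.card N = Nat.card Gal(L/K)) :
    (minpoly (ResidueField A) (residue B (normElement A h N))).natDegree = d := by
  have := H.finiteDimensional
  obtain ⟨n, hn, hmin⟩ := H.exists_minpoly p
  rw [residue_normElement H p]
  apply natDegree_minpoly_pow_mul hmin (pow_pos (Fact.out : p.Prime).pos _)
  rw [hd, card_gal_eq_finrank_residueField K L he hπ H, hn]

theorem card_eq_pow : ∃ n, Nat.card N = p ^ n := by
  obtain ⟨n, hn, -⟩ := H.exists_minpoly p
  have h1 := Subgroup.card_subgroup_dvd_card N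
  rw [card_gal_eq_finrank_residueField K L he hπ H, hn, Nat.dvd_prime_pow Fact.out] at h1
  obtain ⟨m, -, hm⟩ := h1
  exact ⟨m, hm⟩

/-- The ring of integers of the fixed field of N is A[α], for α the norm of h: the residue class of
α is h̄^#N, of degree [G : N] over F. -/
theorem exists_aeval_normElement {b : B} (hb : IsFixed A N b) {d : ℕ}
    (hd : d * Nat.card N = Nat.card Gal(L/K)) :
    ∃ P : A[X], P.degree < d ∧ aeval (normElement A h N) P = b := by
  have h1 := natDegree_minpoly_residue_normElement he hπ H p hd
  have h2 : (minpoly (ResidueField A) (residue B (normElement A h N))).degree = d := by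
    rw [← h1]
    exact degree_eq_natDegree (minpoly.ne_zero
      (have := H.finiteDimensional; IsIntegral.of_finite _ _))
  rw [← h2]
  exact exists_aeval_eq_of_fixed K L he hπ N isFixed_normElement (by rw [h1, hd]) hb

/-- As b = P(α), its conjugate is P(σ(α)), and σ(α) - α divides P(σ(α)) - P(α). -/
theorem sub_dvd_galRestrict_sub {b : B} (hb : IsFixed A N b) (σ : Gal(L/K)) :
    galRestrict A K L B σ (normElement A h N) - normElement A h N ∣
      galRestrict A K L B σ b - b := by
  obtain ⟨P, -, rfl⟩ := exists_aeval_normElement he hπ H p hb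
    (d := N.index) (by rw [mul_comm]; exact N.card_mul_index)
  have h1 : galRestrict A K L B σ (aeval (normElement A h N) P) =
      aeval (galRestrict A K L B σ (normElement A h N)) P :=
    (aeval_algHom_apply (galRestrict A K L B σ) _ P).symm
  rw [h1, aeval_def, aeval_def, eval₂_eq_eval_map, eval₂_eq_eval_map]
  exact sub_dvd_eval_sub _ _ _

/-- The leading coefficient of `α - σ(α)`, for `α` the product of the conjugates of `h` under `N`. -/
theorem exists_normElement_sub_eq {σ : Gal(L/K)} (hσ : σ ∉ N) :
    ∃ (n : ℕ) (w : B), normElement A h N - galRestrict A K L B σ (normElement A h N) =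
      algebraMap A B π ^ n * w ∧ residue B w = ∏ s : N, uMap A K L π h (σ * s) := by
  have hϖ := irreducible_algebraMap (B := B) he hπ
  have : CharP (ResidueField B) p :=
    charP_of_injective_algebraMap (algebraMap (ResidueField A) (ResidueField B)).injective p
  obtain ⟨e, hcard⟩ := card_eq_pow (N := N) he hπ H p
  set α := normElement A h N with hα
  set R : B[X] := ∏ s : N, (X - C (galRestrict A K L B s h)) with hR
  have hR0 : R.coeff 0 = (-1) ^ Nat.card N * α := by
    rw [coeff_zero_eq_eval_zero, hR, eval_prod]
    simp only [eval_sub, eval_X, eval_C, zero_sub]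
    rw [Finset.prod_neg, Finset.card_univ, Nat.card_eq_fintype_card]
    rfl
  have hRmonic : R.Monic := monic_prod_of_monic _ _ fun s _ => monic_X_sub_C _
  have hRdeg : R.natDegree = Nat.card N := by
    rw [hR, natDegree_prod_of_monic _ _ fun s _ => monic_X_sub_C _]
    simp
  -- N acts trivially on E and has p-power order, so the intermediate coefficients of R are
  -- divisible by π.
  have hRres : R.map (residue B) = X ^ Nat.card N - C (residue B h) ^ Nat.card N := by
    rw [hR, Polynomial.map_prod]
    simp only [Polynomial.map_sub, map_X, map_C, residue_galRestrict K L p H]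
    rw [Finset.prod_const, Finset.card_univ, ← Nat.card_eq_fintype_card, hcard, sub_pow_char_pow]
  set D : B[X] := R.map (galRestrict A K L B σ : B →+* B) - R with hD
  have hDeval : D.eval h = ∏ s : N, displacement A K L h (σ * s) := by
    have h1 : R.eval h = 0 := by
      rw [hR, eval_prod]
      apply Finset.prod_eq_zero (Finset.mem_univ 1)
      simp
    rw [hD, eval_sub, h1, sub_zero, hR, Polynomial.map_prod, eval_prod]
    refine Finset.prod_congr rfl fun s _ => ?_
    rw [Polynomial.map_sub, map_X, map_C, eval_sub, eval_X, eval_C, displacement,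
      galRestrict_mul_apply]
    rfl
  have hDcoeff : ∀ l, D.coeff l = galRestrict A K L B σ (R.coeff l) - R.coeff l := by
    intro l
    rw [hD, coeff_sub, coeff_map]
    rfl
  -- An intermediate coefficient of R is π·c with c fixed by N, and σ(c) - c is divisible by σ(α) -
  -- α. The top coefficient is 1 and contributes nothing to D.
  have hdvd : C (algebraMap A B π * (galRestrict A K L B σ α - α)) ∣ D.divX := by
    rw [C_dvd_iff_dvd_coeff]
    intro l
    rw [coeff_divX, hDcoeff]
    by_cases hl : l + 1 = Nat.card N
    · rw [hl, ← hRdeg, hRmonic.coeff_natDegree, map_one, sub_self]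
      exact dvd_zero _
    · have h1 : residue B (R.coeff (l + 1)) = 0 := by
        rw [← coeff_map, hRres, coeff_sub, coeff_X_pow, if_neg hl, ← C_pow, coeff_C_succ, sub_zero]
      obtain ⟨c, hc⟩ := (residue_eq_zero_iff_dvd hϖ _).1 h1
      have hcfix : IsFixed A N c := (isFixed_algebraMap π).of_mul hϖ.ne_zero
        (hc ▸ isFixed_coeff_prod (l + 1))
      rw [hc, map_mul, AlgEquiv.commutes, ← mul_sub]
      exact mul_dvd_mul_left _ (sub_dvd_galRestrict_sub he hπ H p hcfix σ)
  obtain ⟨Z, hZ⟩ := hdvd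
  -- Evaluating D at h gives ∏ (h - σs(h)) on one side. On the other, only the constant coefficient
  -- matters modulo π(σ(α) - α), so the product is (σ(α) - α)·U with U ≡ -1, also when p = 2.
  set U : B := (-1) ^ Nat.card N + algebraMap A B π * (Z.eval h * h) with hU
  have hUeq : D.eval h = (galRestrict A K L B σ α - α) * U := by
    rw [← divX_mul_X_add D, hZ, hDcoeff, hR0, map_mul (galRestrict A K L B σ), map_pow, map_neg,
      map_one, hU]
    simp only [eval_add, eval_mul, eval_C, eval_X]
    ring
  have hUres : residue B (-U) = 1 := by
    rw [hU, map_neg, map_add, map_pow, map_neg, map_one, hcard, neg_one_pow_eq_neg_one_of_charP,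
      (residue_eq_zero_iff_dvd hϖ _).2 (dvd_mul_right _ _), add_zero, neg_neg]
  obtain ⟨V, hV⟩ := ((residue_ne_zero_iff_isUnit (-U)).1 (hUres ▸ one_ne_zero)).exists_right_inv
  have hVres : residue B V = 1 := by
    have := congrArg (residue B) hV
    rwa [map_mul, hUres, one_mul, map_one] at this
  have hσs : ∀ s : N, σ * s ≠ 1 := fun s hs => hσ (by
    rw [mul_eq_one_iff_eq_inv] at hs
    exact hs ▸ inv_mem s.2)
  choose w hw hwu using fun s : N => exists_displacement_eq K L he hπ H (hσs s)
  refine ⟨∑ s : N, ord (displacement A K L h (σ * s)), (∏ s : N, w s) * V, ?_, ?_⟩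
  · rw [← mul_assoc, ← Finset.prod_pow_eq_pow_sum, ← Finset.prod_mul_distrib,
      ← Finset.prod_congr rfl fun s _ => hw s, ← hDeval, hUeq]
    calc α - galRestrict A K L B σ α = (α - galRestrict A K L B σ α) * (-U * V) := by
          rw [hV, mul_one]
      _ = _ := by ring
  · rw [map_mul, hVres, mul_one, map_prod]
    exact Finset.prod_congr rfl fun s _ => hwu s

end Descent

/-! ### Traces from the fixed field of a normal subgroup and the different -/

section Descent

set_option linter.unusedSectionVars false

variable {A B : Type*} {K L : Type*} [CommRing A] [IsDomain A] [IsDiscreteValuationRing A]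
  [CommRing B] [IsDomain B] [IsDiscreteValuationRing B] [Algebra A B]
  [IsLocalHom (algebraMap A B)] [Field K] [Algebra A K] [IsFractionRing A K]
  [Field L] [Algebra K L] [FiniteDimensional K L] [Algebra A L] [IsScalarTower A K L]
  [Algebra B L] [IsScalarTower A B L] [IsIntegralClosure B A L]
  {π : A} {h : B} {a₀ : ResidueField A} {N : Subgroup Gal(L/K)} [N.Normal]

/-- For N-fixed b the sum over coset representatives is the trace of the fixed field, and
translation by γ permutes the cosets. -/
theorem sum_galRestrict_sub_eq_zero [Fintype (Gal(L/K) ⧸ N)] {b : B} (hb : IsFixed A N b)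
    (γ : Gal(L/K)) :
    ∑ x : Gal(L/K) ⧸ N, galRestrict A K L B x.out (b - galRestrict A K L B γ b) = 0 := by
  simp only [map_sub, Finset.sum_sub_distrib]
  rw [sub_eq_zero]
  symm
  refine Fintype.sum_equiv (Equiv.mulRight (γ : Gal(L/K) ⧸ N)) _ _ fun x => ?_
  rw [← galRestrict_mul_apply, ← galRestrict_out_apply hb, QuotientGroup.mk_mul,
    QuotientGroup.out_eq', Equiv.coe_mulRight]

open Classical in
variable (A h N) in
/-- The product of the differences of `α` and its other conjugates, for `α` the product of the
conjugates of `h` under `N`. -/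
noncomputable def differentElement [Fintype N] [Fintype (Gal(L/K) ⧸ N)] : B :=
  ∏ x ∈ Finset.univ.erase (1 : Gal(L/K) ⧸ N),
    (normElement A h N - galRestrict A K L B x.out (normElement A h N))

variable [Fintype N] [Fintype (Gal(L/K) ⧸ N)]

theorem isFixed_differentElement : IsFixed A N (differentElement A h N) :=
  IsFixed.prod fun _ _ => isFixed_normElement.sub (isFixed_normElement.galRestrict _)

variable [IsGalois K L] (he : (maximalIdeal A).map (algebraMap A B) = maximalIdeal B)
    (hπ : Irreducible π) (H : IsInsepGenerator (ResidueField A) (residue B h) a₀)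
    (p : ℕ) [Fact p.Prime] [CharP (ResidueField A) p]

include he hπ H p

theorem normElement_sub_ne_zero {σ : Gal(L/K)} (hσ : σ ∉ N) :
    normElement A h N - galRestrict A K L B σ (normElement A h N) ≠ 0 := by
  obtain ⟨n, w, h1, h2⟩ := exists_normElement_sub_eq he hπ H p hσ
  rw [h1]
  refine mul_ne_zero (pow_ne_zero n (irreducible_algebraMap he hπ).ne_zero) ?_
  rintro rfl
  rw [map_zero] at h2
  refine Finset.prod_ne_zero_iff.2 (fun s _ => uMap_ne_zero K L he hπ H fun hs => hσ ?_) h2.symm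
  rw [mul_eq_one_iff_eq_inv] at hs
  exact hs ▸ inv_mem s.2

theorem out_notMem {x : Gal(L/K) ⧸ N} (hx : x ≠ 1) : x.out ∉ N := by
  rwa [← QuotientGroup.eq_one_iff, QuotientGroup.out_eq']

theorem differentElement_ne_zero : differentElement A h N ≠ 0 := by
  classical
  rw [differentElement]
  exact Finset.prod_ne_zero_iff.2 fun x hx =>
    normElement_sub_ne_zero he hπ H p (out_notMem he hπ H p (Finset.mem_erase.1 hx).1)

/-- The top coefficient of a polynomial in `α` is the sum of the conjugates of its quotient by the
different. -/
theorem coeff_eq_zero_of_sum_eq_zero {P : A[X]} {m : ℕ} {y : B}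
    (hP : P.degree < (Fintype.card (Gal(L/K) ⧸ N) : ℕ))
    (hy : ∑ x : Gal(L/K) ⧸ N, galRestrict A K L B x.out y = 0)
    (hb : differentElement A h N * y = algebraMap A B π ^ m * aeval (normElement A h N) P) :
    P.coeff (Fintype.card (Gal(L/K) ⧸ N) - 1) = 0 := by
  classical
  have hBL := faithfulSMul_of_isIntegralClosure A B L
  have hinj := FaithfulSMul.algebraMap_injective B L
  have hAL : Function.Injective (algebraMap A L) := by
    rw [IsScalarTower.algebraMap_eq A K L]
    exact (algebraMap K L).injective.comp (IsFractionRing.injective A K)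
  have hϖ := irreducible_algebraMap (B := B) he hπ
  set α := normElement A h N with hα
  have hαfix : IsFixed A N α := isFixed_normElement
  let v : Gal(L/K) ⧸ N → L := fun x => algebraMap B L (galRestrict A K L B x.out α)
  have hv : Function.Injective v := by
    intro x y hxy
    by_contra hne
    have h1 : galRestrict A K L B x.out α = galRestrict A K L B y.out α := hinj hxy
    have h2 : (x.out)⁻¹ * y.out ∉ N := by
      rw [← QuotientGroup.eq, QuotientGroup.out_eq', QuotientGroup.out_eq']
      exact hne
    apply normElement_sub_ne_zero he hπ H p h2
    rw [sub_eq_zero, galRestrict_mul_apply, ← h1, ← galRestrict_mul_apply, inv_mul_cancel, map_one]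
    rfl
  -- The substitution z ↦ xz carries the product of differences at x to the x-conjugate of the
  -- product at 1.
  have hprod : ∀ x, ∏ z ∈ Finset.univ.erase x, (v x - v z) =
      algebraMap B L (galRestrict A K L B x.out (differentElement A h N)) := by
    intro x
    rw [differentElement, map_prod, map_prod]
    symm
    refine Finset.prod_bij (fun z _ => x * z) (fun z hz => ?_) (fun z _ w _ h => mul_left_cancel h)
      (fun z hz => ⟨x⁻¹ * z, ?_, by simp⟩) fun z _ => ?_
    · simpa using hz
    · simpa [inv_mul_eq_one, eq_comm] using hz
    · rw [map_sub, map_sub, ← galRestrict_mul_apply, ← galRestrict_out_apply hαfix (x.out * z.out),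
        QuotientGroup.mk_mul, QuotientGroup.out_eq', QuotientGroup.out_eq']
  have heval : ∀ x, (P.map (algebraMap A L)).eval (v x) =
      algebraMap B L (galRestrict A K L B x.out (aeval α P)) := by
    intro x
    rw [eval_map_algebraMap, aeval_algebraMap_apply, aeval_algHom_apply]
  -- Lagrange interpolation at the conjugates of α is Euler's formula: the top coefficient of P is
  -- the sum of the P(x(α)) divided by the conjugates of the different.
  have hLag := Lagrange.coeff_eq_sum (s := Finset.univ) (v := v) hv.injOn
    (P := P.map (algebraMap A L)) (by
      rwa [degree_map_eq_of_injective hAL, Finset.card_univ])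
  rw [Finset.card_univ, coeff_map] at hLag
  apply hAL
  rw [hLag, map_zero]
  have hϖL : algebraMap B L (algebraMap A B π) ^ m ≠ 0 :=
    pow_ne_zero _ ((map_ne_zero_iff _ hinj).2 hϖ.ne_zero)
  have hterm : ∀ x, (P.map (algebraMap A L)).eval (v x) / ∏ z ∈ Finset.univ.erase x, (v x - v z) =
      algebraMap B L (galRestrict A K L B x.out y) / algebraMap B L (algebraMap A B π) ^ m := by
    intro x
    have h1 := congrArg (fun b => algebraMap B L (galRestrict A K L B x.out b)) hb
    simp only [map_mul, map_pow, AlgEquiv.commutes] at h1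
    have hne : algebraMap B L (galRestrict A K L B x.out (differentElement A h N)) ≠ 0 := by
      rw [map_ne_zero_iff _ hinj, EmbeddingLike.map_ne_zero_iff]
      exact differentElement_ne_zero he hπ H p
    rw [hprod, heval, div_eq_div_iff hne hϖL, mul_comm, ← h1, mul_comm]
  rw [Finset.sum_congr rfl fun x _ => hterm x, ← Finset.sum_div, ← map_sum, hy, map_zero, zero_div]

open Classical in
-- Multiply the leading terms of `exists_normElement_sub_eq` over the non-trivial cosets, which
-- together make up the complement of N.
theorem exists_differentElement_eq : ∃ (n : ℕ) (w : B),
    differentElement A h N = algebraMap A B π ^ n * w ∧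
      residue B w = ∏ σ : Gal(L/K) with σ ∉ N, uMap A K L π h σ := by
  choose n w h1 h2 using fun x : {x : Gal(L/K) ⧸ N // x ≠ 1} =>
    exists_normElement_sub_eq he hπ H p (out_notMem he hπ H p x.2)
  have hsub : ∀ f : Gal(L/K) ⧸ N → B, ∏ x ∈ Finset.univ.erase (1 : Gal(L/K) ⧸ N), f x =
      ∏ x : {x : Gal(L/K) ⧸ N // x ≠ 1}, f x := fun f =>
    Finset.prod_subtype _ (by simp) f
  have hsub' : ∀ f : Gal(L/K) ⧸ N → ResidueField B,
      ∏ x ∈ Finset.univ.erase (1 : Gal(L/K) ⧸ N), f x =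
      ∏ x : {x : Gal(L/K) ⧸ N // x ≠ 1}, f x := fun f =>
    Finset.prod_subtype _ (by simp) f
  refine ⟨∑ x, n x, ∏ x, w x, ?_, ?_⟩
  · rw [differentElement, hsub, Finset.prod_congr rfl fun x _ => h1 x, Finset.prod_mul_distrib,
      Finset.prod_pow_eq_pow_sum]
  · rw [map_prod, Finset.prod_congr rfl fun x _ => h2 x,
      ← hsub' fun x => ∏ s : N, uMap A K L π h (x.out * s)]
    rw [← Finset.prod_fiberwise_of_maps_to (s := Finset.univ.filter fun σ : Gal(L/K) => σ ∉ N)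
      (t := Finset.univ.erase (1 : Gal(L/K) ⧸ N)) (g := fun σ => (σ : Gal(L/K) ⧸ N))]
    · refine Finset.prod_congr rfl fun x hx => ?_
      rw [← prod_coset_eq N x.out, QuotientGroup.out_eq', Finset.filter_filter]
      refine Finset.prod_congr (Finset.filter_congr fun σ _ => ?_) fun _ _ => rfl
      refine ⟨fun h => ⟨fun hσ => (Finset.mem_erase.1 hx).1 ?_, h⟩, fun h => h.2⟩
      rw [← h]
      exact (QuotientGroup.eq_one_iff σ).2 hσ
    · intro σ hσ
      rw [Finset.mem_filter] at hσ
      exact Finset.mem_erase.2 ⟨mt (QuotientGroup.eq_one_iff σ).1 hσ.2, Finset.mem_univ _⟩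

open Classical in
/-- If `G / N` has order `p ^ (m + 1)` and `g ^ p ^ m ∉ N`, the product of the `u_σ`, for `σ ∉ N`,
and of the `u_σ`, for `σ ∈ g ^ p ^ m N`, lies in the residue field of `K`. -/
theorem prod_uMap_mem_range {m : ℕ} (hcard : p ^ (m + 1) * Nat.card N = Nat.card Gal(L/K))
    {g : Gal(L/K)} (hg : g ^ p ^ m ∉ N) :
    (∏ σ : Gal(L/K) with σ ∉ N, uMap A K L π h σ) * ∏ s : N, uMap A K L π h (g ^ p ^ m * s) ∈
      (algebraMap (ResidueField A) (ResidueField B)).range := by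
  have hp : p.Prime := Fact.out
  have hϖ := irreducible_algebraMap (B := B) he hπ
  have : CharP (ResidueField B) p :=
    charP_of_injective_algebraMap (algebraMap (ResidueField A) (ResidueField B)).injective p
  have hquot : Fintype.card (Gal(L/K) ⧸ N) = p ^ (m + 1) := by
    rw [← Nat.card_eq_fintype_card]
    change N.index = _
    apply Nat.eq_of_mul_eq_mul_right (Nat.card_pos (α := N))
    rw [hcard, mul_comm, N.card_mul_index]
  obtain ⟨n₁, w₁, hD, hw₁⟩ := exists_differentElement_eq (N := N) he hπ H p
  obtain ⟨n₂, w₂, hτ, hw₂⟩ := exists_normElement_sub_eq he hπ H p hg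
  set α := normElement A h N with hα
  set τ := g ^ p ^ m with hτdef
  have hαfix : IsFixed A N α := isFixed_normElement
  have hϖfix : ∀ n, IsFixed A N (algebraMap A B π ^ n) := fun n => (isFixed_algebraMap π).pow n
  have hWfix : IsFixed A N (w₁ * w₂) := by
    apply (hϖfix (n₁ + n₂)).of_mul (pow_ne_zero _ hϖ.ne_zero)
    have h1 : algebraMap A B π ^ (n₁ + n₂) * (w₁ * w₂) =
        differentElement A h N * (α - galRestrict A K L B τ α) := by
      rw [hD, hτ]; ring
    rw [h1]
    exact isFixed_differentElement.mul (hαfix.sub (hαfix.galRestrict τ))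
  have hmin := natDegree_minpoly_residue_normElement he hπ H p hcard
  rw [← hα] at hmin
  obtain ⟨Q, hQdeg, hQ⟩ := exists_aeval_normElement he hπ H p hWfix hcard
  rw [← hw₁, ← hw₂, ← map_mul, ← hQ, residue_aeval, ← hα]
  set Qr := Q.map (residue A) with hQr
  -- The residue in question is the value at ᾱ of Qr, of degree below that of the minimal polynomial
  -- of ᾱ. The claim is that Qr is constant.
  by_cases hl : Qr.natDegree = 0
  · rw [eq_C_of_natDegree_eq_zero hl, aeval_C]
    exact ⟨_, rfl⟩
  exfalso
  have hQr0 : Qr ≠ 0 := by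
    intro h0
    simp [h0] at hl
  have hQrdeg : Qr.natDegree < p ^ (m + 1) := by
    rw [natDegree_lt_iff_degree_lt hQr0]
    exact degree_map_le.trans_lt hQdeg
  set l := Qr.natDegree with hldef
  -- k = p^(m+1) - 1 - l is the shift that moves the leading term of Qr to the top degree p^(m+1) -
  -- 1.
  obtain ⟨k, hk⟩ := Nat.exists_eq_add_of_lt hQrdeg
  obtain ⟨j, k', hk', hkk⟩ := Nat.exists_eq_pow_mul_and_not_dvd (Nat.succ_ne_zero k) p hp.ne_one
  rw [Nat.succ_eq_add_one] at hkk
  have hk'0 : k' ≠ 0 := by rintro rfl; simp at hk'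
  -- Here l > 0 enters: p^j ≤ k + 1 = p^(m+1) - l < p^(m+1).
  have hjm : j ≤ m := by
    have h1 : p ^ j < p ^ (m + 1) := by
      have : p ^ j ≤ k + 1 := by rw [hkk]; exact Nat.le_mul_of_pos_right _ (Nat.pos_of_ne_zero hk'0)
      omega
    have := (Nat.pow_lt_pow_iff_right hp.one_lt).1 h1
    omega
  obtain ⟨M, hM⟩ := Nat.exists_eq_succ_of_ne_zero (pow_pos hp.pos j).ne'
  rw [Nat.succ_eq_add_one] at hM
  -- γ is chosen with γ^(p^j) = τ. In the product y₀ of the conjugates γ^i(α^k') with 0 ≤ i < p^j,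
  -- applying γ only replaces the factor α^k' by τ(α)^k'. So y₀ - γ(y₀) is a multiple of α - τ(α),
  -- with a cofactor of residue k'·ᾱ^(k'p^j - 1) = k'·ᾱ^k.
  set γ := g ^ p ^ (m - j) with hγ
  have hγτ : γ ^ (M + 1) = τ := by
    rw [← hM, hγ, hτdef, ← pow_mul, ← pow_add, Nat.sub_add_cancel hjm]
  let f : ℕ → B := fun i => galRestrict A K L B (γ ^ i) (α ^ k')
  have hffix : ∀ i, IsFixed A N (f i) := fun i => (hαfix.pow k').galRestrict _
  set y₀ := ∏ i ∈ Finset.range (M + 1), f i with hy₀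
  have hy₀fix : IsFixed A N y₀ := IsFixed.prod fun i _ => hffix i
  set x₀ := ∏ i ∈ Finset.range M, f (i + 1) with hx₀
  set s₀ := ∑ i ∈ Finset.range k', α ^ i * galRestrict A K L B τ α ^ (k' - 1 - i) with hs₀
  have hy : y₀ - galRestrict A K L B γ y₀ = algebraMap A B π ^ n₂ * (w₂ * (x₀ * s₀)) := by
    have e1 : y₀ = x₀ * α ^ k' := by
      rw [hy₀, Finset.prod_range_succ', hx₀]
      simp [f]
    have e2 : galRestrict A K L B γ y₀ = x₀ * galRestrict A K L B τ α ^ k' := by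
      have : ∀ i, galRestrict A K L B γ (f i) = f (i + 1) := fun i => by
        simp only [f]
        rw [← galRestrict_mul_apply, pow_succ']
      rw [hy₀, map_prod, Finset.prod_congr rfl fun i _ => this i, Finset.prod_range_succ, hx₀]
      simp only [f]
      rw [hγτ, map_pow]
    have e3 := (Commute.all α (galRestrict A K L B τ α)).geom_sum₂_mul k'
    rw [← hs₀, hτ] at e3
    rw [e2, e1, ← mul_sub, ← e3]
    ring
  have hDy : differentElement A h N * (y₀ - galRestrict A K L B γ y₀) =
      algebraMap A B π ^ (n₁ + n₂) * (w₁ * w₂ * (x₀ * s₀)) := by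
    rw [hy, hD]
    ring
  have hbfix : IsFixed A N (w₁ * w₂ * (x₀ * s₀)) := by
    apply (hϖfix (n₁ + n₂)).of_mul (pow_ne_zero _ hϖ.ne_zero)
    rw [← hDy]
    exact isFixed_differentElement.mul (hy₀fix.sub (hy₀fix.galRestrict γ))
  obtain ⟨P, hPdeg, hP⟩ := exists_aeval_normElement he hπ H p hbfix hcard
  -- y₀ - γ(y₀) has trace zero, so Euler's formula annihilates the top coefficient of P.
  have hPcoeff := coeff_eq_zero_of_sum_eq_zero he hπ H p (P := P) (m := n₁ + n₂)
    (by rwa [hquot]) (sum_galRestrict_sub_eq_zero hy₀fix γ) (by rw [hP, hDy])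
  rw [hquot] at hPcoeff
  have hres : residue B (x₀ * s₀) = (k' : ResidueField B) * residue B α ^ k := by
    have e1 : residue B x₀ = residue B α ^ (k' * M) := by
      rw [hx₀, map_prod, Finset.prod_congr rfl fun i _ => residue_galRestrict K L p H _ _,
        Finset.prod_const, Finset.card_range, map_pow, ← pow_mul]
    have e2 : residue B s₀ = k' * residue B α ^ (k' - 1) := by
      rw [hs₀, map_sum, ← geom_sum₂_self]
      refine Finset.sum_congr rfl fun i _ => ?_
      rw [map_mul, map_pow, map_pow, residue_galRestrict K L p H]
    rw [map_mul, e1, e2, mul_left_comm, ← pow_add]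
    congr 2
    obtain ⟨k'', rfl⟩ := Nat.exists_eq_succ_of_ne_zero hk'0
    rw [hM] at hkk
    rw [Nat.succ_sub_one, Nat.succ_eq_add_one]
    have : (M + 1) * (k'' + 1) = (k'' + 1) * M + k'' + 1 := by ring
    rw [Nat.succ_eq_add_one, this] at hkk
    omega
  -- T vanishes at ᾱ and has degree below its minimal polynomial. Its coefficient in degree l + k =
  -- p^(m+1) - 1 is k' times the leading coefficient of Qr, which is non-zero as p does not divide
  -- k': a contradiction.
  set T : (ResidueField A)[X] := C (k' : ResidueField A) * X ^ k * Qr - P.map (residue A) with hT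
  have hT0 : aeval (residue B α) T = 0 := by
    rw [hT, map_sub, ← residue_aeval, hP, map_mul, map_mul, ← residue_aeval, hQ, aeval_C, map_pow,
      aeval_X, map_mul (residue B) (w₁ * w₂), hres, map_natCast, sub_eq_zero]
    ring
  have hk'F : (k' : ResidueField A) ≠ 0 := by
    rwa [Ne, CharP.cast_eq_zero_iff (ResidueField A) p]
  have hkl : p ^ (m + 1) - 1 = l + k := by omega
  have hTcoeff : T.coeff (p ^ (m + 1) - 1) = k' * Qr.leadingCoeff := by
    rw [hT, coeff_sub, coeff_map, hPcoeff, map_zero, sub_zero, mul_assoc, coeff_C_mul, hkl,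
      coeff_X_pow_mul]
    rfl
  have hTne : T ≠ 0 := by
    intro h0
    rw [h0, coeff_zero] at hTcoeff
    exact mul_ne_zero hk'F (leadingCoeff_ne_zero.2 hQr0) hTcoeff.symm
  have hTdeg : T.natDegree < p ^ (m + 1) := by
    rw [natDegree_lt_iff_degree_lt hTne, hT]
    refine (degree_sub_le _ _).trans_lt (max_lt ?_ (degree_map_le.trans_lt hPdeg))
    rw [mul_assoc, degree_mul, degree_C hk'F, zero_add, degree_mul, degree_X_pow,
      degree_eq_natDegree hQr0]
    have : k + l < p ^ (m + 1) := by omega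
    exact_mod_cast this
  have := natDegree_le_of_dvd (minpoly.dvd (ResidueField A) _ hT0) hTne
  rw [hmin] at this
  omega

end Descent

/-! ## Characters -/

section Characters

variable {p : ℕ} [Fact p.Prime] {C : Type*} [Field C] {ψ : Multiplicative (ZMod p) →* Cˣ}

theorem injective_of_ne_one (hψ : ψ ≠ 1) : Function.Injective ψ := by
  rw [← MonoidHom.ker_eq_bot_iff]
  have : Fact (Nat.card (Multiplicative (ZMod p))).Prime := ⟨by
    rw [Nat.card_congr Multiplicative.toAdd, Nat.card_zmod]; exact Fact.out⟩
  refine (ψ.ker.eq_bot_or_eq_top_of_prime_card).resolve_right fun h => hψ ?_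
  rwa [MonoidHom.ker_eq_top_iff] at h

theorem isPrimitiveRoot_apply_one (hψ : ψ ≠ 1) :
    IsPrimitiveRoot (ψ (Multiplicative.ofAdd 1)) p := by
  have h1 : orderOf (Multiplicative.ofAdd (1 : ZMod p)) = p := by
    rw [orderOf_ofAdd_eq_addOrderOf, ZMod.addOrderOf_one]
  have h2 := IsPrimitiveRoot.orderOf (ψ (Multiplicative.ofAdd 1))
  rwa [orderOf_injective ψ (injective_of_ne_one hψ), h1] at h2

theorem apply_natCast (n : ℕ) :
    ψ (Multiplicative.ofAdd (n : ZMod p)) = ψ (Multiplicative.ofAdd 1) ^ n := by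
  rw [← map_pow, ← ofAdd_nsmul, nsmul_one]

/-- A non-trivial ψ sends 1 to a primitive p-th root of unity, whose powers are all the p-th roots
of unity in C. -/
theorem mem_range_of_pow_eq_one (hψ : ψ ≠ 1) {x : Cˣ} (hx : x ^ p = 1) : x ∈ ψ.range := by
  have hp : p.Prime := Fact.out
  have : NeZero p := ⟨hp.ne_zero⟩
  obtain ⟨i, -, hi⟩ := IsPrimitiveRoot.eq_pow_of_pow_eq_one
    ((isPrimitiveRoot_apply_one hψ).map_of_injective Units.val_injective (f := Units.coeHom C))
    (ξ := (x : C)) (by rw [← Units.val_pow_eq_pow_val, hx, Units.val_one])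
  refine ⟨Multiplicative.ofAdd (i : ZMod p), ?_⟩
  rw [apply_natCast]
  ext
  simpa using hi

theorem existsUnique_factorization (hψ : ψ ≠ 1) {H : Type*} [Group H] (χ : H →* Cˣ)
    (hχ : ∀ σ, χ σ ^ p = 1) :
    ∃! χbar : H →* Multiplicative (ZMod p), ∀ σ, χ σ = ψ (χbar σ) := by
  refine ⟨(MonoidHom.ofInjective (injective_of_ne_one hψ)).symm.toMonoidHom.comp
    (χ.codRestrict ψ.range fun σ => mem_range_of_pow_eq_one hψ (hχ σ)), fun σ => ?_,
    fun χ' hχ' => ?_⟩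
  · symm
    exact congrArg Subtype.val ((MonoidHom.ofInjective (injective_of_ne_one hψ)).apply_symm_apply
      ⟨χ σ, mem_range_of_pow_eq_one hψ (hχ σ)⟩)
  · ext1 σ
    apply injective_of_ne_one hψ
    rw [← hχ' σ]
    exact congrArg Subtype.val ((MonoidHom.ofInjective (injective_of_ne_one hψ)).apply_symm_apply
      ⟨χ σ, mem_range_of_pow_eq_one hψ (hχ σ)⟩).symm

variable {G : Type*} [Group G] [Finite G]

@[simp]
theorem charValue_one (χ : G →* Cˣ) : charValue χ 1 = 1 := Subtype.ext (by simp [charValue])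

theorem charValue_mul (χ : G →* Cˣ) (σ τ : G) :
    charValue χ (σ * τ) = charValue χ σ * charValue χ τ := Subtype.ext (by simp [charValue])

theorem sum_charValue_eq_zero {H : Subgroup G} [Fintype H] {χ : G →* Cˣ} {ρ : G} (hρ : ρ ∈ H)
    (hρχ : χ ρ ≠ 1) : ∑ σ : H, charValue χ (σ : G) = 0 := by
  have h1 := sum_hom_units_eq_zero ((Units.coeHom C).comp (χ.comp H.subtype)) (fun h => hρχ (by
    have := DFunLike.congr_fun h ⟨ρ, hρ⟩
    ext
    simpa using this))
  apply Subtype.ext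
  rw [AddSubmonoidClass.coe_finsetSum]
  simpa [charValue] using h1

theorem sum_univ_charValue_eq_zero [Fintype G] {χ : G →* Cˣ} (hχ : χ ≠ 1) :
    ∑ σ : G, charValue χ σ = 0 := by
  have h1 := sum_hom_units_eq_zero ((Units.coeHom C).comp χ) (fun h => hχ (by
    ext σ
    simpa using DFunLike.congr_fun h σ))
  apply Subtype.ext
  rw [AddSubmonoidClass.coe_finsetSum]
  simpa [charValue] using h1

theorem innerOne_eq_zero [Fintype G] {χ : G →* Cˣ} (hχ : χ ≠ 1) : innerOne χ = 0 := by
  have h1 := congrArg Subtype.val (sum_univ_charValue_eq_zero hχ)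
  rw [AddSubmonoidClass.coe_finsetSum] at h1
  apply Subtype.ext
  change _ * ∑ σ : G, (χ σ : C) = 0
  have h2 : ∑ σ : G, (χ σ : C) = 0 := h1
  rw [h2, mul_zero]

/-- A sum of `ℓ(σ) ⊗ χ(σ)` outside a subgroup on which `χ` is non-trivial vanishes, if `ℓ` is
invariant under right translation by the subgroup. -/
theorem sum_tmul_charValue_eq_zero [Fintype G] {M : Type*} [AddCommGroup M] {H : Subgroup G}
    [DecidablePred (· ∈ H)]
    {χ : G →* Cˣ} {ρ : G} (hρ : ρ ∈ H) (hρχ : χ ρ ≠ 1) (l : G → M)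
    (hl : ∀ σ, σ ∉ H → ∀ s ∈ H, l (σ * s) = l σ) :
    ∑ σ : G with σ ∉ H, l σ ⊗ₜ[ℤ] charValue χ σ = 0 := by
  classical
  rw [← Finset.sum_fiberwise _ (fun σ : G => (σ : G ⧸ H))]
  refine Finset.sum_eq_zero fun x _ => ?_
  obtain ⟨σ, rfl⟩ := QuotientGroup.mk_surjective x
  rw [Finset.filter_filter]
  by_cases hσ : σ ∈ H
  · rw [Finset.sum_eq_zero]
    intro τ hτ
    exfalso
    rw [Finset.mem_filter, (QuotientGroup.eq : (τ : G ⧸ H) = σ ↔ _)] at hτ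
    apply hτ.2.1
    have := H.mul_mem hσ (H.inv_mem hτ.2.2)
    simpa using this
  · have h1 : (Finset.univ.filter fun τ : G => τ ∉ H ∧ (τ : G ⧸ H) = (σ : G ⧸ H)) =
        Finset.univ.filter fun τ : G => (τ : G ⧸ H) = (σ : G ⧸ H) := by
      refine Finset.filter_congr fun τ _ => ⟨fun h => h.2, fun h => ⟨fun hτ => hσ ?_, h⟩⟩
      have := H.mul_mem hτ (QuotientGroup.eq.1 h)
      simpa using this
    rw [h1, sum_coset_eq H σ]
    rw [Finset.sum_congr rfl fun s _ => by rw [hl σ hσ s s.2, charValue_mul],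
      ← TensorProduct.tmul_sum, ← Finset.mul_sum, sum_charValue_eq_zero hρ hρχ, mul_zero,
      TensorProduct.tmul_zero]

end Characters

/-! ## Products over the fibres of a homomorphism to `𝔽_p` -/

theorem prod_subgroup_filter {G M : Type*} [Group G] [Fintype G] [CommMonoid M] (H : Subgroup G)
    [Fintype H] (P : G → Prop) [DecidablePred P] [DecidablePred (· ∈ H)] (f : G → M) :
    ∏ σ ∈ Finset.univ.filter (fun σ : H => P σ), f σ = ∏ σ : G with σ ∈ H ∧ P σ, f σ := by
  refine Finset.prod_bij (fun σ _ => (σ : G)) (fun σ hσ => ?_) (fun σ _ τ _ h => Subtype.ext h)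
    (fun σ hσ => ?_) (fun _ _ => rfl)
  · rw [Finset.mem_filter] at hσ ⊢
    exact ⟨Finset.mem_univ _, σ.2, hσ.2⟩
  · rw [Finset.mem_filter] at hσ
    exact ⟨⟨σ, hσ.2.1⟩, Finset.mem_filter.2 ⟨Finset.mem_univ _, hσ.2.2⟩, rfl⟩

section Fibres

set_option linter.unusedSectionVars false

variable {p : ℕ} [Fact p.Prime] {k : Type*} [Field k] [CharP k p] {H : Type*} [Group H]
  [Fintype H] {u : H → k} (hu : ∀ σ τ, u (σ * τ) = u σ + u τ) (hu1 : ∀ σ, u σ = 0 → σ = 1)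
  (χ : H →* Multiplicative (ZMod p))

include hu

theorem additive_apply_one : u 1 = 0 := by
  have := hu 1 1
  rw [mul_one] at this
  exact left_eq_add.1 this

theorem additive_apply_pow (σ : H) (n : ℕ) : u (σ ^ n) = n * u σ := by
  induction n with
  | zero => simp [additive_apply_one hu]
  | succ n ih => rw [pow_succ, hu, ih]; push_cast; ring

omit [CharP k p] in
variable {χ} in
/-- The product of the `u_τ + u_κ`, for `κ` in the kernel, is the product of `u` over a coset. -/
theorem prod_ker_add_eq [DecidableEq (Multiplicative (ZMod p))] {τ : H} :
    ∏ κ : H with χ κ = 1, (u τ + u κ) = ∏ σ : H with χ σ = χ τ, u σ := by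
  refine Finset.prod_bij (fun κ _ => τ * κ) (fun κ hκ => ?_) (fun _ _ _ _ h => mul_left_cancel h)
    (fun σ hσ => ?_) (fun κ _ => (hu τ κ).symm)
  · rw [Finset.mem_filter] at hκ ⊢
    rw [map_mul, hκ.2, mul_one]
    exact ⟨Finset.mem_univ _, rfl⟩
  · rw [Finset.mem_filter] at hσ
    refine ⟨τ⁻¹ * σ, Finset.mem_filter.2 ⟨Finset.mem_univ _, ?_⟩, by simp⟩
    rw [map_mul, map_inv, hσ.2, inv_mul_cancel]

include hu1

theorem additive_injective : Function.Injective u := by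
  intro σ τ h
  have h1 : u (σ * τ⁻¹) + u τ = u τ := by rw [← hu, inv_mul_cancel_right, h]
  have := hu1 _ (add_eq_right.1 h1)
  rwa [mul_inv_eq_one] at this

/-- The map σ ↦ σ^r is a bijection from the fibre above 1 to the fibre above r and multiplies u by
r. The number of factors is a power of p, and r^(p^n) = r in 𝔽_p. -/
theorem prod_fibre_natCast [DecidableEq (Multiplicative (ZMod p))]
    (hcard : ∃ n, (Finset.univ.filter fun σ : H => χ σ = Multiplicative.ofAdd 1).card = p ^ n)
    {r : ℕ} (hr : ((r : ℕ) : ZMod p) ≠ 0) :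
    ∏ σ : H with χ σ = Multiplicative.ofAdd (r : ZMod p), u σ =
      r * ∏ σ : H with χ σ = Multiplicative.ofAdd 1, u σ := by
  have hrk : (r : k) ≠ 0 := by
    rw [Ne, CharP.cast_eq_zero_iff k p]
    rwa [Ne, ZMod.natCast_eq_zero_iff] at hr
  have hinj : Function.Injective fun σ : H => σ ^ r := by
    intro σ τ h
    apply additive_injective hu hu1
    have := congrArg u h
    simp only [additive_apply_pow hu] at this
    exact mul_left_cancel₀ hrk this
  have hχr : ∀ σ : H, χ (σ ^ r) = Multiplicative.ofAdd (r : ZMod p) ↔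
      χ σ = Multiplicative.ofAdd 1 := by
    intro σ
    rw [map_pow, ← nsmul_one r, ofAdd_nsmul]
    refine ⟨fun h => ?_, fun h => by rw [h]⟩
    have h1 := congrArg Multiplicative.toAdd h
    rw [toAdd_pow, toAdd_pow, nsmul_eq_mul, nsmul_eq_mul] at h1
    have h2 : Multiplicative.toAdd (χ σ) = (1 : ZMod p) := mul_left_cancel₀ hr h1
    exact congrArg Multiplicative.ofAdd h2
  have h1 : ∏ σ : H with χ σ = Multiplicative.ofAdd (r : ZMod p), u σ =
      ∏ σ : H with χ σ = Multiplicative.ofAdd 1, u (σ ^ r) := by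
    symm
    refine Finset.prod_bij (fun σ _ => σ ^ r) (fun σ hσ => ?_) (fun _ _ _ _ h => hinj h)
      (fun σ hσ => ?_) (fun _ _ => rfl)
    · rw [Finset.mem_filter] at hσ ⊢
      exact ⟨Finset.mem_univ _, (hχr σ).2 hσ.2⟩
    · obtain ⟨τ, rfl⟩ := (Finite.injective_iff_surjective.1 hinj) σ
      rw [Finset.mem_filter] at hσ
      exact ⟨τ, Finset.mem_filter.2 ⟨Finset.mem_univ _, (hχr τ).1 hσ.2⟩, rfl⟩
  obtain ⟨n, hn⟩ := hcard
  rw [h1, Finset.prod_congr rfl fun σ _ => additive_apply_pow hu σ r, Finset.prod_mul_distrib,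
    Finset.prod_const, hn]
  congr 1
  have := congrArg (ZMod.castHom dvd_rfl k) (ZMod.pow_card_pow (p := p) (n := n) (r : ZMod p))
  rwa [map_pow, map_natCast] at this

omit hu hu1 [CharP k p] in
theorem sum_fibres {M : Type*} [AddCommMonoid M] [DecidableEq (Multiplicative (ZMod p))]
    (f : H → M) : ∑ σ : H with χ σ ≠ 1, f σ =
      ∑ r ∈ Finset.Ico 1 p, ∑ σ : H with χ σ = Multiplicative.ofAdd (r : ZMod p), f σ := by
  have hp : p.Prime := Fact.out
  have : NeZero p := ⟨hp.ne_zero⟩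
  rw [← Finset.sum_fiberwise_of_maps_to (s := Finset.univ.filter fun σ : H => χ σ ≠ 1)
    (t := Finset.Ico 1 p) (g := fun σ => (Multiplicative.toAdd (χ σ)).val)]
  · refine Finset.sum_congr rfl fun r hr => ?_
    rw [Finset.mem_Ico] at hr
    rw [Finset.filter_filter]
    refine Finset.sum_congr (Finset.filter_congr fun σ _ => ?_) fun _ _ => rfl
    constructor
    · rintro ⟨-, h⟩
      rw [← h, ZMod.natCast_zmod_val]
      rfl
    · intro h
      rw [h, toAdd_ofAdd, ZMod.val_cast_of_lt hr.2]
      refine ⟨fun h0 => ?_, rfl⟩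
      rw [ofAdd_eq_one, ZMod.natCast_eq_zero_iff] at h0
      exact absurd (Nat.le_of_dvd hr.1 h0) (not_le.2 hr.2)
  · intro σ hσ
    rw [Finset.mem_filter] at hσ
    rw [Finset.mem_Ico, Nat.one_le_iff_ne_zero]
    refine ⟨fun h => hσ.2 ?_, ZMod.val_lt _⟩
    rwa [ZMod.val_eq_zero, toAdd_eq_zero] at h

/-- The p - 1 fibres above r ≠ 0 each contribute r times the same product, and the r multiply to -1
by Wilson's theorem. -/
theorem prod_fibres_ne_one [DecidableEq (Multiplicative (ZMod p))]
    (hcard : ∃ n, (Finset.univ.filter fun σ : H => χ σ = Multiplicative.ofAdd 1).card = p ^ n) :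
    ∏ σ : H with χ σ ≠ 1, u σ =
      -(∏ σ : H with χ σ = Multiplicative.ofAdd 1, u σ) ^ (p - 1) := by
  have h1 := sum_fibres χ (M := Additive k) u
  change ∏ σ : H with χ σ ≠ 1, u σ =
    ∏ r ∈ Finset.Ico 1 p, ∏ σ : H with χ σ = Multiplicative.ofAdd (r : ZMod p), u σ at h1
  rw [h1, Finset.prod_congr rfl fun r hr => prod_fibre_natCast hu hu1 χ hcard (r := r) ?_,
    Finset.prod_mul_distrib, Finset.prod_const, Nat.card_Ico]
  · have := congrArg (ZMod.castHom dvd_rfl k) (ZMod.prod_Ico_one_prime p)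
    rw [map_prod] at this
    simp only [map_natCast, map_neg, map_one] at this
    rw [this, neg_one_mul]
  · rw [Finset.mem_Ico] at hr
    rw [Ne, ZMod.natCast_eq_zero_iff]
    exact fun h0 => absurd (Nat.le_of_dvd hr.1 h0) (not_le.2 hr.2)

end Fibres

/-! ### Descent to F of the product attached to the character -/

section Descent

set_option linter.unusedSectionVars false

variable {A B : Type*} {K L : Type*} [CommRing A] [IsDomain A] [IsDiscreteValuationRing A]
  [CommRing B] [IsDomain B] [IsDiscreteValuationRing B] [Algebra A B]
  [IsLocalHom (algebraMap A B)] [Field K] [Algebra A K] [IsFractionRing A K]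
  [Field L] [Algebra K L] [FiniteDimensional K L] [Algebra A L] [IsScalarTower A K L]
  [Algebra B L] [IsScalarTower A B L] [IsIntegralClosure B A L] [IsGalois K L]
  {π : A} {h : B} {a₀ : ResidueField A}
  (he : (maximalIdeal A).map (algebraMap A B) = maximalIdeal B)
  (hπ : Irreducible π) (H : IsInsepGenerator (ResidueField A) (residue B h) a₀)
  (p : ℕ) [Fact p.Prime] [CharP (ResidueField A) p]

include he hπ H p

/-- The term coming from σ has higher valuation, and the leading unit w of h - τ(h) is replaced by
σ(w), which has the same residue. -/
theorem uMap_mul_of_notMem_right {σ τ : Gal(L/K)} (hσ : σ ∈ lastGroup K L π h)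
    (hτ : τ ∉ lastGroup K L π h) : uMap A K L π h (σ * τ) = uMap A K L π h τ := by
  have hϖ := irreducible_algebraMap (B := B) he hπ
  have hτ1 : τ ≠ 1 := fun h1 => hτ (h1 ▸ one_mem _)
  obtain ⟨w, hw, hwu⟩ := exists_displacement_eq K L he hπ H hτ1
  obtain ⟨v, hv, hvu⟩ := exists_displacement_eq_lastBreak K L he hπ H hσ
  obtain ⟨m, hm⟩ := Nat.exists_eq_add_of_lt (lt_of_le_of_ne (ord_displacement_le_lastBreak hτ1)
    (mt (mem_lastGroup_iff K L he hπ H hτ1).2 hτ))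
  have hx : displacement A K L h (σ * τ) = algebraMap A B π ^ ord (displacement A K L h τ) *
      (galRestrict A K L B σ w + algebraMap A B π * (algebraMap A B π ^ m * v)) := by
    have h1 : galRestrict A K L B σ (displacement A K L h τ) =
        algebraMap A B π ^ ord (displacement A K L h τ) * galRestrict A K L B σ w := by
      conv_lhs => rw [hw]
      rw [map_mul, map_pow, AlgEquiv.commutes]
    rw [displacement_mul, h1, hv, hm]
    ring
  have hres : residue B (galRestrict A K L B σ w +
      algebraMap A B π * (algebraMap A B π ^ m * v)) = uMap A K L π h τ := by
    rw [map_add, residue_galRestrict K L p H, hwu, (residue_eq_zero_iff_dvd hϖ _).2 (dvd_mul_right _ _), add_zero]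
  exact (eq_pow_mul_of_residue_ne_zero hϖ hx (hres ▸ uMap_ne_zero K L he hπ H hτ1)).2.trans hres

variable {C : Type*} [Field C] {ψ : Multiplicative (ZMod p) →* Cˣ} {χ : Gal(L/K) →* Cˣ}
  {χbar : lastGroup K L π h →* Multiplicative (ZMod p)}

/-- An element of the group whose power of suitable exponent is a given element of order `p`
modulo the kernel of a character. -/
theorem exists_pow_apply_eq {x : Gal(L/K)} (hx : χ x ^ p = 1) (hx1 : χ x ≠ 1) :
    ∃ (m : ℕ) (g : Gal(L/K)), p ^ (m + 1) * Nat.card χ.ker = Nat.card Gal(L/K) ∧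
      χ (g ^ p ^ m) = χ x := by
  have hp : p.Prime := Fact.out
  have : Finite χ.range := Finite.of_surjective _ χ.rangeRestrict_surjective
  have hcyc : IsCyclic χ.range := isCyclic_subgroup_units χ.range
  obtain ⟨⟨_, g, rfl⟩, hg⟩ := hcyc.exists_generator
  have hord : orderOf (χ g) = Nat.card χ.range := by
    rw [← Subgroup.orderOf_mk (H := χ.range) (χ g) ⟨g, rfl⟩]
    exact orderOf_eq_card_of_forall_mem_zpowers hg
  have hcard : Nat.card χ.range * Nat.card χ.ker = Nat.card Gal(L/K) := by
    rw [mul_comm, ← Subgroup.card_mul_index χ.ker, Subgroup.index_ker]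
  have : Fintype (⊤ : Subgroup Gal(L/K)) := Fintype.ofFinite _
  obtain ⟨n, hn⟩ := card_eq_pow (N := (⊤ : Subgroup Gal(L/K))) he hπ H p
  rw [Subgroup.card_top] at hn
  obtain ⟨m, -, hm⟩ := (Nat.dvd_prime_pow hp).1 (hn ▸ Dvd.intro _ hcard : Nat.card χ.range ∣ p ^ n)
  cases m with
  | zero =>
    exfalso
    rw [pow_zero, Subgroup.card_eq_one] at hm
    exact hx1 (Subgroup.mem_bot.1 (hm ▸ (⟨x, rfl⟩ : χ x ∈ χ.range)))
  | succ m =>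
    rw [hm] at hord hcard
    -- The image of χ is cyclic of order p^(m+1), generated by χ(g), so χ(g)^(p^m) generates the
    -- p-th roots of unity. Since χ(x) is its i-th power, g^i does what is wanted.
    have h1 : IsPrimitiveRoot (χ g ^ p ^ m) p :=
      (IsPrimitiveRoot.orderOf (χ g)).pow (by rw [hord]; exact pow_pos hp.pos _) (by rw [hord, pow_succ])
    have : NeZero p := ⟨hp.ne_zero⟩
    obtain ⟨i, -, hi⟩ := IsPrimitiveRoot.eq_pow_of_pow_eq_one
      (h1.map_of_injective Units.val_injective (f := Units.coeHom C))
      (ξ := (χ x : C)) (by rw [← Units.val_pow_eq_pow_val, hx, Units.val_one])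
    refine ⟨m, g ^ i, hcard, ?_⟩
    ext
    rw [← hi, ← pow_mul, mul_comm, pow_mul, map_pow, map_pow]
    simp

open Classical in
/-- The product of the `u_σ` over the fibre above `1` of `χ̄`. -/
noncomputable def fibreProd (χbar : lastGroup K L π h →* Multiplicative (ZMod p)) :
    ResidueField B :=
  ∏ σ : lastGroup K L π h with χbar σ = Multiplicative.ofAdd 1, uMap A K L π h σ

/-- By additivity u_τ + u_κ = u_{τκ}, and τκ runs over the fibre of τ; in particular the value does
not depend on τ. -/
theorem eval_kerPoly {τ : lastGroup K L π h} (hτ : χbar τ = Multiplicative.ofAdd 1) :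
    (kerPoly χbar (uMap A K L π h)).eval (uMap A K L π h τ) = fibreProd p χbar := by
  classical
  rw [kerPoly, eval_prod, fibreProd, ← hτ]
  simp only [eval_add, eval_X, eval_C]
  exact prod_ker_add_eq (u := fun σ : lastGroup K L π h => uMap A K L π h σ)
    fun σ ρ => uMap_mul K L he hπ H p σ.2 ρ.2

theorem fibreProd_ne_zero : fibreProd p χbar ≠ 0 := by
  classical
  refine Finset.prod_ne_zero_iff.2 fun σ hσ => uMap_ne_zero K L he hπ H fun h1 => ?_
  rw [Finset.mem_filter, (Subtype.ext h1 : σ = 1), map_one] at hσ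
  have h2 : (0 : ZMod p) = 1 := congrArg Multiplicative.toAdd hσ.2
  exact zero_ne_one h2

open Classical in
-- The fibre is a coset of the kernel, a subgroup of a group of p-power order.
theorem exists_card_fibre {τ : lastGroup K L π h} (hτ : χbar τ = Multiplicative.ofAdd 1) :
    ∃ n, (Finset.univ.filter fun σ : lastGroup K L π h =>
      χbar σ = Multiplicative.ofAdd 1).card = p ^ n := by
  obtain ⟨n, hn⟩ := card_eq_pow (N := lastGroup K L π h) he hπ H p
  have h1 := Subgroup.card_subgroup_dvd_card χbar.ker
  rw [hn, Nat.dvd_prime_pow Fact.out] at h1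
  obtain ⟨m, -, hm⟩ := h1
  refine ⟨m, ?_⟩
  rw [MonoidHom.card_fiber_eq_of_mem_range χbar (x := Multiplicative.ofAdd 1) (y := 1) ⟨τ, hτ⟩
    ⟨1, map_one _⟩, ← hm, ← Fintype.card_subtype, ← Nat.card_eq_fintype_card]
  rfl

open Classical in
theorem prod_lastGroup_ne_one {τ : lastGroup K L π h} (hτ : χbar τ = Multiplicative.ofAdd 1) :
    ∏ σ : lastGroup K L π h with χbar σ ≠ 1, uMap A K L π h σ = -fibreProd p χbar ^ (p - 1) := by
  have : CharP (ResidueField B) p :=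
    charP_of_injective_algebraMap (algebraMap (ResidueField A) (ResidueField B)).injective p
  exact prod_fibres_ne_one (u := fun σ : lastGroup K L π h => uMap A K L π h σ)
    (fun σ ρ => uMap_mul K L he hπ H p σ.2 ρ.2)
    (fun σ hσ => Subtype.ext (by_contra fun h1 => uMap_ne_zero K L he hπ H h1 hσ)) χbar
    (exists_card_fibre he hπ H p hτ)

open Classical in
/-- The product `-f̄(u_τ) ^ p ∏ u_σ`, over the `σ` outside the last ramification group, lies in the
residue field of `K`. -/
theorem neg_fibreProd_pow_mul_mem_range (hψ : ψ ≠ 1)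
    (hχ : ∀ σ : lastGroup K L π h, χ σ = ψ (χbar σ))
    {τ : lastGroup K L π h} (hτ : χbar τ = Multiplicative.ofAdd 1) :
    -fibreProd p χbar ^ p * ∏ σ : Gal(L/K) with σ ∉ lastGroup K L π h, uMap A K L π h σ ∈
      (algebraMap (ResidueField A) (ResidueField B)).range := by
  have hp : p.Prime := Fact.out
  have hψi := injective_of_ne_one hψ
  have hx1 : χ τ ≠ 1 := by
    rw [hχ, hτ, ← ψ.map_one, hψi.ne_iff]
    intro h0
    have h2 : (1 : ZMod p) = 0 := congrArg Multiplicative.toAdd h0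
    exact one_ne_zero h2
  obtain ⟨m, g, hcard, hg⟩ := exists_pow_apply_eq he hπ H p
    (by rw [← map_pow, pow_eq_one_of_mem_lastGroup K L he hπ H p τ.2, map_one]) hx1
  have : Fintype (Gal(L/K) ⧸ χ.ker) := Fintype.ofFinite _
  -- Modulo N = ker χ, the coset of g^(p^m) is the fibre of χ through τ; both products are then
  -- split into the parts inside and outside the last ramification group.
  have key := prod_uMap_mem_range (N := χ.ker) he hπ H p hcard (g := g)
    (by rwa [MonoidHom.mem_ker, hg])
  have hmk : ∀ ρ : Gal(L/K), (ρ : Gal(L/K) ⧸ χ.ker) = (g ^ p ^ m : Gal(L/K)) ↔ χ ρ = χ τ := by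
    intro ρ
    rw [QuotientGroup.eq, MonoidHom.mem_ker, map_mul, map_inv, hg, inv_mul_eq_one]
  rw [← prod_coset_eq, Finset.filter_congr fun ρ _ => hmk ρ] at key
  have hsplit : ∀ (P : Gal(L/K) → Prop) [DecidablePred P], ∏ σ : Gal(L/K) with P σ, uMap A K L π h σ =
      (∏ σ ∈ Finset.univ.filter (fun σ : lastGroup K L π h => P σ), uMap A K L π h σ) *
        ∏ σ : Gal(L/K) with σ ∉ lastGroup K L π h ∧ P σ, uMap A K L π h σ := by
    intro P _
    rw [prod_subgroup_filter (lastGroup K L π h) P, ← Finset.prod_filter_mul_prod_filter_not _ (fun σ => σ ∈ lastGroup K L π h),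
      Finset.filter_filter, Finset.filter_filter]
    simp only [and_comm]
  have hone : ∀ σ : lastGroup K L π h, χ σ = 1 ↔ χbar σ = 1 := fun σ => by
    rw [hχ, ← ψ.map_one, hψi.eq_iff]
  have hfib : ∀ σ : lastGroup K L π h, χ σ = χ τ ↔ χbar σ = Multiplicative.ofAdd 1 := fun σ => by
    rw [hχ, hχ, hτ, hψi.eq_iff]
  have hker : ∀ inst : DecidablePred fun σ : Gal(L/K) => σ ∉ χ.ker,
      ∏ σ ∈ @Finset.filter _ (fun σ => σ ∉ χ.ker) inst Finset.univ, uMap A K L π h σ =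
        ∏ σ : Gal(L/K) with ¬ χ σ = 1, uMap A K L π h σ := by
    intro inst
    refine Finset.prod_congr ?_ fun _ _ => rfl
    ext σ
    simp only [Finset.mem_filter, MonoidHom.mem_ker]
  rw [hker, hsplit (fun σ => ¬ χ σ = 1), hsplit (fun ρ => χ ρ = χ τ), Finset.filter_congr fun σ _ => hfib σ] at key
  simp only [hone] at key
  -- Multiplication by τ leaves u unchanged outside the last ramification group, so this part of the
  -- fibre of τ can be traded for the missing part of ker χ. All σ outside that group are then
  -- accounted for exactly once.
  have hout : ∏ ρ : Gal(L/K) with ρ ∉ lastGroup K L π h ∧ χ ρ = χ τ, uMap A K L π h ρ =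
      ∏ ρ : Gal(L/K) with ρ ∉ lastGroup K L π h ∧ χ ρ = 1, uMap A K L π h ρ := by
    symm
    refine Finset.prod_bij (fun ρ _ => (τ : Gal(L/K)) * ρ) (fun ρ hρ => ?_)
      (fun _ _ _ _ h => mul_left_cancel h) (fun ρ hρ => ?_) (fun ρ hρ => ?_)
    · rw [Finset.mem_filter] at hρ ⊢
      rw [map_mul, hρ.2.2, mul_one, Subgroup.mul_mem_cancel_left (lastGroup K L π h) τ.2]
      exact ⟨Finset.mem_univ _, hρ.2.1, rfl⟩
    · rw [Finset.mem_filter] at hρ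
      refine ⟨(τ : Gal(L/K))⁻¹ * ρ, Finset.mem_filter.2 ⟨Finset.mem_univ _, ?_, ?_⟩, by simp⟩
      · rw [Subgroup.mul_mem_cancel_left (lastGroup K L π h) ((lastGroup K L π h).inv_mem τ.2)]
        exact hρ.2.1
      · rw [map_mul, map_inv, hρ.2.2, inv_mul_cancel]
    · rw [Finset.mem_filter] at hρ
      exact (uMap_mul_of_notMem_right he hπ H p τ.2 hρ.2.1).symm
  rw [hout, prod_lastGroup_ne_one he hπ H p hτ] at key
  rw [← Finset.prod_filter_mul_prod_filter_not _ (fun σ => χ σ = 1), Finset.filter_filter,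
    Finset.filter_filter]
  convert key using 1
  rw [← fibreProd]
  rw [← pow_sub_one_mul hp.ne_zero (fibreProd p χbar)]
  ring

end Descent

/-! ### Evaluation of the Swan conductor -/

open Classical in
theorem sum_subgroup_erase {G M : Type*} [Group G] [Fintype G] [AddCommMonoid M] (T : Subgroup G)
    (f : G → M) : ∑ σ ∈ Finset.univ.erase 1, f σ =
      ∑ σ : G with σ ∉ T, f σ + ∑ σ : T with σ ≠ 1, f σ := by
  have h1 := prod_subgroup_filter (M := Multiplicative M) T (fun σ => σ ≠ 1) f
  change ∑ σ ∈ Finset.univ.filter (fun σ : T => (σ : G) ≠ 1), f σ =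
    ∑ σ : G with σ ∈ T ∧ σ ≠ 1, f σ at h1
  simp only [ne_eq, OneMemClass.coe_eq_one] at h1 ⊢
  rw [h1, ← Finset.sum_filter_add_sum_filter_not _ (fun σ => σ ∉ T)]
  congr 1
  · refine Finset.sum_congr ?_ fun _ _ => rfl
    ext σ
    simp only [Finset.mem_filter, Finset.mem_erase, Finset.mem_univ, and_true, true_and,
      and_iff_right_iff_imp]
    rintro hσ rfl
    exact hσ T.one_mem
  · refine Finset.sum_congr ?_ fun _ _ => rfl
    ext σ
    simp only [Finset.mem_filter, Finset.mem_erase, Finset.mem_univ, and_true, true_and, not_not]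
    exact and_comm

section SwanFormula

set_option linter.unusedSectionVars false

variable {A B : Type*} {K L : Type*} [CommRing A] [IsDomain A] [IsDiscreteValuationRing A]
  [CommRing B] [IsDomain B] [IsDiscreteValuationRing B] [Algebra A B]
  [IsLocalHom (algebraMap A B)] [Field K] [Algebra A K] [IsFractionRing A K]
  [Field L] [Algebra K L] [FiniteDimensional K L] [Algebra A L] [IsScalarTower A K L]
  [Algebra B L] [IsScalarTower A B L] [IsIntegralClosure B A L] [IsGalois K L]
  {π : A} {h : B} {a₀ : ResidueField A}
  (he : (maximalIdeal A).map (algebraMap A B) = maximalIdeal B)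
  (hπ : Irreducible π) (H : IsInsepGenerator (ResidueField A) (residue B h) a₀)
  (p : ℕ) [Fact p.Prime] [CharP (ResidueField A) p]
  {C : Type*} [Field C] {ψ : Multiplicative (ZMod p) →* Cˣ} {χ : Gal(L/K) →* Cˣ}
  {χbar : lastGroup K L π h →* Multiplicative (ZMod p)}

theorem sum_pow_charValue_eq {p : ℕ} [Fact p.Prime] {ψ : Multiplicative (ZMod p) →* Cˣ}
    (hψ : ψ ≠ 1) :
    ∑ r ∈ Finset.Ico 1 p, charValue ψ (Multiplicative.ofAdd 1) ^ r = -1 := by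
  have hp : p.Prime := Fact.out
  have h1 := ((isPrimitiveRoot_apply_one hψ).map_of_injective Units.val_injective
    (f := Units.coeHom C)).geom_sum_eq_zero hp.one_lt
  rw [Finset.range_eq_Ico, Finset.sum_eq_sum_Ico_succ_bot hp.pos, pow_zero] at h1
  apply Subtype.ext
  rw [AddSubmonoidClass.coe_finsetSum]
  exact eq_neg_of_add_eq_zero_right h1

include he hπ H

open Classical in
-- On the fibre above r, χ is ξ^r and u has product r·φ, with φ the product over the fibre above 1.
-- The classes [r] give ε(ξ), and [φ] is multiplied by ∑ ξ^r = -1.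
theorem sum_fibres_tmul (hψ : ψ ≠ 1)
    (hχ : ∀ σ : lastGroup K L π h, χ σ = ψ (χbar σ))
    {τ : lastGroup K L π h} (hτ : χbar τ = Multiplicative.ofAdd 1) :
    ∑ σ : lastGroup K L π h with χbar σ ≠ 1,
        upperScalar A (uMap A K L π h σ) ⊗ₜ[ℤ] charValue χ (σ : Gal(L/K)) =
      epsilon A p (charValue ψ (Multiplicative.ofAdd 1)) 1 -
        upperScalar A (fibreProd p χbar) ⊗ₜ[ℤ] 1 := by
  have : CharP (ResidueField B) p :=
    charP_of_injective_algebraMap (algebraMap (ResidueField A) (ResidueField B)).injective p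
  have hfib : ∀ r ∈ Finset.Ico 1 p,
      ∑ σ : lastGroup K L π h with χbar σ = Multiplicative.ofAdd (r : ZMod p),
          upperScalar A (uMap A K L π h σ) ⊗ₜ[ℤ] charValue χ (σ : Gal(L/K)) =
        upperScalar A (r : ResidueField B) ⊗ₜ[ℤ]
            (1 * charValue ψ (Multiplicative.ofAdd 1) ^ r) +
          upperScalar A (fibreProd p χbar) ⊗ₜ[ℤ]
            (charValue ψ (Multiplicative.ofAdd 1) ^ r) := by
    intro r hr
    rw [Finset.mem_Ico] at hr
    have hndvd : ¬ p ∣ r := fun h0 => absurd (Nat.le_of_dvd hr.1 h0) (not_le.2 hr.2)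
    have hval : ∀ σ ∈ Finset.univ.filter (fun σ : lastGroup K L π h =>
        χbar σ = Multiplicative.ofAdd (r : ZMod p)),
        charValue χ (σ : Gal(L/K)) = charValue ψ (Multiplicative.ofAdd 1) ^ r := by
      intro σ hσ
      rw [Finset.mem_filter] at hσ
      apply Subtype.ext
      change (χ σ : C) = (ψ (Multiplicative.ofAdd 1) : C) ^ r
      rw [hχ, hσ.2, apply_natCast, Units.val_pow_eq_pow_val]
    have hne : ∀ σ ∈ Finset.univ.filter (fun σ : lastGroup K L π h =>
        χbar σ = Multiplicative.ofAdd (r : ZMod p)), uMap A K L π h σ ≠ 0 := by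
      intro σ hσ
      rw [Finset.mem_filter] at hσ
      refine uMap_ne_zero K L he hπ H fun h1 => hndvd ?_
      rw [(Subtype.ext h1 : σ = 1), map_one, eq_comm, ofAdd_eq_one, ZMod.natCast_eq_zero_iff] at hσ
      exact hσ.2
    have hprod := prod_fibre_natCast (u := fun σ : lastGroup K L π h => uMap A K L π h σ)
      (fun σ ρ => uMap_mul K L he hπ H p σ.2 ρ.2)
      (fun σ hσ => Subtype.ext (by_contra fun h1 => uMap_ne_zero K L he hπ H h1 hσ)) χbar
      (exists_card_fibre he hπ H p hτ) (r := r) (by rwa [Ne, ZMod.natCast_eq_zero_iff])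
    rw [Finset.sum_congr rfl fun σ hσ => by rw [hval σ hσ], ← TensorProduct.sum_tmul,
      ← upperScalar_prod A _ _ hne, hprod, ← fibreProd, upperScalar_mul A
        (by rwa [Ne, CharP.cast_eq_zero_iff _ p]) (fibreProd_ne_zero he hπ H p),
      TensorProduct.add_tmul, one_mul]
  rw [sum_fibres χbar, Finset.sum_congr rfl hfib, Finset.sum_add_distrib, ← TensorProduct.tmul_sum,
    sum_pow_charValue_eq hψ, TensorProduct.tmul_neg, ← sub_eq_add_neg]
  rfl

open Classical in
-- The kernel of χ̄ drops out as χ - 1 vanishes there. Subtracting the terms with coefficient 1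
-- brings in the class of -φ^(p-1), which combines with [φ] into [-φ^p].
theorem sum_lastGroup_tmul (hψ : ψ ≠ 1)
    (hχ : ∀ σ : lastGroup K L π h, χ σ = ψ (χbar σ))
    {τ : lastGroup K L π h} (hτ : χbar τ = Multiplicative.ofAdd 1) :
    ∑ σ : lastGroup K L π h with σ ≠ 1,
        upperScalar A (uMap A K L π h σ) ⊗ₜ[ℤ] (charValue χ (σ : Gal(L/K)) - 1) =
      epsilon A p (charValue ψ (Multiplicative.ofAdd 1)) 1 -
        upperScalar A (-fibreProd p χbar ^ p) ⊗ₜ[ℤ] 1 := by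
  have hp : p.Prime := Fact.out
  have h1 : ∑ σ : lastGroup K L π h with σ ≠ 1,
        upperScalar A (uMap A K L π h σ) ⊗ₜ[ℤ] (charValue χ (σ : Gal(L/K)) - 1) =
      ∑ σ : lastGroup K L π h with χbar σ ≠ 1,
        upperScalar A (uMap A K L π h σ) ⊗ₜ[ℤ] (charValue χ (σ : Gal(L/K)) - 1) := by
    symm
    refine Finset.sum_subset (fun σ hσ => ?_) (fun σ _ hσ => ?_)
    · rw [Finset.mem_filter] at hσ ⊢
      exact ⟨hσ.1, fun h0 => hσ.2 (by rw [h0, map_one])⟩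
    · have h0 : χbar σ = 1 := by simpa using hσ
      have h2 : charValue χ (σ : Gal(L/K)) = 1 := Subtype.ext (by simp [charValue, hχ, h0])
      rw [h2, sub_self, TensorProduct.tmul_zero]
  have hne : ∀ σ ∈ Finset.univ.filter (fun σ : lastGroup K L π h => χbar σ ≠ 1),
      uMap A K L π h σ ≠ 0 := by
    intro σ hσ
    rw [Finset.mem_filter] at hσ
    exact uMap_ne_zero K L he hπ H fun h0 => hσ.2 (by rw [(Subtype.ext h0 : σ = 1), map_one])
  have hf := fibreProd_ne_zero he hπ H p (χbar := χbar)
  rw [h1, Finset.sum_congr rfl fun σ _ => TensorProduct.tmul_sub _ _ _, Finset.sum_sub_distrib,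
    sum_fibres_tmul he hπ H p hψ hχ hτ, ← TensorProduct.sum_tmul, ← upperScalar_prod A _ _ hne,
    prod_lastGroup_ne_one he hπ H p hτ, sub_sub, ← TensorProduct.add_tmul,
    ← upperScalar_mul A hf (neg_ne_zero.2 (pow_ne_zero _ hf)), mul_neg, mul_pow_sub_one hp.ne_zero]

include p in
open Classical in
-- Outside the last ramification group the class of h - σ(h) is constant on cosets of that group,
-- while χ sums to zero on each of them.
theorem sum_leadClass_outside_eq_zero {ρ : Gal(L/K)} (hρ : ρ ∈ lastGroup K L π h)
    (hρχ : χ ρ ≠ 1) :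
    ∑ σ : Gal(L/K) with σ ∉ lastGroup K L π h,
      leadClass A (unifUpper B hπ) (displacement A K L h σ) ⊗ₜ[ℤ] charValue χ σ = 0 := by
  refine sum_tmul_charValue_eq_zero hρ hρχ _ fun σ hσ s hs => ?_
  obtain ⟨h1, h2⟩ := displacement_mul_of_notMem K L he hπ H p hσ hs
  rw [leadClass, leadClass, h1]
  congr 2

theorem leadClass_of_mem_lastGroup {σ : Gal(L/K)} (hσ : σ ∈ lastGroup K L π h) (hσ1 : σ ≠ 1) :
    leadClass A (unifUpper B hπ) (displacement A K L h σ) =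
      lastBreak A K L h • upperCotangent A ((maximalIdeal B).toCotangent (unifUpper B hπ)) +
        upperScalar A (uMap A K L π h σ) := by
  rw [leadClass, (mem_lastGroup_iff K L he hπ H hσ1).1 hσ]
  rfl

open Classical in
/-- Kato's Swan conductor of a character which is non-trivial on the last ramification group. -/
theorem swan_eq (hψ : ψ ≠ 1)
    (hχ : ∀ σ : lastGroup K L π h, χ σ = ψ (χbar σ))
    {τ : lastGroup K L π h} (hτ : χbar τ = Multiplicative.ofAdd 1) :
    swan A K L p (unifUpper B hπ) h (charValue ψ (Multiplicative.ofAdd 1)) χ =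
      (conductor A K L h • upperCotangent A ((maximalIdeal B).toCotangent (unifUpper B hπ)) +
        upperScalar A (-fibreProd p χbar ^ p) +
        ∑ σ : Gal(L/K) with σ ∉ lastGroup K L π h, upperScalar A (uMap A K L π h σ) -
        Module.finrank (ResidueField A) (ResidueField B) • upperDifferential A
          (KaehlerDifferential.D (ResidueField A) (ResidueField B) (residue B h))) ⊗ₜ[ℤ] 1 := by
  have hρχ : χ τ ≠ 1 := by
    rw [hχ, hτ, ← ψ.map_one, (injective_of_ne_one hψ).ne_iff]
    intro h0
    have h2 : (1 : ZMod p) = 0 := congrArg Multiplicative.toAdd h0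
    exact one_ne_zero h2
  have hχ1 : χ ≠ 1 := fun h0 => hρχ (by rw [h0, MonoidHom.one_apply])
  set D := upperDifferential A
    (KaehlerDifferential.D (ResidueField A) (ResidueField B) (residue B h)) with hD
  set P := upperCotangent A ((maximalIdeal B).toCotangent (unifUpper B hπ)) with hP
  let ℓ : Gal(L/K) → SUpper A B := fun σ =>
    leadClass A (unifUpper B hπ) (displacement A K L h σ)
  -- This gives the coefficient -#G of [dh̄]; the equality #G = [E : F] makes it the coefficient
  -- needed for [dā₀].
  have hsum : ∑ σ ∈ Finset.univ.erase (1 : Gal(L/K)), (charValue χ σ - 1) =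
      -(Module.finrank (ResidueField A) (ResidueField B) : ZTilde C) := by
    have h1 := Finset.add_sum_erase Finset.univ (fun σ : Gal(L/K) => charValue χ σ - 1)
      (Finset.mem_univ 1)
    rw [Finset.sum_sub_distrib (s := Finset.univ), sum_univ_charValue_eq_zero hχ1] at h1
    rw [charValue_one, sub_self, zero_add] at h1
    rw [h1, ← card_gal_eq_finrank_residueField K L he hπ H]
    simp
  have hsumT : ∑ σ : lastGroup K L π h with σ ≠ 1, (charValue χ (σ : Gal(L/K))) = -1 := by
    have h1 := Finset.add_sum_erase Finset.univ (fun σ : lastGroup K L π h => charValue χ (σ : Gal(L/K)))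
      (Finset.mem_univ 1)
    rw [sum_charValue_eq_zero τ.2 hρχ, OneMemClass.coe_one, charValue_one] at h1
    rw [Finset.filter_ne']
    exact eq_neg_of_add_eq_zero_right h1
  -- The value of s_G at 1 is absorbed by replacing χ(σ) by χ(σ) - 1; the inner product of χ with 1
  -- vanishes.
  have hswan : swan A K L p (unifUpper B hπ) h (charValue ψ (Multiplicative.ofAdd 1)) χ =
      ∑ σ ∈ Finset.univ.erase (1 : Gal(L/K)), (D - ℓ σ) ⊗ₜ[ℤ] (charValue χ σ - 1) +
        epsilon A p (charValue ψ (Multiplicative.ofAdd 1)) 1 := by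
    have hne : ∀ σ ∈ Finset.univ.erase (1 : Gal(L/K)),
        sG A K L (unifUpper B hπ) h σ ⊗ₜ[ℤ] charValue χ σ = (D - ℓ σ) ⊗ₜ[ℤ] charValue χ σ :=
      fun σ hσ => by rw [sG, if_neg (Finset.ne_of_mem_erase hσ)]; rfl
    have hone : sG A K L (unifUpper B hπ) h 1 = -∑ σ ∈ Finset.univ.erase (1 : Gal(L/K)), (D - ℓ σ) :=
      if_pos rfl
    rw [swan, innerOne_eq_zero hχ1, sub_zero, ← Finset.add_sum_erase _ _ (Finset.mem_univ 1), hone,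
      charValue_one, TensorProduct.neg_tmul, TensorProduct.sum_tmul, Finset.sum_congr rfl hne,
      neg_add_eq_sub, ← Finset.sum_sub_distrib]
    congr 1
    exact Finset.sum_congr rfl fun σ _ => (TensorProduct.tmul_sub _ _ _).symm
  have hsplit : ∑ σ ∈ Finset.univ.erase (1 : Gal(L/K)), ℓ σ ⊗ₜ[ℤ] (charValue χ σ - 1) =
      -((∑ σ : Gal(L/K) with σ ∉ lastGroup K L π h, ℓ σ) ⊗ₜ[ℤ] (1 : ZTilde C)) +
        (-(lastBreak A K L h • P + ∑ σ : lastGroup K L π h with σ ≠ 1, lastBreak A K L h • P) ⊗ₜ[ℤ] 1 +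
        (epsilon A p (charValue ψ (Multiplicative.ofAdd 1)) 1 -
          upperScalar A (-fibreProd p χbar ^ p) ⊗ₜ[ℤ] 1)) := by
    rw [sum_subgroup_erase (lastGroup K L π h)]
    congr 1
    · rw [Finset.sum_congr rfl fun σ _ => TensorProduct.tmul_sub _ _ _, Finset.sum_sub_distrib,
        sum_leadClass_outside_eq_zero he hπ H p τ.2 hρχ, zero_sub, ← TensorProduct.sum_tmul]
    · rw [← sum_lastGroup_tmul he hπ H p hψ hχ hτ, Finset.sum_congr rfl fun σ hσ => by
        rw [show ℓ σ = _ from leadClass_of_mem_lastGroup he hπ H σ.2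
          (fun h0 => (Finset.mem_filter.1 hσ).2 (Subtype.ext h0)), TensorProduct.add_tmul],
        Finset.sum_add_distrib]
      congr 1
      rw [← TensorProduct.tmul_sum, Finset.sum_sub_distrib, hsumT, TensorProduct.tmul_sub,
        TensorProduct.tmul_neg, TensorProduct.add_tmul, TensorProduct.sum_tmul,
        ← TensorProduct.tmul_sum, ← hP]
      abel
  -- On the non-trivial part of the last ramification group χ sums to -1: this accounts for the
  -- supremum in c, and the terms with coefficient -1 account for the valuations of its elements.
  have hcond : conductor A K L h • P = lastBreak A K L h • P +
      (∑ σ : Gal(L/K) with σ ∉ lastGroup K L π h, ord (displacement A K L h σ) • P +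
        ∑ σ : lastGroup K L π h with σ ≠ 1, lastBreak A K L h • P) := by
    rw [conductor_eq, add_smul, Finset.sum_smul, sum_subgroup_erase (lastGroup K L π h)]
    congr 2
    refine Finset.sum_congr rfl fun σ hσ => ?_
    rw [(mem_lastGroup_iff K L he hπ H
      (fun h0 => (Finset.mem_filter.1 hσ).2 (Subtype.ext h0))).1 σ.2]
  have hl : ∑ σ : Gal(L/K) with σ ∉ lastGroup K L π h, ℓ σ =
      ∑ σ : Gal(L/K) with σ ∉ lastGroup K L π h, ord (displacement A K L h σ) • P +
        ∑ σ : Gal(L/K) with σ ∉ lastGroup K L π h, upperScalar A (uMap A K L π h σ) := by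
    rw [← Finset.sum_add_distrib]
    rfl
  have hfin : ∀ n : ℕ, (n • D) ⊗ₜ[ℤ] (1 : ZTilde C) = n • D ⊗ₜ[ℤ] (1 : ZTilde C) := fun n => by
    rw [← TensorProduct.smul_tmul']
  rw [hswan, Finset.sum_congr rfl fun σ _ => TensorProduct.sub_tmul _ _ _,
    Finset.sum_sub_distrib, hsplit, ← TensorProduct.tmul_sum, hsum, hcond, hl,
    TensorProduct.tmul_neg, ← nsmul_one, TensorProduct.tmul_smul]
  simp only [TensorProduct.add_tmul, TensorProduct.sub_tmul, hfin]
  abel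

/-- The statement about a subgroup `T` known to be the last ramification group. -/
theorem swan_formula_of_eq_lastGroup {T : Subgroup Gal(L/K)} (hT : T = lastGroup K L π h)
    (hψ : ψ ≠ 1) :
    (∃! χbar : T →* Multiplicative (ZMod p), ∀ σ : T, χ σ = ψ (χbar σ)) ∧
    ∀ χbar : T →* Multiplicative (ZMod p), (∀ σ : T, χ σ = ψ (χbar σ)) →
      ∀ τ : T, χbar τ = Multiplicative.ofAdd 1 →
        ∃ s : SLower A B,
          lowerToUpperHom p he H s =
            lowerToUpperHom p he H
                (conductor A K L h • lowerCotangent B ((maximalIdeal A).toCotangent (unifLower hπ)))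
              + upperScalar A
                  (-((kerPoly χbar (uMap A K L π h)).eval (uMap A K L π h τ)) ^ p)
              + sumOutside T (fun σ => upperScalar A (uMap A K L π h σ))
              - lowerToUpperHom p he H
                  (lowerDifferential B
                    ⟨KaehlerDifferential.D ℤ (ResidueField A) a₀, H.D_mem_ker p⟩) ∧
          swan A K L p (unifUpper B hπ) h (charValue ψ (Multiplicative.ofAdd 1)) χ =
            lowerToUpperHom p he H s ⊗ₜ[ℤ] (1 : ZTilde C) := by
  classical
  subst hT
  refine ⟨existsUnique_factorization hψ (χ.comp (lastGroup K L π h).subtype) fun σ => ?_,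
    fun χbar hχ τ hτ => ?_⟩
  · have h1 : σ ^ p = 1 := Subtype.ext (pow_eq_one_of_mem_lastGroup K L he hπ H p σ.2)
    rw [← map_pow, h1, map_one]
  -- c in F maps to the product of -φ^p and the u_σ outside the last ramification group, so these
  -- factors come from S_{K,L} jointly.
  obtain ⟨c, hc⟩ := neg_fibreProd_pow_mul_mem_range he hπ H p hψ hχ hτ
  have hf := neg_ne_zero.2 (pow_ne_zero p (fibreProd_ne_zero he hπ H p (χbar := χbar)))
  have hne : ∀ σ ∈ Finset.univ.filter (fun σ : Gal(L/K) => σ ∉ lastGroup K L π h),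
      uMap A K L π h σ ≠ 0 := fun σ hσ =>
    uMap_ne_zero K L he hπ H fun h0 => (Finset.mem_filter.1 hσ).2 (h0 ▸ one_mem _)
  have hprod := Finset.prod_ne_zero_iff.2 hne
  have hc0 : c ≠ 0 := by
    rintro rfl
    rw [map_zero] at hc
    exact mul_ne_zero hf hprod hc.symm
  have hout : sumOutside (lastGroup K L π h) (fun σ => upperScalar A (uMap A K L π h σ)) =
      ∑ σ : Gal(L/K) with σ ∉ lastGroup K L π h, upperScalar A (uMap A K L π h σ) := rfl
  -- The witness is v·[π] + [c] - [dā₀] in S_{K,L}, where v is the conductor: each of its three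
  -- terms is already defined over K.
  have hs : lowerToUpperHom p he H
        (conductor A K L h • lowerCotangent B ((maximalIdeal A).toCotangent (unifLower hπ)) +
          unitClass (algebraMap (ResidueField A) (LowerAlgebra A B) c) -
          lowerDifferential B
            ⟨KaehlerDifferential.D ℤ (ResidueField A) a₀, H.D_mem_ker p⟩) =
      lowerToUpperHom p he H
          (conductor A K L h • lowerCotangent B ((maximalIdeal A).toCotangent (unifLower hπ))) +
        upperScalar A (-fibreProd p χbar ^ p) +
        ∑ σ : Gal(L/K) with σ ∉ lastGroup K L π h, upperScalar A (uMap A K L π h σ) -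
        lowerToUpperHom p he H
          (lowerDifferential B
            ⟨KaehlerDifferential.D ℤ (ResidueField A) a₀, H.D_mem_ker p⟩) := by
    rw [map_sub, map_add, lowerToUpperHom_scalar p he H hc0, hc, upperScalar_mul A hf hprod,
      upperScalar_prod A _ _ hne, ← add_assoc]
  refine ⟨_, hs.trans ?_, ?_⟩
  · rw [eval_kerPoly he hπ H p hτ, hout]
  · rw [hs, swan_eq he hπ H p hψ hχ hτ, map_nsmul, lowerToUpperHom_lowerCotangent p he H hπ,
      lowerToUpperHom_lowerDifferential p he H]

end SwanFormula

end KatoSwan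

theorem proposition10p2 {p : ℕ} [Fact p.Prime]
    -- `K` is a complete discrete valuation field with ring of integers `A`
    {K : Type*} [NontriviallyNormedField K] [IsUltrametricDist K] [CompleteSpace K]
    {A : Type*} [CommRing A] [IsDomain A] [IsDiscreteValuationRing A]
    [Algebra A K] [IsFractionRing A K]
    (hA : ∀ x : K, ‖x‖ ≤ 1 ↔ ∃ a : A, algebraMap A K a = x)
    -- the residue field has characteristic `p` and is finitely generated over a perfect field
    [CharP (ResidueField A) p]
    {F₀ : Type*} [Field F₀] [PerfectField F₀] [Algebra F₀ (ResidueField A)]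
    [Algebra.EssFiniteType F₀ (ResidueField A)]
    -- `L / K` is a finite Galois extension and `B` is the ring of integers of `L`
    {L : Type*} [Field L] [Algebra K L] [FiniteDimensional K L] [IsGalois K L]
    {B : Type*} [CommRing B] [IsDomain B] [IsDiscreteValuationRing B]
    [Algebra A B] [IsLocalHom (algebraMap A B)] [Algebra B L] [Algebra A L]
    [IsScalarTower A B L] [IsScalarTower A K L] [IsIntegralClosure B A L]
    -- `L / K` is of type (II): the ramification index is one, and the residue extension is
    -- non-trivial, purely inseparable and generated by the residue class of `h`
    (he : (maximalIdeal A).map (algebraMap A B) = maximalIdeal B)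
    (h : B) (a₀ : ResidueField A) (H : IsInsepGenerator (ResidueField A) (residue B h) a₀)
    (π : A) (hπ : Irreducible π)
    {C : Type*} [Field C] [IsAlgClosed C] [CharZero C]
    (ψ₀ : Multiplicative (ZMod p) →* Cˣ) (hψ₀ : ψ₀ ≠ 1)
    (χ : Gal(L/K) →* Cˣ) (hχ : ∃ σ ∈ topGroup A K L π h, χ σ ≠ 1) :
    (∃! χbar : topGroup A K L π h →* Multiplicative (ZMod p),
      ∀ σ : topGroup A K L π h, χ σ = ψ₀ (χbar σ)) ∧
    ∀ χbar : topGroup A K L π h →* Multiplicative (ZMod p),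
      (∀ σ : topGroup A K L π h, χ σ = ψ₀ (χbar σ)) →
      ∀ τ : topGroup A K L π h, χbar τ = Multiplicative.ofAdd 1 →
        ∃ s : SLower A B,
          lowerToUpperHom p he H s =
            lowerToUpperHom p he H
                (conductor A K L h • lowerCotangent B ((maximalIdeal A).toCotangent (unifLower hπ)))
              + upperScalar A
                  (-((kerPoly χbar (uMap A K L π h)).eval (uMap A K L π h τ)) ^ p)
              + sumOutside (topGroup A K L π h) (fun σ => upperScalar A (uMap A K L π h σ))
              - lowerToUpperHom p he H
                  (lowerDifferential B
                    ⟨KaehlerDifferential.D ℤ (ResidueField A) a₀, H.D_mem_ker p⟩) ∧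
          swan A K L p (unifUpper B hπ) h (charValue ψ₀ (Multiplicative.ofAdd 1)) χ =
            lowerToUpperHom p he H s ⊗ₜ[ℤ] (1 : ZTilde C) := by
  have := hχ
  exact swan_formula_of_eq_lastGroup he hπ H p (topGroup_eq_lastGroup hA he hπ H) hψ₀
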